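/- Let $n\ge 1$, let $\mathbb S^n\subset\mathbb R^{n+1}$ be the unit sphere with round metric $\bar g$, area $\omega_n$ and surface measure $d\theta$, let $B(1)$ be the unit ball of $\mathbb R^{n+1}$, and let $V$ denote volume. For a convex body $\Omega\subset\mathbb R^{n+1}$ and $z\in\mathbb R^{n+1}$ let $u_z(x)=\max_{y\in\Omega}\langle x,y-z\rangle$ be the support function of $\Omega$ with respect to $z$; the entropy of $\Omega$ is $$\mathcal E(\Omega)=\sup_{z:\,u_z>0}\frac1{\omega_n}\int_{\mathbb S^n}\log u_z\,d\theta,$$ and an entropy point of $\Omega$ is a point $z\in\Omega$ with $\frac1{\omega_n}\int_{\mathbb S^n}\log u_z\,d\theta=\mathcal E(\Omega)$. A positive solution of the normalized Gauss curvature flow is a smooth function $u>0$ on $\mathbb S^n\times[0,\infty)$ such that $\bar\nabla^2u+u\,\bar g$ is positive definite at every point and time and $$\frac{\partial u}{\partial t}=u-\frac1{\det\big(\bar g^{ik}(\bar\nabla_k\bar\nabla_ju+u\,\bar g_{kj})\big)}.$$ Theorem. For every $n\ge1$ and $A\in\mathbb R$ there is $\delta=\delta(n,A)>0$ such that the following holds.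 Let $\Omega_0\subset\mathbb R^{n+1}$ be a convex body with $V(\Omega_0)=V(B(1))$ and $\mathcal E(\Omega_0)\le A$. Then there are constants $\epsilon>0$ and $\Lambda>0$, depending only on $n$ and $\Omega_0$, such that every positive solution $u$ of the normalized Gauss curvature flow for which $u(\cdot,0)$ is the support function of $\Omega_0$ (with respect to the origin) satisfies $$\epsilon\le u(x,t)\le\Lambda\qquad\text{for all }x\in\mathbb S^n,\ t\ge0 .$$ Moreover, for each $t\ge0$ the function $u(\cdot,t)$ is the support function, with respect to the origin, of a convex body $\Omega_t$ (equal to the given $\Omega_0$ at $t=0$); $\Omega_t$ has exactly one entropy point $e(t)$; $e(t)\to0$ as $t\to\infty$; and $\operatorname{dist}(e(t),\partial\Omega_t)\ge\delta$ for all $t\ge0$. -/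

import Mathlib

open scoped ContDiff

noncomputable section

namespace GaussFlow

/-- The ambient Euclidean space of dimension `n + 1`. -/
abbrev Eucl (n : ℕ) : Type := EuclideanSpace ℝ (Fin (n + 1))

/-- The unit sphere of dimension `n`. -/
abbrev Sph (n : ℕ) : Type := Metric.sphere (0 : Eucl n) 1

/-- The tangent space of the unit sphere at `x`, the orthogonal complement of `x`. -/
abbrev Tangent {n : ℕ} (x : Sph n) : Submodule ℝ (Eucl n) := (Submodule.span ℝ {(x : Eucl n)})ᗮ

/-- The surface measure of the unit sphere. -/
abbrev sphereMeasure (n : ℕ) : MeasureTheory.Measure (Sph n) :=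
  (MeasureTheory.volume : MeasureTheory.Measure (Eucl n)).toSphere

theorem normalize_mem {n : ℕ} {z : Eucl n} (hz : z ≠ 0) :
    ‖z‖⁻¹ • z ∈ Metric.sphere (0 : Eucl n) 1 := by
  have h : ‖z‖ ≠ 0 := norm_ne_zero_iff.mpr hz
  rw [mem_sphere_zero_iff_norm, norm_smul, norm_inv, norm_norm, inv_mul_cancel₀ h]

/-- The extension of a function on the sphere to the punctured space which is constant along rays,
`z ↦ f (z / |z|)` (the value at the origin plays no role). -/
def radialExt {n : ℕ} (f : Sph n → ℝ) (z : Eucl n) : ℝ :=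
  open Classical in
  if hz : z = 0 then 0 else f ⟨‖z‖⁻¹ • z, normalize_mem hz⟩

/-- The covariant Hessian of `f` at `x` for the round metric. The extension that is constant along
rays has vanishing radial derivative, and geodesics (great circles) satisfy `γ'' = -γ`, so its
ordinary second derivative on tangent vectors is the covariant Hessian. -/
def sphereHess {n : ℕ} (f : Sph n → ℝ) (x : Sph n) (v w : Tangent x) : ℝ :=
  fderiv ℝ (fderiv ℝ (radialExt f)) (x : Eucl n) (v : Eucl n) (w : Eucl n)

/-- The bilinear form `∇²f + f g` on the tangent space at `x`. -/
def formA {n : ℕ} (f : Sph n → ℝ) (x : Sph n) (v w : Tangent x) : ℝ :=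
  sphereHess f x v w + f x * inner ℝ v w

/-- Positive definiteness of `∇²f + f g` at every point. -/
def APos {n : ℕ} (f : Sph n → ℝ) : Prop :=
  ∀ (x : Sph n) (v : Tangent x), v ≠ 0 → 0 < formA f x v v

/-- The determinant of the endomorphism `g⁻¹ (∇²f + f g)`, computed in an orthonormal basis of the
tangent space. -/
def detA {n : ℕ} (f : Sph n → ℝ) (x : Sph n) : ℝ :=
  Matrix.det (Matrix.of fun i j =>
    formA f x (stdOrthonormalBasis ℝ (Tangent x) i) (stdOrthonormalBasis ℝ (Tangent x) j))

/-- The Gauss curvature, as a function of the outer normal `x`, of the hypersurface with support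
function `f`. -/
def gaussCurv {n : ℕ} (f : Sph n → ℝ) (x : Sph n) : ℝ := 1 / detA f x

/-- `u` is a positive long-time solution of the normalized Gauss curvature flow: it is smooth on
`Sⁿ × [0, ∞)` (smoothness is expressed through the extension constant along rays), positive, the
form `∇²u + u g` is positive definite at every time, and `∂u/∂t = u - K`. Only the values at times
`t ≥ 0` matter. -/
structure IsPositiveSolution {n : ℕ} (u : ℝ → Sph n → ℝ) : Prop where
  smooth : ContDiffOn ℝ ∞ (fun p : ℝ × Eucl n => radialExt (u p.1) p.2)
    (Set.Ici (0 : ℝ) ×ˢ {(0 : Eucl n)}ᶜ)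
  pos : ∀ t, 0 ≤ t → ∀ x, 0 < u t x
  convex : ∀ t, 0 ≤ t → APos (u t)
  flow : ∀ t, 0 ≤ t → ∀ x,
    HasDerivWithinAt (fun s => u s x) (u t x - gaussCurv (u t) x) (Set.Ici 0) t

/-- The support function of `Ω` with respect to the point `z₀`. -/
def supportFn {n : ℕ} (Ω : ConvexBody (Eucl n)) (z₀ : Eucl n) (x : Sph n) : ℝ :=
  sSup ((fun z : Eucl n => inner ℝ (x : Eucl n) (z - z₀)) '' (Ω : Set (Eucl n)))

/-- The mean over the sphere of the logarithm of the support function with respect to `z₀`. -/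
def meanLog {n : ℕ} (Ω : ConvexBody (Eucl n)) (z₀ : Eucl n) : ℝ :=
  ((sphereMeasure n).real Set.univ)⁻¹ * ∫ x, Real.log (supportFn Ω z₀ x) ∂(sphereMeasure n)

/-- The entropy of a convex body (with non-empty interior): the supremum of the mean logarithm over
all positive support functions. -/
def entropy {n : ℕ} (Ω : ConvexBody (Eucl n)) : ℝ :=
  sSup (meanLog Ω '' {z₀ | ∀ x, 0 < supportFn Ω z₀ x})

/-- `e` is an entropy point of `Ω`: a point of `Ω` at which the entropy is attained. The first two
conditions after membership say that the integral of the logarithm is a genuine finite one; for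
other points of `Ω` it is `-∞`. -/
structure IsEntropyPoint {n : ℕ} (Ω : ConvexBody (Eucl n)) (e : Eucl n) : Prop where
  mem : e ∈ Ω
  ae_pos : ∀ᵐ x ∂(sphereMeasure n), 0 < supportFn Ω e x
  integrable : MeasureTheory.Integrable (fun x => Real.log (supportFn Ω e x)) (sphereMeasure n)
  attained : meanLog Ω e = entropy Ω

end GaussFlow

end

/-! The engine is a monotonicity with a moving centre. The point `e^{t-T} z` solves `z' = z`, so the
support function `w` of `Ω_t` with respect to it again satisfies `∂w/∂t = w - K`. Hence the time
derivative of `∫ log w` is `∫ (1 - K/w) ≤ ∫ (w/K - 1)`. The last integral vanishes because `∫ w/K`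
is `(n+1)` times the volume, which the flow keeps at `V(B(1))`. Thus the mean logarithm of `Ω_T` at
`z` is at most that of `Ω_t` at `e^{t-T} z` (`integral_log_le`), and in particular the entropy
decreases and stays below `A`.

Three static facts about convex bodies complete the picture. The entropy bounds the diameter by some
`D` (`exists_diam_le`). Under bounds on volume and diameter the mean logarithm has a maximizer at
distance at least `δ` from the boundary (`exists_maximizer`): by compactness one reaches a limit
whose support function vanishes in some direction, and a shift away from the contact directions
increases the mean logarithm there, as a reflection argument shows. Finally the mean logarithm is
uniformly strictly concave (`exists_stability`), which makes the maximizer unique and yields, with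
monotonicity, `k ‖e(t) - e^{t-T} e(T)‖² ≤ E(t) - E(T)` for `t ≤ T`, where `E(t)` is the entropy of
`Ω_t`.

The conclusion is read off from this inequality. Since `‖e‖ ≤ D` and `E` decreases to a limit, `T →
∞` gives `k ‖e(t)‖² ≤ E(t) - lim E → 0`. The upper bound on `u` is the diameter bound, the origin
being in `Ω_t`. For the lower bound, `E` cannot drop a fixed amount too many times, so within a
bounded waiting time `e` comes within `δ/2` of the origin; there `u ≥ δ/2`, and since `∂u/∂t ≤ u`
this bound propagates backwards with an exponential loss.

Volume preservation is proved without integration by parts: the volume of the body at time `s` is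
bounded by an explicit integral over the body at time `t`, with equality at `s = t`, so both have
the same derivative there (`hasDerivAt_totalVolume`). -/

noncomputable section

namespace GaussFlow

open scoped ContDiff Pointwise
open MeasureTheory Set Metric

variable {n : ℕ}

/-! ### Integration over the sphere: rotation invariance and integrability of logarithms. -/

section SphereMeasure

/-- A fixed point of the sphere. -/
def northPole (n : ℕ) : Sph n :=
  ⟨EuclideanSpace.single 0 1, by simp⟩

/-- Radial projection to the sphere (the origin is sent to the north pole). -/
def toSph (y : Eucl n) : Sph n :=
  open Classical in
  if hy : y = 0 then northPole n else ⟨‖y‖⁻¹ • y, normalize_mem hy⟩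

theorem coe_toSph {y : Eucl n} (hy : y ≠ 0) : (toSph y : Eucl n) = ‖y‖⁻¹ • y := by
  simp [toSph, hy]

theorem norm_smul_toSph {y : Eucl n} (hy : y ≠ 0) : ‖y‖ • (toSph y : Eucl n) = y := by
  rw [coe_toSph hy, smul_smul, mul_inv_cancel₀ (norm_ne_zero_iff.mpr hy), one_smul]

theorem sph_norm (x : Sph n) : ‖(x : Eucl n)‖ = 1 := by simp

theorem sph_ne_zero (x : Sph n) : (x : Eucl n) ≠ 0 := by
  intro h
  have := sph_norm x
  simp [h] at this

theorem toSph_smul {r : ℝ} (hr : 0 < r) (x : Sph n) : toSph (r • (x : Eucl n)) = x := by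
  have h : r • (x : Eucl n) ≠ 0 := smul_ne_zero hr.ne' (sph_ne_zero x)
  apply Subtype.ext
  rw [coe_toSph h, norm_smul, sph_norm, smul_smul, Real.norm_of_nonneg hr.le, mul_one,
    inv_mul_cancel₀ hr.ne', one_smul]

theorem toSph_coe (x : Sph n) : toSph (x : Eucl n) = x := by
  simpa using toSph_smul one_pos x

theorem radialExt_eq (f : Sph n → ℝ) {y : Eucl n} (hy : y ≠ 0) : radialExt f y = f (toSph y) := by
  simp [radialExt, toSph, hy]

theorem radialExt_coe (f : Sph n → ℝ) (x : Sph n) : radialExt f x = f x := by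
  rw [radialExt_eq f (sph_ne_zero x), toSph_coe]

theorem radialExt_smul (f : Sph n → ℝ) {r : ℝ} (hr : 0 < r) (y : Eucl n) :
    radialExt f (r • y) = radialExt f y := by
  by_cases hy : y = 0
  · simp [hy]
  · rw [radialExt_eq f (smul_ne_zero hr.ne' hy), radialExt_eq f hy]
    conv_lhs => rw [← norm_smul_toSph hy, smul_smul]
    rw [toSph_smul (mul_pos hr (norm_pos_iff.mpr hy))]

theorem measurable_toSph : Measurable (toSph : Eucl n → Sph n) := by
  classical
  have : (fun y : Eucl n => (toSph y : Eucl n)) =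
      fun y => if y = 0 then (northPole n : Eucl n) else ‖y‖⁻¹ • y := by
    funext y
    by_cases hy : y = 0 <;> simp [toSph, hy]
  have hm : Measurable fun y : Eucl n => (toSph y : Eucl n) := by
    rw [this]
    exact Measurable.ite (measurableSet_singleton 0) measurable_const (by fun_prop)
  exact hm.subtype_mk

theorem ball_diff_preimage_toSph (s : Set (Sph n)) :
    (toSph ⁻¹' s) ∩ (ball (0 : Eucl n) 1 \ {0}) = Ioo (0 : ℝ) 1 • ((↑) '' s : Set (Eucl n)) := by
  ext y
  simp only [mem_inter_iff, mem_preimage, mem_sdiff, mem_ball_zero_iff, mem_singleton_iff,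
    Set.mem_smul, mem_image, mem_Ioo]
  constructor
  · rintro ⟨hs, hy, h0⟩
    exact ⟨‖y‖, ⟨norm_pos_iff.mpr h0, hy⟩, _, ⟨_, hs, rfl⟩, norm_smul_toSph h0⟩
  · rintro ⟨r, ⟨hr, hr1⟩, _, ⟨x, hx, rfl⟩, rfl⟩
    rw [toSph_smul hr]
    refine ⟨hx, ?_, smul_ne_zero hr.ne' (sph_ne_zero x)⟩
    rw [norm_smul, sph_norm, Real.norm_of_nonneg hr.le, mul_one]
    exact hr1

/-- Turns spherical integrals into Lebesgue integrals over the ball; the factor is the dimension of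
the ambient space. -/
theorem sphereMeasure_eq (n : ℕ) : sphereMeasure n =
    ((n + 1 : ℕ) : ENNReal) • (volume.restrict (ball (0 : Eucl n) 1)).map toSph := by
  ext s hs
  rw [Measure.toSphere_apply' _ hs, Measure.smul_apply, Measure.map_apply measurable_toSph hs,
    Measure.restrict_apply (measurable_toSph hs), finrank_euclideanSpace_fin, smul_eq_mul,
    ← ball_diff_preimage_toSph, ← inter_sdiff_assoc,
    measure_sdiff_null (measure_singleton _)]

theorem lintegral_sphere {h : Sph n → ENNReal} (hh : Measurable h) :
    ∫⁻ x, h x ∂(sphereMeasure n) = ((n + 1 : ℕ) : ENNReal) *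
      ∫⁻ y in ball (0 : Eucl n) 1, h (toSph y) := by
  rw [sphereMeasure_eq, lintegral_smul_measure, lintegral_map hh measurable_toSph, smul_eq_mul]

/-- The action of a linear isometry on the sphere. -/
def sphMap (L : Eucl n ≃ₗᵢ[ℝ] Eucl n) : Sph n ≃ᵐ Sph n where
  toFun x := ⟨L x, by simp⟩
  invFun x := ⟨L.symm x, by simp⟩
  left_inv x := by simp
  right_inv x := by simp
  measurable_toFun := by
    apply Measurable.subtype_mk
    exact L.continuous.measurable.comp measurable_subtype_coe
  measurable_invFun := by
    apply Measurable.subtype_mk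
    exact L.symm.continuous.measurable.comp measurable_subtype_coe

@[simp] theorem coe_sphMap (L : Eucl n ≃ₗᵢ[ℝ] Eucl n) (x : Sph n) :
    (sphMap L x : Eucl n) = L x := rfl

/-- The measure of a subset of the sphere is that of the cone over it, up to a factor, and linear
isometries map cones to cones. -/
theorem measurePreserving_sphMap (L : Eucl n ≃ₗᵢ[ℝ] Eucl n) :
    MeasurePreserving (sphMap L) (sphereMeasure n) (sphereMeasure n) := by
  refine ⟨(sphMap L).measurable, ?_⟩
  have key : ∀ s : Set (Sph n), (Ioo (0 : ℝ) 1 • ((↑) '' (sphMap L ⁻¹' s) : Set (Eucl n))) =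
      L ⁻¹' (Ioo (0 : ℝ) 1 • ((↑) '' s)) := by
    intro s
    ext y
    simp only [Set.mem_smul, mem_image, mem_preimage]
    constructor
    · rintro ⟨r, hr, _, ⟨x, hx, rfl⟩, rfl⟩
      exact ⟨r, hr, _, ⟨_, hx, rfl⟩, by simp⟩
    · rintro ⟨r, hr, _, ⟨x, hx, rfl⟩, h⟩
      refine ⟨r, hr, _, ⟨(sphMap L).symm x, by simpa using hx, rfl⟩, ?_⟩
      apply L.injective
      rw [← h, map_smul]
      congr 1
      exact congrArg Subtype.val ((sphMap L).apply_symm_apply x)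
  ext s hs
  rw [Measure.map_apply (sphMap L).measurable hs, Measure.toSphere_apply' _ hs,
    Measure.toSphere_apply' _ ((sphMap L).measurable hs), key]
  have hL : MeasurePreserving L.toMeasurableEquiv volume volume := L.measurePreserving
  exact congrArg _ (hL.measure_preimage_equiv _)

theorem integral_sphMap (L : Eucl n ≃ₗᵢ[ℝ] Eucl n) (g : Sph n → ℝ) :
    ∫ x, g (sphMap L x) ∂(sphereMeasure n) = ∫ x, g x ∂(sphereMeasure n) :=
  (measurePreserving_sphMap L).integral_comp (sphMap L).measurableEmbedding g

theorem exists_isometry (x y : Sph n) : ∃ L : Eucl n ≃ₗᵢ[ℝ] Eucl n, sphMap L x = y := by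
  refine ⟨(ℝ ∙ ((x : Eucl n) - y))ᗮ.reflection, Subtype.ext ?_⟩
  exact Submodule.reflection_sub (by simp)

theorem sphereMeasure_univ_pos (n : ℕ) : 0 < (sphereMeasure n).real univ := by
  have : (sphereMeasure n) univ ≠ 0 := by
    have : Nonempty (Sph n) := ⟨northPole n⟩
    exact isOpen_univ.measure_ne_zero _ univ_nonempty
  exact ENNReal.toReal_pos this (measure_ne_top _ _)

theorem integrable_of_continuous {g : Sph n → ℝ} (hg : Continuous g) :
    Integrable g (sphereMeasure n) :=
  hg.integrable_of_hasCompactSupport (HasCompactSupport.of_compactSpace g)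

/-- By rotation invariance the integral depends on `v` only through its length. This supplies the
quadratic term in `exists_stability`. -/
theorem exists_secondMoment (n : ℕ) : ∃ c : ℝ, 0 < c ∧ ∀ v : Eucl n,
    ∫ x : Sph n, (inner ℝ (x : Eucl n) v) ^ 2 ∂(sphereMeasure n) = c * ‖v‖ ^ 2 := by
  refine ⟨∫ x : Sph n, (inner ℝ (x : Eucl n) (northPole n : Eucl n)) ^ 2 ∂(sphereMeasure n),
    ?_, ?_⟩
  · have hc : Continuous fun x : Sph n => (inner ℝ (x : Eucl n) (northPole n : Eucl n)) ^ 2 := by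
      fun_prop
    apply hc.integral_pos_of_hasCompactSupport_nonneg_nonzero (HasCompactSupport.of_compactSpace _)
      (fun x => sq_nonneg _) (x := northPole n)
    simp
  · intro v
    by_cases hv : v = 0
    · simp [hv]
    obtain ⟨L, hL⟩ := exists_isometry (toSph v) (northPole n)
    rw [← integral_sphMap L fun x => (inner ℝ (x : Eucl n) (northPole n : Eucl n)) ^ 2,
      ← integral_mul_const]
    congr 1
    funext x
    conv_lhs => rw [← norm_smul_toSph hv, inner_smul_right]
    rw [← hL, coe_sphMap, coe_sphMap, L.inner_map_map]
    ring

/-- In the ball `|y 0| ≤ |y 0| / ‖y‖ ≤ 1`, so the logarithm is dominated by `log |y 0|`, which is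
integrable over a box by the one-dimensional case. -/
theorem integrable_log_abs_inner_pole (n : ℕ) :
    Integrable (fun x : Sph n => Real.log |inner ℝ (x : Eucl n) (northPole n : Eucl n)|)
      (sphereMeasure n) := by
  have hmeas : Measurable
      fun x : Sph n => Real.log |inner ℝ (x : Eucl n) (northPole n : Eucl n)| := by
    apply Real.measurable_log.comp
    have : Continuous fun x : Sph n => |inner ℝ (x : Eucl n) (northPole n : Eucl n)| := by fun_prop
    exact this.measurable
  rw [sphereMeasure_eq]
  refine Integrable.smul_measure ?_ (by simp)
  rw [integrable_map_measure hmeas.aestronglyMeasurable measurable_toSph.aemeasurable]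
  have hinner : ∀ y : Eucl n, inner ℝ y (northPole n : Eucl n) = y 0 := by
    intro y
    simp [northPole, EuclideanSpace.inner_single_right]
  have h1 : IntegrableOn (fun y : Eucl n => Real.log (y 0)) (ball 0 1) := by
    have hbox : IntegrableOn (fun y : Fin (n + 1) → ℝ => Real.log (y 0))
        (Set.pi univ fun _ => Icc (-1 : ℝ) 1) := by
      rw [IntegrableOn, volume_pi, Measure.restrict_pi_pi]
      refine integrable_comp_eval (i := (0 : Fin (n + 1))) (f := Real.log)
        (μ := fun _ : Fin (n + 1) => (volume : Measure ℝ).restrict (Icc (-1 : ℝ) 1)) ?_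
      have := (intervalIntegral.intervalIntegrable_log' (a := -1) (b := 1))
      rw [intervalIntegrable_iff_integrableOn_Icc_of_le (by norm_num)] at this
      exact this
    have := ((PiLp.volume_preserving_ofLp (Fin (n + 1))).integrableOn_comp_preimage
      (MeasurableEquiv.toLp 2 (Fin (n + 1) → ℝ)).symm.measurableEmbedding).mpr hbox
    refine this.mono_set ?_
    intro y hy
    simp only [mem_preimage, Set.mem_pi, mem_univ, forall_const, mem_Icc]
    intro i
    rw [mem_ball_zero_iff] at hy
    have h := PiLp.norm_apply_le y i
    rw [Real.norm_eq_abs] at h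
    exact abs_le.mp (h.trans hy.le)
  refine Integrable.mono h1 (hmeas.comp measurable_toSph).aestronglyMeasurable ?_
  rw [ae_restrict_iff' measurableSet_ball]
  have h0 : ∀ᵐ y : Eucl n, y ≠ 0 := by
    rw [ae_iff]; simp
  filter_upwards [h0] with y hy hy1
  rw [mem_ball_zero_iff] at hy1
  simp only [Function.comp_apply]
  rw [coe_toSph hy, inner_smul_left, hinner, Real.norm_eq_abs, Real.norm_eq_abs, abs_mul]
  simp only [conj_trivial, abs_inv, abs_norm]
  have hyp : 0 < ‖y‖ := norm_pos_iff.mpr hy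
  by_cases hz : y 0 = 0
  · simp [hz]
  have habs : 0 < |y 0| := abs_pos.mpr hz
  have hle : |y 0| ≤ ‖y‖ := by
    have h := PiLp.norm_apply_le y 0
    rwa [Real.norm_eq_abs] at h
  rw [← Real.log_abs (y 0), abs_of_nonpos (a := Real.log (‖y‖⁻¹ * |y 0|)),
    abs_of_nonpos (a := Real.log |y 0|)]
  · apply neg_le_neg
    apply Real.log_le_log habs
    rw [inv_mul_eq_div, le_div_iff₀ hyp]
    nlinarith
  · exact Real.log_nonpos habs.le (hle.trans hy1.le)
  · apply Real.log_nonpos (by positivity)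
    rw [inv_mul_eq_div, div_le_one hyp]
    exact hle

theorem log_abs_inner_rotate (x : Sph n) : ∃ L : Eucl n ≃ₗᵢ[ℝ] Eucl n, ∀ y : Sph n,
    Real.log |inner ℝ (y : Eucl n) (x : Eucl n)| =
      Real.log |inner ℝ (sphMap L y : Eucl n) (northPole n : Eucl n)| := by
  obtain ⟨L, hL⟩ := exists_isometry x (northPole n)
  refine ⟨L, fun y => ?_⟩
  rw [← hL, coe_sphMap, coe_sphMap, L.inner_map_map]

theorem integrable_log_abs_inner (ξ : Sph n) :
    Integrable (fun x : Sph n => Real.log |inner ℝ (x : Eucl n) (ξ : Eucl n)|)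
      (sphereMeasure n) := by
  obtain ⟨L, hL⟩ := log_abs_inner_rotate ξ
  simp only [hL]
  exact ((measurePreserving_sphMap L).integrable_comp_emb (sphMap L).measurableEmbedding).mpr
    (integrable_log_abs_inner_pole n)

theorem integral_log_abs_inner (ξ : Sph n) :
    ∫ x : Sph n, Real.log |inner ℝ (x : Eucl n) (ξ : Eucl n)| ∂(sphereMeasure n) =
    ∫ x : Sph n, Real.log |inner ℝ (x : Eucl n) (northPole n : Eucl n)| ∂(sphereMeasure n) := by
  obtain ⟨L, hL⟩ := log_abs_inner_rotate ξ
  simp only [hL]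
  exact integral_sphMap L
    fun x => Real.log |inner ℝ (x : Eucl n) (northPole n : Eucl n)|

theorem ae_inner_ne_zero (ξ : Sph n) :
    ∀ᵐ x : Sph n ∂(sphereMeasure n), inner ℝ (x : Eucl n) (ξ : Eucl n) ≠ 0 := by
  have hm : MeasurableSet {x : Sph n | inner ℝ (x : Eucl n) (ξ : Eucl n) = 0} := by
    have : Continuous fun x : Sph n => inner ℝ (x : Eucl n) (ξ : Eucl n) := by fun_prop
    exact this.measurable (measurableSet_singleton 0)
  rw [ae_iff]
  simp only [ne_eq, not_not]
  rw [Measure.toSphere_apply' _ hm]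
  have hsub : (Ioo (0 : ℝ) 1 •
      ((↑) '' {x : Sph n | inner ℝ (x : Eucl n) (ξ : Eucl n) = 0} : Set (Eucl n))) ⊆
      ((Submodule.span ℝ {(ξ : Eucl n)})ᗮ : Submodule ℝ (Eucl n)) := by
    rintro _ ⟨r, hr, _, ⟨x, hx, rfl⟩, rfl⟩
    refine Submodule.smul_mem _ r ?_
    rw [Submodule.mem_orthogonal_singleton_iff_inner_left]
    exact hx
  rw [measure_mono_null hsub, mul_zero]
  refine Measure.addHaar_submodule _ _ fun h => sph_ne_zero ξ ?_
  rw [Submodule.orthogonal_eq_top_iff, Submodule.span_singleton_eq_bot] at h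
  exact h

end SphereMeasure

/-! ### Support functions, the mean logarithm and its strict concavity. -/

section SupportFunctions

/-- The support function of a set, on the whole space. -/
def supp (K : Set (Eucl n)) (v : Eucl n) : ℝ := sSup ((fun z : Eucl n => inner ℝ v z) '' K)

section supp

variable {K : Set (Eucl n)}

theorem inner_le_supp (hK : IsCompact K) (v : Eucl n) {y : Eucl n} (hy : y ∈ K) :
    inner ℝ v y ≤ supp K v :=
  le_csSup (hK.image (by fun_prop)).bddAbove ⟨y, hy, rfl⟩

theorem exists_supp_eq (hK : IsCompact K) (hne : K.Nonempty) (v : Eucl n) :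
    ∃ y ∈ K, supp K v = inner ℝ v y := by
  obtain ⟨y, hy, h⟩ := (hK.image (f := fun z : Eucl n => inner ℝ v z) (by fun_prop)).sSup_mem
    (hne.image _)
  exact ⟨y, hy, h.symm⟩

theorem supp_le (hK : IsCompact K) (hne : K.Nonempty) {v : Eucl n} {c : ℝ}
    (h : ∀ y ∈ K, inner ℝ v y ≤ c) : supp K v ≤ c := by
  obtain ⟨y, hy, e⟩ := exists_supp_eq hK hne v
  exact e ▸ h y hy

theorem supp_add_le (hK : IsCompact K) (hne : K.Nonempty) (v w : Eucl n) :
    supp K (v + w) ≤ supp K v + supp K w := by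
  refine supp_le hK hne fun y hy => ?_
  rw [inner_add_left]
  exact add_le_add (inner_le_supp hK v hy) (inner_le_supp hK w hy)

theorem supp_smul_le (hK : IsCompact K) (hne : K.Nonempty) {r : ℝ} (hr : 0 ≤ r) (v : Eucl n) :
    supp K (r • v) ≤ r * supp K v := by
  refine supp_le hK hne fun y hy => ?_
  rw [real_inner_smul_left]
  exact mul_le_mul_of_nonneg_left (inner_le_supp hK v hy) hr

theorem supp_le_add_norm (hK : IsCompact K) (hne : K.Nonempty) {D : ℝ}
    (hD : ∀ y ∈ K, ‖y‖ ≤ D) (v w : Eucl n) : supp K v ≤ supp K w + D * ‖v - w‖ := by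
  refine supp_le hK hne fun y hy => ?_
  have h1 : inner ℝ v y = inner ℝ w y + inner ℝ (v - w) y := by rw [inner_sub_left]; ring
  have h2 : inner ℝ (v - w) y ≤ ‖v - w‖ * ‖y‖ := real_inner_le_norm _ _
  have h3 := mul_le_mul_of_nonneg_left (hD y hy) (norm_nonneg (v - w))
  have h4 := inner_le_supp hK w hy
  rw [h1]
  linarith

theorem continuous_supp (hK : IsCompact K) (hne : K.Nonempty) : Continuous (supp K) := by
  obtain ⟨D, hD⟩ := hK.isBounded.exists_norm_le
  have hD0 : 0 ≤ D := (norm_nonneg _).trans (hD _ hne.some_mem)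
  refine LipschitzWith.continuous (K := D.toNNReal) (LipschitzWith.of_dist_le_mul fun v w => ?_)
  rw [Real.coe_toNNReal _ hD0, Real.dist_eq, dist_eq_norm, abs_sub_le_iff]
  constructor
  · linarith [supp_le_add_norm hK hne hD v w]
  · rw [norm_sub_rev]
    linarith [supp_le_add_norm hK hne hD w v]

theorem mem_of_inner_le_supp (hK : IsCompact K) (hne : K.Nonempty) (hc : Convex ℝ K) {y : Eucl n}
    (h : ∀ x : Sph n, inner ℝ (x : Eucl n) y ≤ supp K x) : y ∈ K := by
  by_contra hy
  obtain ⟨f, u, hf, hu⟩ := geometric_hahn_banach_closed_point hc hK.isClosed hy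
  set w := (InnerProductSpace.toDual ℝ (Eucl n)).symm f with hw
  have hfw : ∀ z, f z = inner ℝ w z := fun z => by
    rw [hw, InnerProductSpace.toDual_symm_apply]
  have hw0 : w ≠ 0 := by
    intro h0
    obtain ⟨a, ha⟩ := hne
    have := hf a ha
    rw [hfw, h0, inner_zero_left] at this
    rw [hfw, h0, inner_zero_left] at hu
    linarith
  have h1 := h (toSph w)
  have hp : 0 < ‖w‖⁻¹ := inv_pos.mpr (norm_pos_iff.mpr hw0)
  obtain ⟨a, ha, hs⟩ := exists_supp_eq hK hne (toSph w : Eucl n)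
  rw [hs, coe_toSph hw0, real_inner_smul_left, real_inner_smul_left, ← hfw, ← hfw] at h1
  have := le_of_mul_le_mul_left h1 hp
  linarith [hf a ha]

end supp

section supportFn

variable (Ω : ConvexBody (Eucl n))

theorem supportFn_eq (z : Eucl n) (x : Sph n) :
    supportFn Ω z x = supp (Ω : Set (Eucl n)) x - inner ℝ (x : Eucl n) z := by
  apply le_antisymm
  · refine csSup_le (Ω.nonempty.image _) ?_
    rintro _ ⟨y, hy, rfl⟩
    simp only [inner_sub_right]
    linarith [inner_le_supp Ω.isCompact (x : Eucl n) hy]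
  · obtain ⟨y, hy, e⟩ := exists_supp_eq Ω.isCompact Ω.nonempty (x : Eucl n)
    rw [e, ← inner_sub_right]
    exact le_csSup (Ω.isCompact.image (by fun_prop)).bddAbove ⟨y, hy, rfl⟩

theorem supportFn_eq_sub (z : Eucl n) (x : Sph n) :
    supportFn Ω z x = supportFn Ω 0 x - inner ℝ (x : Eucl n) z := by
  rw [supportFn_eq, supportFn_eq, inner_zero_right, sub_zero]

theorem supportFn_zero (x : Sph n) : supportFn Ω 0 x = supp (Ω : Set (Eucl n)) x := by
  rw [supportFn_eq, inner_zero_right, sub_zero]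

theorem continuous_supportFn (z : Eucl n) : Continuous (supportFn Ω z) := by
  have : supportFn Ω z = fun x : Sph n => supp (Ω : Set (Eucl n)) x - inner ℝ (x : Eucl n) z :=
    funext (supportFn_eq Ω z)
  rw [this]
  have := (continuous_supp Ω.isCompact Ω.nonempty).comp (continuous_subtype_val (p := fun x => x ∈ sphere (0 : Eucl n) 1))
  exact this.sub (by fun_prop)

variable {Ω}

theorem mem_iff_inner_le {y : Eucl n} :
    y ∈ Ω ↔ ∀ x : Sph n, inner ℝ (x : Eucl n) y ≤ supportFn Ω 0 x := by
  constructor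
  · intro hy x
    rw [supportFn_zero]
    exact inner_le_supp Ω.isCompact _ hy
  · intro h
    refine mem_of_inner_le_supp Ω.isCompact Ω.nonempty Ω.convex fun x => ?_
    rw [← supportFn_zero]
    exact h x

theorem mem_iff_supportFn_nonneg {z : Eucl n} : z ∈ Ω ↔ ∀ x, 0 ≤ supportFn Ω z x := by
  rw [mem_iff_inner_le]
  refine forall_congr' fun x => ?_
  rw [supportFn_eq_sub Ω z, sub_nonneg]

theorem eq_of_supportFn_eq {Ω' : ConvexBody (Eucl n)}
    (h : ∀ x, supportFn Ω 0 x = supportFn Ω' 0 x) : Ω = Ω' := by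
  apply SetLike.ext
  intro y
  rw [mem_iff_inner_le, mem_iff_inner_le]
  simp only [h]

theorem supportFn_le {z : Eucl n} {D : ℝ} (h : (Ω : Set (Eucl n)) ⊆ closedBall z D) (x : Sph n) :
    supportFn Ω z x ≤ D := by
  refine csSup_le (Ω.nonempty.image _) ?_
  rintro _ ⟨y, hy, rfl⟩
  have h1 := h hy
  rw [mem_closedBall, dist_eq_norm] at h1
  have h2 := real_inner_le_norm (x : Eucl n) (y - z)
  rw [sph_norm, one_mul] at h2
  exact h2.trans h1

theorem closedBall_subset_iff {z : Eucl n} {δ : ℝ} (hδ : 0 ≤ δ) :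
    closedBall z δ ⊆ (Ω : Set (Eucl n)) ↔ ∀ x, δ ≤ supportFn Ω z x := by
  constructor
  · intro h x
    have hm : z + δ • (x : Eucl n) ∈ Ω := by
      apply h
      rw [mem_closedBall, dist_eq_norm, add_sub_cancel_left, norm_smul, sph_norm, mul_one,
        Real.norm_of_nonneg hδ]
    have := mem_iff_inner_le.mp hm x
    rw [inner_add_right, real_inner_smul_right, real_inner_self_eq_norm_sq, sph_norm] at this
    rw [supportFn_eq_sub]
    linarith
  · intro h y hy
    rw [mem_closedBall, dist_eq_norm] at hy
    refine mem_iff_inner_le.mpr fun x => ?_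
    have h1 := h x
    have h2 := real_inner_le_norm (x : Eucl n) (y - z)
    rw [sph_norm, one_mul, inner_sub_right] at h2
    rw [supportFn_eq_sub] at h1
    linarith

/-- The support function with respect to `z` is positive. -/
def Adm (Ω : ConvexBody (Eucl n)) (z : Eucl n) : Prop := ∀ x, 0 < supportFn Ω z x

theorem Adm.mem {z : Eucl n} (h : Adm Ω z) : z ∈ Ω :=
  mem_iff_supportFn_nonneg.mpr fun x => (h x).le

instance : Nonempty (Sph n) := ⟨northPole n⟩

theorem Adm.continuous_log {z : Eucl n} (h : Adm Ω z) :
    Continuous fun x => Real.log (supportFn Ω z x) :=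
  (continuous_supportFn Ω z).log fun x => (h x).ne'

theorem Adm.integrable_log {z : Eucl n} (h : Adm Ω z) :
    Integrable (fun x => Real.log (supportFn Ω z x)) (sphereMeasure n) :=
  integrable_of_continuous h.continuous_log

theorem inv_mul_integral_le {f : Sph n → ℝ} {c : ℝ} (hf : Integrable f (sphereMeasure n))
    (h : ∀ᵐ x ∂(sphereMeasure n), f x ≤ c) :
    ((sphereMeasure n).real univ)⁻¹ * ∫ x, f x ∂(sphereMeasure n) ≤ c := by
  rw [inv_mul_le_iff₀ (sphereMeasure_univ_pos n)]
  have := integral_mono_ae hf (integrable_const c) h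
  rwa [integral_const, smul_eq_mul] at this

theorem le_inv_mul_integral {f : Sph n → ℝ} {c : ℝ} (hf : Integrable f (sphereMeasure n))
    (h : ∀ᵐ x ∂(sphereMeasure n), c ≤ f x) :
    c ≤ ((sphereMeasure n).real univ)⁻¹ * ∫ x, f x ∂(sphereMeasure n) := by
  rw [le_inv_mul_iff₀ (sphereMeasure_univ_pos n)]
  have := integral_mono_ae (integrable_const c) hf h
  rwa [integral_const, smul_eq_mul] at this

theorem Adm.le_meanLog {z : Eucl n} (h : Adm Ω z) {m : ℝ} (hm : 0 < m)
    (hu : ∀ x, m ≤ supportFn Ω z x) : Real.log m ≤ meanLog Ω z :=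
  le_inv_mul_integral h.integrable_log (ae_of_all _ fun x => Real.log_le_log hm (hu x))

theorem subset_closedBall_diam {z : Eucl n} (hz : z ∈ Ω) :
    (Ω : Set (Eucl n)) ⊆ closedBall z (diam (Ω : Set (Eucl n))) :=
  fun _ hy => dist_le_diam_of_mem Ω.isBounded hy hz

theorem Adm.meanLog_le {z : Eucl n} (h : Adm Ω z) :
    meanLog Ω z ≤ Real.log (diam (Ω : Set (Eucl n))) :=
  inv_mul_integral_le h.integrable_log
    (ae_of_all _ fun x => Real.log_le_log (h x) (supportFn_le (subset_closedBall_diam h.mem) x))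

theorem bddAbove_meanLog (Ω : ConvexBody (Eucl n)) :
    BddAbove (meanLog Ω '' {z | ∀ x, 0 < supportFn Ω z x}) := by
  refine ⟨Real.log (diam (Ω : Set (Eucl n))), ?_⟩
  rintro _ ⟨z, hz, rfl⟩
  exact Adm.meanLog_le hz

theorem Adm.meanLog_le_entropy {z : Eucl n} (h : Adm Ω z) : meanLog Ω z ≤ entropy Ω :=
  le_csSup (bddAbove_meanLog Ω) ⟨z, h, rfl⟩

/-- Apply `log q ≤ q - 1` to `q = 4ab/(a+b)²`, where `1 - q = (a-b)²/(a+b)²` and `a + b ≤ 2D`. -/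
theorem log_midpoint {a b D : ℝ} (ha : 0 < a) (hb : 0 < b) (haD : a ≤ D) (hbD : b ≤ D) :
    (Real.log a + Real.log b) / 2 + (a - b) ^ 2 / (8 * D ^ 2) ≤ Real.log ((a + b) / 2) := by
  have hs : 0 < a + b := add_pos ha hb
  have hD : 0 < D := ha.trans_le haD
  have h1 := Real.log_le_sub_one_of_pos (x := 4 * a * b / (a + b) ^ 2) (by positivity)
  rw [Real.log_div (by positivity) (by positivity), Real.log_mul (by positivity) hb.ne',
    Real.log_mul (by norm_num) ha.ne', Real.log_pow] at h1
  have h2 : Real.log ((a + b) / 2) = Real.log (a + b) - Real.log 2 :=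
    Real.log_div hs.ne' (by norm_num)
  have h3 : Real.log 4 = 2 * Real.log 2 := by
    rw [show (4 : ℝ) = 2 ^ 2 by norm_num, Real.log_pow]; norm_num
  have h4 : (a - b) ^ 2 / (4 * D ^ 2) ≤ 1 - 4 * a * b / (a + b) ^ 2 := by
    have : 1 - 4 * a * b / (a + b) ^ 2 = (a - b) ^ 2 / (a + b) ^ 2 := by
      field_simp; ring
    rw [this]
    gcongr
    nlinarith
  have h5 : (a - b) ^ 2 / (8 * D ^ 2) = (a - b) ^ 2 / (4 * D ^ 2) / 2 := by
    field_simp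
    ring
  rw [h2, h5]
  push_cast at h1
  linarith

/-- Strict concavity of the mean logarithm, in the form of a stability estimate. -/
theorem exists_stability (n : ℕ) : ∃ c : ℝ, 0 < c ∧
    ∀ (Ω : ConvexBody (Eucl n)) (D : ℝ), diam (Ω : Set (Eucl n)) ≤ D → ∀ e z : Eucl n,
    Adm Ω e → z ∈ Ω → (∀ᵐ x ∂(sphereMeasure n), 0 < supportFn Ω z x) →
    Integrable (fun x => Real.log (supportFn Ω z x)) (sphereMeasure n) →
    c * (‖e - z‖ ^ 2 / D ^ 2) ≤ entropy Ω - (meanLog Ω e + meanLog Ω z) / 2 := by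
  obtain ⟨c, hc, hmom⟩ := exists_secondMoment n
  set A := (sphereMeasure n).real univ with hA_def
  have hA : 0 < A := sphereMeasure_univ_pos n
  refine ⟨A⁻¹ * c / 8, by positivity, fun Ω D hD e z he hz hpos hint => ?_⟩
  set m : Eucl n := (2 : ℝ)⁻¹ • (e + z) with hm
  have hum : ∀ x, supportFn Ω m x = (supportFn Ω e x + supportFn Ω z x) / 2 := by
    intro x
    rw [supportFn_eq_sub, supportFn_eq_sub Ω e, supportFn_eq_sub Ω z, hm, real_inner_smul_right,
      inner_add_right]
    ring
  -- Only `e` has to be admissible: `z` may lie on the boundary, yet the midpoint is still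
  -- admissible and so competes for the entropy.
  have hmadm : Adm Ω m := fun x => by
    rw [hum]
    linarith [he x, mem_iff_supportFn_nonneg.mp hz x]
  have hle := hmadm.meanLog_le_entropy
  have hsq : ∀ x, (supportFn Ω e x - supportFn Ω z x) ^ 2 = (inner ℝ (x : Eucl n) (e - z)) ^ 2 := by
    intro x
    rw [supportFn_eq_sub, supportFn_eq_sub Ω z, inner_sub_right]
    ring
  have hi2 : Integrable (fun x : Sph n => (inner ℝ (x : Eucl n) (e - z)) ^ 2) (sphereMeasure n) :=
    integrable_of_continuous (by fun_prop)
  have hmono := integral_mono_ae (μ := sphereMeasure n)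
    (((he.integrable_log.add hint).div_const 2).add (hi2.div_const (8 * D ^ 2)))
    hmadm.integrable_log (by
      filter_upwards [hpos] with x hx
      simp only [Pi.add_apply]
      rw [hum, ← hsq]
      exact log_midpoint (he x) hx
        ((supportFn_le (subset_closedBall_diam he.mem) x).trans hD)
        ((supportFn_le (subset_closedBall_diam hz) x).trans hD))
  have hsplit : ∫ x, (((fun x => Real.log (supportFn Ω e x)) +
        fun x => Real.log (supportFn Ω z x)) x) / 2 + (inner ℝ (x : Eucl n) (e - z)) ^ 2 / (8 * D ^ 2)
          ∂(sphereMeasure n) =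
      (∫ x, Real.log (supportFn Ω e x) ∂(sphereMeasure n) +
        ∫ x, Real.log (supportFn Ω z x) ∂(sphereMeasure n)) / 2 +
        c * ‖e - z‖ ^ 2 / (8 * D ^ 2) := by
    rw [integral_add ((he.integrable_log.add hint).div_const 2) (hi2.div_const (8 * D ^ 2)),
      integral_div, integral_div, hmom]
    congr 2
    exact integral_add he.integrable_log hint
  have hmono' := mul_le_mul_of_nonneg_left (hsplit ▸ hmono) (inv_nonneg.mpr hA.le)
  have : A⁻¹ * ∫ x, Real.log (supportFn Ω m x) ∂(sphereMeasure n) = meanLog Ω m := rfl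
  rw [this] at hmono'
  have h2 : meanLog Ω e = A⁻¹ * ∫ x, Real.log (supportFn Ω e x) ∂(sphereMeasure n) := rfl
  have h3 : meanLog Ω z = A⁻¹ * ∫ x, Real.log (supportFn Ω z x) ∂(sphereMeasure n) := rfl
  have h4 : A⁻¹ * c / 8 * (‖e - z‖ ^ 2 / D ^ 2) = A⁻¹ * (c * ‖e - z‖ ^ 2 / (8 * D ^ 2)) := by
    field_simp
  rw [mul_add] at hmono'
  rw [h4, h2, h3]
  linarith

end supportFn

end SupportFunctions

/-! ### Gain of the mean logarithm when the centre leaves the boundary. -/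

section Reflection

theorem one_sub_inv_le_log' {q : ℝ} (hq : 0 < q) : 1 - 1 / q ≤ Real.log q := by
  rw [one_div]
  exact Real.one_sub_inv_le_log_of_pos hq

/-- The combined effect of a shift by `s * c` on a value `a` of a support function and on its
value `a'` at the reflected point. -/
theorem reflected_pair_log {a a' c s m κ c₀ : ℝ} (hm : 0 < m) (hs : 0 < s) (hsm : s ≤ m / 4)
    (ha : 0 ≤ a) (haa : a ≤ a') (ha' : m ≤ a') (hc : 0 ≤ c) (hc1 : c ≤ 1) (hc₀ : 0 < c₀)
    (hκ : κ = s * c₀ / 8) (hκm : κ ≤ m) (hcc : a < m → c₀ < c) :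
    -(4 * s ^ 2 / m ^ 2) ≤ Real.log (a + s * c) - Real.log (max a κ) +
        (Real.log (a' - s * c) - Real.log (max a' κ)) ∧
      (a < m / 8 → 1 / 2 < c → s / m ≤ Real.log (a + s * c) - Real.log (max a κ) +
        (Real.log (a' - s * c) - Real.log (max a' κ))) := by
  have hκ0 : 0 < κ := by rw [hκ]; positivity
  have hsc0 : 0 ≤ s * c := mul_nonneg hs.le hc
  have hsc : s * c ≤ s := by nlinarith
  have ha'0 : 0 < a' := hm.trans_le ha'
  have hmax' : max a' κ = a' := max_eq_left (hκm.trans ha')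
  have hd : 3 / 4 * a' ≤ a' - s * c := by linarith
  have hd0 : 0 < a' - s * c := by linarith
  have hmax0 : 0 < max a κ := lt_max_of_lt_right hκ0
  have hac : 0 < a + s * c := by
    rcases lt_or_ge a m with h | h
    · have : 0 < c := hc₀.trans (hcc h)
      positivity
    · linarith
  -- The four logarithms combine into that of a single ratio, so lower bounds for `Q` suffice,
  -- through `log Q ≥ 1 - 1/Q`.
  obtain ⟨Q, hQ⟩ : ∃ Q, Q = (a + s * c) * (a' - s * c) / (max a κ * a') := ⟨_, rfl⟩
  have hQ0 : 0 < Q := hQ ▸ div_pos (mul_pos hac hd0) (mul_pos hmax0 ha'0)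
  have hlog : Real.log (a + s * c) - Real.log (max a κ) +
        (Real.log (a' - s * c) - Real.log (max a' κ)) = Real.log Q := by
    rw [hmax', hQ, Real.log_div (by positivity) (by positivity), Real.log_mul hac.ne' hd0.ne',
      Real.log_mul hmax0.ne' ha'0.ne']
    ring
  rw [hlog]
  obtain ⟨t, ht⟩ : ∃ t, t = s / m := ⟨_, rfl⟩
  rw [← ht]
  have ht0 : 0 < t := ht ▸ div_pos hs hm
  have ht4 : t ≤ 1 / 4 := by rw [ht, div_le_iff₀ hm]; linarith
  have hst : s = t * m := by rw [ht]; field_simp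
  have hbig : 1 + 2 * t ≤ Q → t ≤ Real.log Q := by
    intro h
    refine le_trans ?_ (one_sub_inv_le_log' hQ0)
    have h1 : 1 / Q ≤ 1 / (1 + 2 * t) := one_div_le_one_div_of_le (by linarith) h
    have h2 : 1 / (1 + 2 * t) ≤ 1 - t := by
      rw [div_le_iff₀ (by linarith)]
      nlinarith
    linarith
  have hsq : 4 * s ^ 2 / m ^ 2 = 4 * t ^ 2 := by rw [ht]; field_simp
  -- Where the truncation is active, the shift lifts `a` to at least `s c₀ = 8κ`, while the factor
  -- at the reflected point is at least `3/4`; so `Q ≥ 6`.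
  have hkap : a < κ → 1 + 2 * t ≤ Q := by
    intro h
    have hc1 := hcc (h.trans_le hκm)
    rw [hQ, max_eq_right h.le, le_div_iff₀ (by positivity)]
    have h1 : 8 * κ ≤ a + s * c := by rw [hκ]; nlinarith
    have h2 : 8 * κ * (3 / 4 * a') ≤ (a + s * c) * (a' - s * c) :=
      mul_le_mul h1 hd (by positivity) hac.le
    have : (1 + 2 * t) * (κ * a') ≤ 6 * (κ * a') :=
      mul_le_mul_of_nonneg_right (by linarith) (by positivity)
    linarith
  constructor
  · rw [hsq]
    rcases lt_or_ge a κ with h | h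
    · have := hbig (hkap h)
      nlinarith
    · have ha0 : 0 < a := hκ0.trans_le h
      rw [max_eq_left h] at hQ
      rcases le_or_gt (s * c) (a' - a) with h1 | h1
      · have : 1 ≤ Q := by
          rw [hQ, le_div_iff₀ (by positivity)]
          nlinarith
        have := Real.log_nonneg this
        nlinarith
      -- The product is `a a' + s c (a' - a) - (s c)²`. Here `a` and `a'` differ by less than `s c`,
      -- so both are at least `3m/4` and the loss is of second order in `s/m`.
      · have hq : 1 - 2 * t ^ 2 ≤ Q := by
          rw [hQ, le_div_iff₀ (by positivity)]
          have h3 : 3 / 4 * m ≤ a := by linarith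
          have h4 : 3 / 4 * m * m ≤ a * a' := mul_le_mul h3 ha' hm.le ha0.le
          have h5 : (s * c) ^ 2 ≤ s ^ 2 := pow_le_pow_left₀ hsc0 hsc 2
          have h6 : t ^ 2 * (3 / 4 * m * m) ≤ t ^ 2 * (a * a') :=
            mul_le_mul_of_nonneg_left h4 (sq_nonneg t)
          have h7 : s ^ 2 = t ^ 2 * (m * m) := by rw [hst]; ring
          have h8 : 0 ≤ s * c * (a' - a) := mul_nonneg hsc0 (sub_nonneg.mpr haa)
          have h9 : 0 ≤ t ^ 2 * (m * m) := by positivity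
          have h10 : (a + s * c) * (a' - s * c) = a * a' + s * c * (a' - a) - (s * c) ^ 2 := by
            ring
          have h11 : t ^ 2 * (3 / 4 * m * m) = 3 / 4 * (t ^ 2 * (m * m)) := by ring
          linarith
        refine le_trans ?_ (one_sub_inv_le_log' hQ0)
        have ht2 : t ^ 2 ≤ 1 / 16 := by nlinarith
        have h1 : 1 / Q ≤ 1 / (1 - 2 * t ^ 2) := one_div_le_one_div_of_le (by linarith) hq
        have h2 : 1 / (1 - 2 * t ^ 2) ≤ 1 + 4 * t ^ 2 := by
          rw [div_le_iff₀ (by linarith)]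
          have := mul_nonneg (sq_nonneg t) (sub_nonneg.mpr ht2)
          linarith [sq_nonneg t, show (1 + 4 * t ^ 2) * (1 - 2 * t ^ 2) =
            1 + 3 / 2 * t ^ 2 + 8 * (t ^ 2 * (1 / 16 - t ^ 2)) by ring]
        linarith
  · intro h8 hc2
    apply hbig
    rcases lt_or_ge a κ with h | h
    · exact hkap h
    · have ha0 : 0 < a := hκ0.trans_le h
      rw [hQ, max_eq_left h, le_div_iff₀ (by positivity)]
      have h1 : (1 + 4 * t) * a ≤ a + s * c := by
        have : 4 * t * a ≤ t * m * (1 / 2) := by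
          have := mul_le_mul_of_nonneg_left h8.le ht0.le
          linarith
        have : t * m * (1 / 2) ≤ t * m * c := mul_le_mul_of_nonneg_left hc2.le (by positivity)
        rw [hst]
        linarith
      have h2 : (1 - t) * a' ≤ a' - s * c := by
        have : s ≤ t * a' := by
          rw [hst]
          exact mul_le_mul_of_nonneg_left ha' ht0.le
        linarith
      have h3 : ((1 + 4 * t) * a) * ((1 - t) * a') ≤ (a + s * c) * (a' - s * c) :=
        mul_le_mul h1 h2 (mul_nonneg (by linarith) ha'0.le) hac.le
      have h4 : (1 + 2 * t) * (a * a') ≤ ((1 + 4 * t) * (1 - t)) * (a * a') :=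
        mul_le_mul_of_nonneg_right
          (by linarith [mul_nonneg ht0.le (sub_nonneg.mpr ht4),
            show (1 + 4 * t) * (1 - t) = 1 + 2 * t + 4 * (t * (1 / 4 - t)) by ring])
          (by positivity)
      linarith [show (1 + 4 * t) * a * ((1 - t) * a') = (1 + 4 * t) * (1 - t) * (a * a') by ring]

/-- A direction of vanishing of a sublinear function such that all other such directions make a
uniformly acute angle with it. -/
theorem exists_central_zero {U : Eucl n → ℝ} (hcont : Continuous U)
    (hadd : ∀ v w, U (v + w) ≤ U v + U w) (hsmul : ∀ r : ℝ, 0 ≤ r → ∀ v, U (r • v) ≤ r * U v)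
    {p : Eucl n} {r : ℝ} (hr : 0 < r)
    (hp : ∀ x : Sph n, inner ℝ (x : Eucl n) p + r ≤ U x) {x₁ : Sph n} (h₁ : U x₁ ≤ 0) :
    ∃ (x₀ : Sph n) (c₀ : ℝ), 0 < c₀ ∧ U x₀ ≤ 0 ∧
      ∀ x : Sph n, U x ≤ 0 → c₀ < inner ℝ (x : Eucl n) (x₀ : Eucl n) := by
  set N : Set (Eucl n) := (↑) '' {x : Sph n | U x ≤ 0} with hN
  have hNc : IsCompact N := by
    refine IsCompact.image (IsClosed.isCompact ?_) continuous_subtype_val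
    exact isClosed_le (hcont.comp continuous_subtype_val) continuous_const
  have hCc : IsCompact (closure (convexHull ℝ N)) :=
    (isBounded_convexHull.mpr hNc.isBounded).isCompact_closure
  -- Sublinearity carries `U ≤ 0` from the zero directions to their hull, and the interior point `p`
  -- keeps the hull away from the origin.
  have hsub : closure (convexHull ℝ N) ⊆ {y | U y ≤ 0 ∧ inner ℝ y p ≤ -r} := by
    have hcl : IsClosed {y : Eucl n | U y ≤ 0 ∧ inner ℝ y p ≤ -r} :=
      (isClosed_le hcont continuous_const).inter (isClosed_le (f := fun y : Eucl n => inner ℝ y p) (by fun_prop) continuous_const)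
    refine closure_minimal (convexHull_min ?_ ?_) hcl
    · rintro _ ⟨x, hx, rfl⟩
      exact ⟨hx, by linarith [hp x, show U x ≤ 0 from hx]⟩
    · intro y hy z hz a b ha hb hab
      refine ⟨(hadd _ _).trans ?_, ?_⟩
      · have h1 := hsmul a ha y
        have h2 := hsmul b hb z
        have h3 := mul_nonpos_of_nonneg_of_nonpos ha hy.1
        have h4 := mul_nonpos_of_nonneg_of_nonpos hb hz.1
        linarith
      · rw [inner_add_left, real_inner_smul_left, real_inner_smul_left]
        have h1 := mul_le_mul_of_nonneg_left hy.2 ha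
        have h2 := mul_le_mul_of_nonneg_left hz.2 hb
        have h3 : a * -r + b * -r = -r := by rw [← add_mul, hab, one_mul]
        linarith
  have hne : (closure (convexHull ℝ N)).Nonempty := ⟨x₁, subset_closure (subset_convexHull ℝ N ⟨x₁, h₁, rfl⟩)⟩
  -- The point of the hull nearest to the origin gives the central direction: `⟨x, ν⟩ ≥ ‖ν‖²` on the
  -- hull. Halving `‖ν‖` for `c₀` makes the inequality strict.
  obtain ⟨ν, hν, hmin⟩ := exists_norm_eq_iInf_of_complete_convex hne hCc.isComplete
    ((convex_convexHull ℝ N).closure) 0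
  rw [norm_eq_iInf_iff_real_inner_le_zero ((convex_convexHull ℝ N).closure) hν] at hmin
  have hν0 : ν ≠ 0 := by
    rintro rfl
    have := (hsub hν).2
    rw [inner_zero_left] at this
    linarith
  have hpos : 0 < ‖ν‖ := norm_pos_iff.mpr hν0
  refine ⟨toSph ν, ‖ν‖ / 2, by positivity, ?_, fun x hx => ?_⟩
  · rw [coe_toSph hν0]
    exact (hsmul _ (by positivity) _).trans
      (mul_nonpos_of_nonneg_of_nonpos (by positivity) (hsub hν).1)
  · have h := hmin x (subset_closure (subset_convexHull ℝ N ⟨x, hx, rfl⟩))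
    rw [zero_sub, inner_neg_left, inner_sub_right, real_inner_self_eq_norm_sq] at h
    rw [coe_toSph hν0, real_inner_smul_right, real_inner_comm, lt_inv_mul_iff₀ hpos]
    nlinarith

theorem reflection_apply' (x₀ x : Sph n) :
    (sphMap (Submodule.reflection (ℝ ∙ (x₀ : Eucl n))ᗮ) x : Eucl n) =
      (x : Eucl n) - (2 * inner ℝ (x : Eucl n) (x₀ : Eucl n)) • (x₀ : Eucl n) := by
  rw [coe_sphMap, Submodule.reflection_orthogonal_apply, Submodule.reflection_singleton_apply]
  simp only [sph_norm, real_inner_comm]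
  module

/-- If a sublinear function vanishes in some direction, then a point moved inside has larger mean
logarithm, even compared with the truncated logarithm. -/
theorem exists_shift_gain {U : Eucl n → ℝ} (hcont : Continuous U)
    (hadd : ∀ v w, U (v + w) ≤ U v + U w) (hsmul : ∀ r : ℝ, 0 ≤ r → ∀ v, U (r • v) ≤ r * U v)
    (hnn : ∀ x : Sph n, 0 ≤ U x) {p : Eucl n} {r : ℝ} (hr : 0 < r)
    (hp : ∀ x : Sph n, inner ℝ (x : Eucl n) p + r ≤ U x) {x₁ : Sph n} (h₁ : U x₁ ≤ 0) :
    ∃ (w : Eucl n) (κ : ℝ), 0 < κ ∧ (∀ x : Sph n, 0 < U x - inner ℝ (x : Eucl n) w) ∧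
      ∫ x : Sph n, Real.log (max (U x) κ) ∂(sphereMeasure n) <
        ∫ x : Sph n, Real.log (U x - inner ℝ (x : Eucl n) w) ∂(sphereMeasure n) := by
  obtain ⟨x₀, c₀, hc₀, hx₀, hacute⟩ := exists_central_zero hcont hadd hsmul hr hp h₁
  set c : Sph n → ℝ := fun x => inner ℝ (x : Eucl n) (x₀ : Eucl n) with hc
  have hcc : Continuous c := by fun_prop
  have hUc : Continuous fun x : Sph n => U x := hcont.comp continuous_subtype_val
  have hc1 : ∀ x, |c x| ≤ 1 := fun x => by
    have := abs_real_inner_le_norm (x : Eucl n) (x₀ : Eucl n)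
    rwa [sph_norm, sph_norm, one_mul] at this
  have hself : c x₀ = 1 := by
    simp only [hc]
    rw [real_inner_self_eq_norm_sq, sph_norm, one_pow]
  have hc₀1 : c₀ < 1 := hself ▸ hacute x₀ hx₀
  -- All zeros of `U` lie in the cap `c > c₀`, so `U` has a positive minimum on the compact
  -- complement.
  obtain ⟨m, hm, hmin⟩ : ∃ m, 0 < m ∧ ∀ x, c x ≤ c₀ → m ≤ U x := by
    have hcl : IsCompact {x : Sph n | c x ≤ c₀} := (isClosed_le hcc continuous_const).isCompact
    have hne : {x : Sph n | c x ≤ c₀}.Nonempty := by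
      refine ⟨-x₀, ?_⟩
      simp only [mem_ofPred_eq, hc, coe_neg_sphere, inner_neg_left]
      rw [real_inner_self_eq_norm_sq, sph_norm]
      linarith
    obtain ⟨y, hy, hmin⟩ := hcl.exists_isMinOn hne hUc.continuousOn
    refine ⟨U y, ?_, fun x hx => hmin hx⟩
    by_contra h
    exact absurd (hacute y (not_lt.mp h)) (not_lt.mpr hy)
  set G : Set (Sph n) := {x | U x < m / 8 ∧ 1 / 2 < c x} with hG
  have hGo : IsOpen G :=
    (isOpen_lt hUc continuous_const).inter (isOpen_lt continuous_const hcc)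
  have hGne : G.Nonempty := ⟨x₀, by linarith, by rw [hself]; norm_num⟩
  have hgpos : 0 < (sphereMeasure n).real G :=
    ENNReal.toReal_pos (hGo.measure_ne_zero _ hGne) (measure_ne_top _ _)
  set g := (sphereMeasure n).real G with hg
  set A := (sphereMeasure n).real univ with hA
  have hA0 : 0 < A := sphereMeasure_univ_pos n
  -- The second choice makes the total second-order loss `4 A s²/m²` at most half of the first-order
  -- gain `g s/m` collected on `G`.
  set s := min (m / 4) (m * g / (8 * A)) with hs
  have hs0 : 0 < s := by rw [hs]; positivity
  have hsm : s ≤ m / 4 := min_le_left _ _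
  have hsg : s ≤ m * g / (8 * A) := min_le_right _ _
  set κ := s * c₀ / 8 with hκ
  have hκ0 : 0 < κ := by positivity
  have hκm : κ ≤ m := by rw [hκ]; nlinarith
  have hadm : ∀ x : Sph n, 0 < U x + s * c x := by
    intro x
    rcases le_or_gt (c x) 0 with h | h
    · have h1 := hmin x (h.trans hc₀.le)
      have h2 := (abs_le.mp (hc1 x)).1
      nlinarith
    · have := hnn x
      positivity
  have hw : ∀ x : Sph n, U x - inner ℝ (x : Eucl n) (-(s • (x₀ : Eucl n))) = U x + s * c x := by
    intro x
    rw [inner_neg_right, real_inner_smul_right, sub_neg_eq_add]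
  refine ⟨-(s • (x₀ : Eucl n)), κ, hκ0, fun x => by rw [hw]; exact hadm x, ?_⟩
  simp only [hw]
  set h : Sph n → ℝ := fun x => Real.log (U x + s * c x) - Real.log (max (U x) κ) with hh
  have hc_1 : Continuous fun x : Sph n => Real.log (U x + s * c x) :=
    (hUc.add (continuous_const.mul hcc)).log fun x => (hadm x).ne'
  have hc_2 : Continuous fun x : Sph n => Real.log (max (U x) κ) :=
    (hUc.max continuous_const).log fun x => (lt_max_of_lt_right hκ0).ne'
  have hhc : Continuous h := hc_1.sub hc_2
  rw [← sub_pos, ← integral_sub (integrable_of_continuous hc_1) (integrable_of_continuous hc_2)]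
  change 0 < ∫ x, h x ∂(sphereMeasure n)
  set L := Submodule.reflection (ℝ ∙ (x₀ : Eucl n))ᗮ with hL
  have hcR : ∀ x, c (sphMap L x) = - c x := by
    intro x
    simp only [hc]
    rw [reflection_apply', inner_sub_left, real_inner_smul_left, real_inner_self_eq_norm_sq,
      sph_norm]
    ring
  have hRR : ∀ x, sphMap L (sphMap L x) = x := fun x =>
    Subtype.ext (Submodule.reflection_reflection _ _)
  -- With `R` the reflection in the hyperplane orthogonal to `x₀`, `x = R x + 2 c(x) x₀` and `U x₀ ≤
  -- 0` give `U x ≤ U (R x)`: the shift raises the smaller of the two values and lowers the larger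
  -- one by the same amount.
  have hkey : ∀ x, 0 ≤ c x → -(4 * s ^ 2 / m ^ 2) ≤ h x + h (sphMap L x) ∧
      (x ∈ G → s / m ≤ h x + h (sphMap L x)) := by
    intro x hx
    have hle : U x ≤ U (sphMap L x) := by
      have hx' : (x : Eucl n) = (sphMap L x : Eucl n) + (2 * c x) • (x₀ : Eucl n) := by
        rw [reflection_apply']
        simp only [hc]
        module
      have h1 := hadd (sphMap L x : Eucl n) ((2 * c x) • (x₀ : Eucl n))
      rw [← hx'] at h1
      have h2 := hsmul (2 * c x) (by positivity) x₀
      have h3 := mul_nonpos_of_nonneg_of_nonpos (show 0 ≤ 2 * c x by positivity) hx₀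
      linarith
    have hbig : m ≤ U (sphMap L x) := by
      apply hmin
      rw [hcR]
      linarith
    have := reflected_pair_log hm hs0 hsm (hnn x) hle hbig hx (abs_le.mp (hc1 x)).2 hc₀ hκ hκm
      (fun hlt => by
        by_contra hcon
        exact absurd (hmin x (not_lt.mp hcon)) (not_le.mpr hlt))
    simp only [hh, hcR, mul_neg, ← sub_eq_add_neg]
    exact ⟨this.1, fun hxG => this.2 hxG.1 hxG.2⟩
  -- By invariance under the reflection, integrating `h + h ∘ R` gives twice the integral of `h`.
  -- Points with `c x < 0` are handled through their reflections.
  have hlow : ∀ x, G.indicator (fun _ => s / m) x - 4 * s ^ 2 / m ^ 2 ≤ h x + h (sphMap L x) := by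
    intro x
    have hq : 0 ≤ 4 * s ^ 2 / m ^ 2 := by positivity
    rcases le_or_gt 0 (c x) with hx | hx
    · by_cases hxG : x ∈ G
      · rw [indicator_of_mem hxG]
        linarith [(hkey x hx).2 hxG]
      · rw [indicator_of_notMem hxG]
        linarith [(hkey x hx).1]
    · have hxG : x ∉ G := fun hxG => by linarith [hxG.2]
      have := (hkey (sphMap L x) (by rw [hcR]; linarith)).1
      rw [hRR] at this
      rw [indicator_of_notMem hxG]
      linarith
  have hhi := integrable_of_continuous hhc
  have hhR : Integrable (fun x => h (sphMap L x)) (sphereMeasure n) :=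
    ((measurePreserving_sphMap L).integrable_comp_emb (sphMap L).measurableEmbedding).mpr hhi
  have hmono := integral_mono (μ := sphereMeasure n)
    (((integrable_const (s / m)).indicator hGo.measurableSet).sub (integrable_const _))
    (hhi.add hhR) hlow
  simp only [Pi.add_apply, Pi.sub_apply] at hmono
  rw [integral_sub ((integrable_const (s / m)).indicator hGo.measurableSet) (integrable_const _),
    integral_add hhi hhR, integral_sphMap, integral_indicator_const _ hGo.measurableSet,
    integral_const, smul_eq_mul, smul_eq_mul, ← hg, ← hA] at hmono
  have hfin : 0 < g * (s / m) - A * (4 * s ^ 2 / m ^ 2) := by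
    have : A * (4 * s ^ 2 / m ^ 2) = (4 * A * s / m) * (s / m) := by field_simp
    rw [this, ← sub_mul]
    refine mul_pos ?_ (by positivity)
    have h2 : 4 * A * s / m ≤ g / 2 := by
      rw [div_le_iff₀ hm]
      rw [le_div_iff₀ (by positivity)] at hsg
      linarith
    linarith
  linarith

end Reflection

/-! ### Compactness, existence and uniqueness of entropy points, and the diameter bound. -/

section EntropyPoints

open TopologicalSpace Filter

theorem hausdorffEDist_ne_top (K L : NonemptyCompacts (Eucl n)) :
    hausdorffEDist (K : Set (Eucl n)) L ≠ ⊤ :=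
  hausdorffEDist_ne_top_of_nonempty_of_bounded K.nonempty L.nonempty K.isCompact.isBounded
    L.isCompact.isBounded

theorem supp_le_supp_add_dist (K L : NonemptyCompacts (Eucl n)) (x : Sph n) :
    supp (K : Set (Eucl n)) x ≤ supp (L : Set (Eucl n)) x + dist K L := by
  refine le_of_forall_pos_lt_add fun ε hε => ?_
  obtain ⟨y, hy, e⟩ := exists_supp_eq K.isCompact K.nonempty (x : Eucl n)
  have hlt : hausdorffDist (K : Set (Eucl n)) L < dist K L + ε := by
    rw [NonemptyCompacts.dist_eq]; linarith
  obtain ⟨y', hy', h⟩ := exists_dist_lt_of_hausdorffDist_lt hy hlt (hausdorffEDist_ne_top K L)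
  have h1 := inner_le_supp L.isCompact (x : Eucl n) hy'
  have h2 := real_inner_le_norm (x : Eucl n) (y - y')
  rw [sph_norm, one_mul, inner_sub_right, ← dist_eq_norm] at h2
  linarith

/-- Upper semicontinuity of volume: the `K k` eventually lie in any thickening of `L`, and the
volumes of the thickenings decrease to that of `L`. -/
theorem volume_le_of_tendsto {K : ℕ → NonemptyCompacts (Eucl n)} {L : NonemptyCompacts (Eucl n)}
    (h : Tendsto K atTop (nhds L)) {v : ENNReal}
    (hv : ∀ k, v ≤ volume (K k : Set (Eucl n))) : v ≤ volume (L : Set (Eucl n)) := by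
  have hlim : Tendsto (fun r => volume (cthickening r (L : Set (Eucl n)))) (nhdsWithin 0 (Ioi 0))
      (nhds (volume (L : Set (Eucl n)))) :=
    (tendsto_measure_cthickening_of_isCompact L.isCompact).mono_left nhdsWithin_le_nhds
  refine ge_of_tendsto hlim ?_
  filter_upwards [self_mem_nhdsWithin] with r hr
  obtain ⟨k, hk⟩ := ((tendsto_iff_dist_tendsto_zero.mp h).eventually_lt_const hr).exists
  refine (hv k).trans (measure_mono fun y hy => ?_)
  rw [NonemptyCompacts.dist_eq] at hk
  obtain ⟨y', hy', hd⟩ := exists_dist_lt_of_hausdorffDist_lt hy hk (hausdorffEDist_ne_top _ _)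
  exact mem_cthickening_of_dist_le _ _ _ _ hy' hd.le

theorem interior_nonempty_of_volume_pos {s : Set (Eucl n)} (hs : Convex ℝ s)
    (hv : 0 < volume s) : (interior s).Nonempty := by
  by_contra h
  rw [not_nonempty_iff_eq_empty] at h
  have : s ⊆ frontier s := by
    rw [frontier, h, sdiff_empty]
    exact subset_closure
  exact hv.ne' (measure_mono_null this (hs.addHaar_frontier volume))

/-- Convexity is not assumed, since `K` will be a Hausdorff limit; the convex hull is bounded by the
same support function and has an interior point. -/
theorem exists_inner_add_le_supp {K : Set (Eucl n)} (hK : IsCompact K) (hv : 0 < volume K) :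
    ∃ (p : Eucl n) (r : ℝ), 0 < r ∧ ∀ x : Sph n, inner ℝ (x : Eucl n) p + r ≤ supp K x := by
  obtain ⟨p, hp⟩ := interior_nonempty_of_volume_pos (convex_convexHull ℝ K)
    (hv.trans_le (measure_mono (subset_convexHull ℝ K)))
  obtain ⟨r, hr, hball⟩ := Metric.nhds_basis_closedBall.mem_iff.mp (mem_interior_iff_mem_nhds.mp hp)
  refine ⟨p, r, hr, fun x => ?_⟩
  have hsub : convexHull ℝ K ⊆ {y | inner ℝ (x : Eucl n) y ≤ supp K x} := by
    refine convexHull_min (fun y hy => inner_le_supp hK _ hy) ?_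
    exact convex_halfSpace_le (innerₛₗ ℝ (x : Eucl n)).isLinear _
  have hm : p + r • (x : Eucl n) ∈ closedBall p r := by
    rw [mem_closedBall, dist_eq_norm, add_sub_cancel_left, norm_smul, sph_norm, mul_one,
      Real.norm_of_nonneg hr.le]
  have := hsub (hball hm)
  rw [mem_ofPred_eq, inner_add_right, real_inner_smul_right, real_inner_self_eq_norm_sq, sph_norm]
    at this
  linarith

theorem exists_adm {Ω : ConvexBody (Eucl n)} (hv : 0 < volume (Ω : Set (Eucl n))) :
    ∃ p, Adm Ω p := by
  obtain ⟨p, r, hr, h⟩ := exists_inner_add_le_supp Ω.isCompact hv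
  refine ⟨p, fun x => ?_⟩
  rw [supportFn_eq]
  linarith [h x]

/-- The translate of a convex body by `-z`, as a nonempty compact set. -/
def translated (Ω : ConvexBody (Eucl n)) (z : Eucl n) : NonemptyCompacts (Eucl n) where
  carrier := (fun y => y - z) '' (Ω : Set (Eucl n))
  isCompact' := Ω.isCompact.image (by fun_prop)
  nonempty' := Ω.nonempty.image _

theorem coe_translated (Ω : ConvexBody (Eucl n)) (z : Eucl n) :
    (translated Ω z : Set (Eucl n)) = (fun y => y - z) '' (Ω : Set (Eucl n)) := rfl

theorem supp_translated (Ω : ConvexBody (Eucl n)) (z : Eucl n) (x : Sph n) :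
    supp (translated Ω z : Set (Eucl n)) x = supportFn Ω z x := by
  rw [coe_translated, supp, image_image, supportFn]

theorem volume_translated (Ω : ConvexBody (Eucl n)) (z : Eucl n) :
    volume (translated Ω z : Set (Eucl n)) = volume (Ω : Set (Eucl n)) := by
  rw [coe_translated]
  simp only [sub_eq_add_neg]
  rw [image_add_right, measure_preimage_add_right]

theorem log_add_le {a d κ : ℝ} (hκ : 0 < κ) (ha : κ ≤ a) (hd : 0 ≤ d) :
    Real.log (a + d) ≤ Real.log a + d / κ := by
  have ha0 : 0 < a := hκ.trans_le ha
  have h1 : a + d = a * (1 + d / a) := by field_simp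
  have h2 := Real.log_le_sub_one_of_pos (x := 1 + d / a) (by positivity)
  rw [h1, Real.log_mul ha0.ne' (by positivity)]
  have h3 : d / a ≤ d / κ := by gcongr
  linarith

/-- If the support function of a convex body with respect to some point is small in some
direction, then another point has mean logarithm larger by a definite amount. -/
theorem exists_meanLog_gain (n : ℕ) {v : ENNReal} (hv : 0 < v) (D : ℝ) :
    ∃ δ : ℝ, 0 < δ ∧ ∀ (Ω : ConvexBody (Eucl n)) (z : Eucl n),
      v ≤ volume (Ω : Set (Eucl n)) → (Ω : Set (Eucl n)) ⊆ closedBall z D → Adm Ω z →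
      (∃ x, supportFn Ω z x < δ) → ∃ w, Adm Ω w ∧ meanLog Ω z + δ < meanLog Ω w := by
  by_contra hcon
  push Not at hcon
  have hδ : ∀ k : ℕ, (0 : ℝ) < 1 / ((k : ℝ) + 1) := fun k => by positivity
  have hcon' := fun k : ℕ => hcon (1 / ((k : ℝ) + 1)) (hδ k)
  choose Ω z hvol hsub hadm hx hbad using hcon'
  choose x hx using hx
  -- Translating `z k` to the origin puts all bodies in one ball, where nonempty compact sets form a
  -- compact space. Only the support function and the volume of the limit matter.
  obtain ⟨L, -, φ, hφ, hlim⟩ := (NonemptyCompacts.isCompact_subsets_of_isCompact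
    (isCompact_closedBall (0 : Eucl n) D)).tendsto_subseq (x := fun k => translated (Ω k) (z k))
    (fun k => by
      rintro _ ⟨y, hy, rfl⟩
      have := hsub k hy
      rw [mem_closedBall, dist_eq_norm] at this
      rwa [mem_closedBall, dist_zero_right])
  set K : ℕ → NonemptyCompacts (Eucl n) := fun k => translated (Ω (φ k)) (z (φ k)) with hK
  have hlim' : Tendsto K atTop (nhds L) := hlim
  have hd : Tendsto (fun k => dist (K k) L) atTop (nhds 0) :=
    tendsto_iff_dist_tendsto_zero.mp hlim'
  have hLv : v ≤ volume (L : Set (Eucl n)) :=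
    volume_le_of_tendsto hlim' fun k => (hvol _).trans (volume_translated _ _).ge
  set U := supp (L : Set (Eucl n)) with hU
  have hUc : Continuous U := continuous_supp L.isCompact L.nonempty
  have hle1 : ∀ k (y : Sph n), supportFn (Ω (φ k)) (z (φ k)) y ≤ U y + dist (K k) L := fun k y => by
    rw [← supp_translated]
    exact supp_le_supp_add_dist _ _ _
  have hle2 : ∀ k (y : Sph n), U y ≤ supportFn (Ω (φ k)) (z (φ k)) y + dist (K k) L := fun k y => by
    rw [← supp_translated, dist_comm]
    exact supp_le_supp_add_dist _ _ _
  have hnn : ∀ y : Sph n, 0 ≤ U y := fun y => by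
    have h := hd.const_add (U y)
    rw [add_zero] at h
    exact ge_of_tendsto' h fun k => ((hadm _ y).le).trans (hle1 k y)
  obtain ⟨p, r, hr, hp⟩ := exists_inner_add_le_supp L.isCompact (hv.trans_le hLv)
  have hδ0 : Tendsto (fun k => 1 / ((φ k : ℝ) + 1)) atTop (nhds 0) :=
    (tendsto_one_div_add_atTop_nhds_zero_nat (𝕜 := ℝ)).comp hφ.tendsto_atTop
  obtain ⟨x₁, hx₁⟩ : ∃ x₁ : Sph n, U x₁ ≤ 0 := by
    obtain ⟨y, -, hy⟩ := isCompact_univ.exists_isMinOn univ_nonempty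
      (hUc.comp continuous_subtype_val : Continuous fun y : Sph n => U y).continuousOn
    refine ⟨y, ?_⟩
    have h := hδ0.add hd
    rw [add_zero] at h
    refine ge_of_tendsto' h fun k => ?_
    have h1 : U y ≤ U (x (φ k)) := hy (mem_univ _)
    linarith [hle2 k (x (φ k)), hx (φ k)]
  obtain ⟨w, κ, hκ, hpos, hgain⟩ := exists_shift_gain hUc (supp_add_le L.isCompact L.nonempty)
    (fun r hr v => supp_smul_le L.isCompact L.nonempty hr v) hnn hr hp hx₁
  have hUwc : Continuous fun y : Sph n => U y - inner ℝ (y : Eucl n) w :=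
    (hUc.comp continuous_subtype_val).sub (by fun_prop)
  obtain ⟨m, hm, hmin⟩ : ∃ m, 0 < m ∧ ∀ y : Sph n, m ≤ U y - inner ℝ (y : Eucl n) w := by
    obtain ⟨y, -, hy⟩ := isCompact_univ.exists_isMinOn univ_nonempty hUwc.continuousOn
    exact ⟨_, hpos y, fun x => hy (mem_univ x)⟩
  set A := (sphereMeasure n).real univ with hA
  have hA0 : 0 < A := sphereMeasure_univ_pos n
  set I₁ := ∫ y : Sph n, Real.log (max (U y) κ) ∂(sphereMeasure n) with hI₁
  set I₂ := ∫ y : Sph n, Real.log (U y - inner ℝ (y : Eucl n) w) ∂(sphereMeasure n) with hI₂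
  have hgap : 0 < A⁻¹ * (I₂ - I₁) := mul_pos (inv_pos.mpr hA0) (sub_pos.mpr hgain)
  have hev1 := hd.eventually_lt_const (show (0 : ℝ) < m / 2 by positivity)
  have hsum : Tendsto (fun k => 1 / ((φ k : ℝ) + 1) + (dist (K k) L / κ + dist (K k) L / (m / 2)))
      atTop (nhds 0) := by
    simpa using hδ0.add ((hd.div_const κ).add (hd.div_const (m / 2)))
  obtain ⟨k, hk1, hk2⟩ := (hev1.and (hsum.eventually_lt_const hgap)).exists
  set d := dist (K k) L with hdd
  have hd0 : 0 ≤ d := dist_nonneg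
  set z' := z (φ k) with hz'
  set Ω' := Ω (φ k) with hΩ'
  have hsh : ∀ y : Sph n, supportFn Ω' (z' + w) y = supportFn Ω' z' y - inner ℝ (y : Eucl n) w := by
    intro y
    rw [supportFn_eq_sub, supportFn_eq_sub Ω' z', inner_add_right]
    ring
  have hlow : ∀ y : Sph n, U y - inner ℝ (y : Eucl n) w ≤ supportFn Ω' (z' + w) y + d := by
    intro y
    rw [hsh]
    linarith [hle2 k y]
  have hadm' : Adm Ω' (z' + w) := fun y => by linarith [hlow y, hmin y]
  have hmax0 : ∀ y : Sph n, 0 < max (U y) κ := fun y => lt_max_of_lt_right hκ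
  have hint1 : Integrable (fun y : Sph n => Real.log (max (U y) κ)) (sphereMeasure n) :=
    integrable_of_continuous
      (((hUc.comp continuous_subtype_val).max continuous_const).log fun y => (hmax0 y).ne')
  have hint2 : Integrable (fun y : Sph n => Real.log (U y - inner ℝ (y : Eucl n) w))
      (sphereMeasure n) := integrable_of_continuous (hUwc.log fun y => (hpos y).ne')
  -- The support functions converge uniformly, but their logarithms need not where `U` vanishes. The
  -- truncation at `κ` gives the upper bound with an error proportional to the distance.
  have hup : meanLog Ω' z' ≤ A⁻¹ * I₁ + d / κ := by
    have h := inv_mul_integral_le ((hadm (φ k)).integrable_log.sub hint1) (c := d / κ)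
      (ae_of_all _ fun y => by
        simp only [Pi.sub_apply]
        have h1 : Real.log (supportFn Ω' z' y) ≤ Real.log (max (U y) κ + d) :=
          Real.log_le_log (hadm _ y) ((hle1 k y).trans (by gcongr; exact le_max_left _ _))
        have h2 := log_add_le hκ (le_max_right (U y) κ) hd0
        linarith)
    simp only [Pi.sub_apply] at h
    rw [integral_sub (hadm (φ k)).integrable_log hint1, mul_sub] at h
    exact sub_le_iff_le_add'.mp h
  have hdown : A⁻¹ * I₂ ≤ meanLog Ω' (z' + w) + d / (m / 2) := by
    have h := inv_mul_integral_le (hint2.sub hadm'.integrable_log) (c := d / (m / 2))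
      (ae_of_all _ fun y => by
        simp only [Pi.sub_apply]
        have h1 : Real.log (U y - inner ℝ (y : Eucl n) w) ≤
            Real.log (supportFn Ω' (z' + w) y + d) := Real.log_le_log (hpos y) (hlow y)
        have h2 := log_add_le (a := supportFn Ω' (z' + w) y) (κ := m / 2) (by positivity)
          (by linarith [hlow y, hmin y]) hd0
        linarith)
    simp only [Pi.sub_apply] at h
    rw [integral_sub hint2 hadm'.integrable_log, mul_sub] at h
    exact sub_le_iff_le_add'.mp h
  have := hbad (φ k) (z' + w) hadm'
  rw [mul_sub] at hk2
  linarith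

/-- Every convex body of positive volume in a ball has a maximizer of the mean logarithm, and the
maximizer is at a definite distance from the boundary. -/
theorem exists_maximizer (n : ℕ) {v : ENNReal} (hv : 0 < v) (D : ℝ) :
    ∃ δ : ℝ, 0 < δ ∧ ∀ Ω : ConvexBody (Eucl n),
      v ≤ volume (Ω : Set (Eucl n)) → diam (Ω : Set (Eucl n)) ≤ D →
      ∃ e, (∀ x, δ ≤ supportFn Ω e x) ∧ meanLog Ω e = entropy Ω := by
  obtain ⟨δ, hδ, h⟩ := exists_meanLog_gain n hv D
  refine ⟨δ, hδ, fun Ω hvol hdiam => ?_⟩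
  have hne : (meanLog Ω '' {z | ∀ x, 0 < supportFn Ω z x}).Nonempty := by
    obtain ⟨p, hp⟩ := exists_adm (hv.trans_le hvol)
    exact ⟨_, p, hp, rfl⟩
  set C : Set (Eucl n) := {z | ∀ x, δ ≤ supportFn Ω z x} with hC
  have hCsub : C ⊆ Ω := fun z hz => Adm.mem fun x => hδ.trans_le (hz x)
  have hCcl : IsClosed C := by
    simp only [hC, supportFn_eq Ω, ofPred_forall]
    exact isClosed_iInter fun x => isClosed_le continuous_const (by fun_prop)
  have hCcp : IsCompact C := Ω.isCompact.of_isClosed_subset hCcl hCsub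
  -- A point outside `C` could be improved by more than `δ`, beyond the entropy. So near-maximizers
  -- stay in the compact set `C`, on which the mean logarithm is continuous.
  have hbig : ∀ z, Adm Ω z → entropy Ω - δ ≤ meanLog Ω z → z ∈ C := by
    intro z hz hle x
    by_contra hlt
    obtain ⟨w, hw, hgt⟩ := h Ω z hvol
      ((subset_closedBall_diam hz.mem).trans (closedBall_subset_closedBall hdiam)) hz
      ⟨x, not_le.mp hlt⟩
    linarith [hw.meanLog_le_entropy]
  obtain ⟨_, ⟨z₀, hz₀, rfl⟩, hz₀'⟩ := exists_lt_of_lt_csSup hne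
    (show entropy Ω - δ < entropy Ω by linarith)
  have hz₀C : z₀ ∈ C := hbig z₀ hz₀ hz₀'.le
  have hcont : ContinuousOn (meanLog Ω) C := by
    refine ContinuousOn.mul continuousOn_const ?_
    refine continuousOn_of_dominated (bound := fun _ => |Real.log δ| + |Real.log D|) ?_ ?_ ?_ ?_
    · intro z hz
      exact (Adm.continuous_log fun x => hδ.trans_le (hz x)).aestronglyMeasurable
    · intro z hz
      refine ae_of_all _ fun x => ?_
      have hpos := hδ.trans_le (hz x)
      have h1 := Real.log_le_log hδ (hz x)
      have h2 := Real.log_le_log hpos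
        ((supportFn_le (subset_closedBall_diam (hCsub hz)) x).trans hdiam)
      rw [Real.norm_eq_abs, abs_le]
      have h3 := neg_abs_le (Real.log δ)
      have h4 := le_abs_self (Real.log D)
      have h5 := abs_nonneg (Real.log D)
      have h6 := abs_nonneg (Real.log δ)
      constructor <;> linarith
    · exact integrable_const _
    · refine ae_of_all _ fun x => ?_
      refine ContinuousOn.log ?_ fun z hz => (hδ.trans_le (hz x)).ne'
      simp only [supportFn_eq Ω]
      fun_prop
  obtain ⟨e, heC, hmax⟩ := hCcp.exists_isMaxOn ⟨z₀, hz₀C⟩ hcont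
  have hadm : Adm Ω e := fun x => hδ.trans_le (heC x)
  refine ⟨e, heC, le_antisymm hadm.meanLog_le_entropy ?_⟩
  refine le_of_forall_lt fun a ha => ?_
  obtain ⟨_, ⟨z, hz, rfl⟩, hz'⟩ := exists_lt_of_lt_csSup hne
    (show max a (entropy Ω - δ) < entropy Ω from max_lt ha (by linarith))
  have hzC := hbig z hz ((le_max_right _ _).trans hz'.le)
  exact ((le_max_left _ _).trans_lt hz').trans_le (hmax hzC)

/-- If both points attain the entropy, the right-hand side of the stability estimate is zero.
Boundary points of `Ω` are excluded too, as that estimate admits them. -/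
theorem isEntropyPoint_iff {Ω : ConvexBody (Eucl n)} {e : Eucl n} (he : Adm Ω e)
    (hmax : meanLog Ω e = entropy Ω) (z : Eucl n) : IsEntropyPoint Ω z ↔ z = e := by
  constructor
  · intro hz
    obtain ⟨c, hc, hst⟩ := exists_stability n
    have h := hst Ω _ le_rfl e z he hz.mem hz.ae_pos hz.integrable
    rw [hmax, hz.attained] at h
    have h0 : 0 < diam (Ω : Set (Eucl n)) :=
      (he (northPole n)).trans_le (supportFn_le (subset_closedBall_diam he.mem) _)
    have h1 : ‖e - z‖ ^ 2 / diam (Ω : Set (Eucl n)) ^ 2 ≤ 0 := by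
      by_contra hcon
      have := mul_pos hc (not_le.mp hcon)
      linarith
    have h2 : ‖e - z‖ ^ 2 ≤ 0 := by
      rwa [div_le_iff₀ (by positivity), zero_mul] at h1
    have h3 : ‖e - z‖ = 0 := by nlinarith [norm_nonneg (e - z)]
    exact (sub_eq_zero.mp (norm_eq_zero.mp h3)).symm
  · rintro rfl
    exact ⟨he.mem, ae_of_all _ he, he.integrable_log, hmax⟩

theorem le_infDist_frontier {Ω : ConvexBody (Eucl n)} {e : Eucl n} {δ : ℝ} (hδ : 0 ≤ δ)
    (h : ∀ x, δ ≤ supportFn Ω e x) : δ ≤ infDist e (frontier (Ω : Set (Eucl n))) := by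
  have hsub := (closedBall_subset_iff hδ).mpr h
  have hne : (frontier (Ω : Set (Eucl n))).Nonempty := by
    by_contra hemp
    rw [not_nonempty_iff_eq_empty, frontier_eq_empty_iff] at hemp
    rcases hemp with hemp | hemp
    · exact Ω.nonempty.ne_empty hemp
    · have := Ω.isCompact
      rw [hemp] at this
      exact noncompact_univ _ this
  rw [le_infDist hne]
  intro y hy
  by_contra hlt
  have hy' : y ∈ ball e δ := by rw [mem_ball']; exact not_le.mp hlt
  exact hy.2 (interior_maximal (ball_subset_closedBall.trans hsub) isOpen_ball hy')

/-- The entropy controls the diameter. -/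
theorem exists_diam_le (n : ℕ) (A : ℝ) : ∃ D : ℝ, 0 < D ∧ ∀ Ω : ConvexBody (Eucl n),
    0 < volume (Ω : Set (Eucl n)) → entropy Ω ≤ A → diam (Ω : Set (Eucl n)) ≤ D := by
  set C := ((sphereMeasure n).real univ)⁻¹ *
    ∫ x : Sph n, Real.log |inner ℝ (x : Eucl n) (northPole n : Eucl n)| ∂(sphereMeasure n) with hC
  refine ⟨4 * Real.exp (A - C), by positivity, fun Ω hv hA => ?_⟩
  refine diam_le_of_forall_dist_le (by positivity) fun y₁ hy₁ y₂ hy₂ => ?_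
  by_cases heq : y₁ = y₂
  · rw [heq, dist_self]; positivity
  obtain ⟨p, hp⟩ := exists_adm hv
  have hne : y₁ - y₂ ≠ 0 := sub_ne_zero.mpr heq
  set l := ‖y₁ - y₂‖ with hl
  have hl0 : 0 < l := norm_pos_iff.mpr hne
  set ξ := toSph (y₁ - y₂) with hξ
  have hlξ : l • (ξ : Eucl n) = y₁ - y₂ := norm_smul_toSph hne
  -- Mixing the midpoint of the chord with an admissible `p` keeps the centre admissible, while the
  -- chord forces the support function to be at least `(l/4)|⟨x, ξ⟩|`, whose mean logarithm is `log
  -- (l/4) + C` for every `ξ`.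
  set z : Eucl n := (2 : ℝ)⁻¹ • p + (4 : ℝ)⁻¹ • (y₁ + y₂) with hz
  have hlow : ∀ x : Sph n, l / 4 * |inner ℝ (x : Eucl n) (ξ : Eucl n)| + supportFn Ω p x / 2 ≤
      supportFn Ω z x := by
    intro x
    have h1 := mem_iff_inner_le.mp hy₁ x
    have h2 := mem_iff_inner_le.mp hy₂ x
    have h3 : l * inner ℝ (x : Eucl n) (ξ : Eucl n) =
        inner ℝ (x : Eucl n) y₁ - inner ℝ (x : Eucl n) y₂ := by
      rw [← real_inner_smul_right, hlξ, inner_sub_right]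
    have h4 : l * |inner ℝ (x : Eucl n) (ξ : Eucl n)| =
        |inner ℝ (x : Eucl n) y₁ - inner ℝ (x : Eucl n) y₂| := by
      rw [← h3, abs_mul, abs_of_pos hl0]
    have h5 : |inner ℝ (x : Eucl n) y₁ - inner ℝ (x : Eucl n) y₂| ≤
        2 * supportFn Ω 0 x - inner ℝ (x : Eucl n) y₁ - inner ℝ (x : Eucl n) y₂ := by
      rw [abs_le]; constructor <;> linarith
    rw [supportFn_eq_sub Ω z, supportFn_eq_sub Ω p, hz, inner_add_right, real_inner_smul_right,
      real_inner_smul_right, inner_add_right]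
    linarith
  have hadm : Adm Ω z := fun x => by
    have := hlow x
    have h2 := hp x
    have : 0 ≤ l / 4 * |inner ℝ (x : Eucl n) (ξ : Eucl n)| := by positivity
    linarith
  have hle : Real.log (l / 4) ≤ meanLog Ω z - C := by
    have h := le_inv_mul_integral (hadm.integrable_log.sub (integrable_log_abs_inner ξ))
      (c := Real.log (l / 4)) (by
        filter_upwards [ae_inner_ne_zero ξ] with x hx
        have hx' : 0 < |inner ℝ (x : Eucl n) (ξ : Eucl n)| := abs_pos.mpr hx
        simp only [Pi.sub_apply]
        rw [le_sub_iff_add_le, ← Real.log_mul (by positivity) hx'.ne']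
        exact Real.log_le_log (by positivity) (by linarith [hlow x, hp x]))
    simp only [Pi.sub_apply] at h
    rw [integral_sub hadm.integrable_log (integrable_log_abs_inner ξ), integral_log_abs_inner,
      mul_sub] at h
    exact h
  have h1 : Real.log (l / 4) ≤ A - C := by linarith [hadm.meanLog_le_entropy]
  rw [Real.log_le_iff_le_exp (by positivity)] at h1
  rw [dist_eq_norm]
  linarith

end EntropyPoints

/-! ### The one-homogeneous extension and its convexity. -/

section Extension

/-- The extension of a function on the sphere that is homogeneous of degree one. -/
def homExt (f : Sph n → ℝ) (y : Eucl n) : ℝ := ‖y‖ * radialExt f y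

/-- Functions on the sphere of class `C²`. -/
def IsC2 (f : Sph n → ℝ) : Prop := ∀ y : Eucl n, y ≠ 0 → ContDiffAt ℝ 2 (radialExt f) y

section homExt

variable {f : Sph n → ℝ}

theorem homExt_coe (f : Sph n → ℝ) (x : Sph n) : homExt f x = f x := by
  rw [homExt, radialExt_coe, sph_norm, one_mul]

theorem homExt_eq (f : Sph n → ℝ) (y : Eucl n) : homExt f y = ‖y‖ * f (toSph y) := by
  by_cases hy : y = 0
  · simp [homExt, hy]
  · rw [homExt, radialExt_eq f hy]

theorem homExt_smul (f : Sph n → ℝ) {r : ℝ} (hr : 0 < r) (y : Eucl n) :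
    homExt f (r • y) = r * homExt f y := by
  rw [homExt, homExt, radialExt_smul f hr, norm_smul, Real.norm_of_nonneg hr.le, mul_assoc]

theorem IsC2.homExt (hf : IsC2 f) {y : Eucl n} (hy : y ≠ 0) : ContDiffAt ℝ 2 (homExt f) y :=
  (contDiffAt_norm ℝ hy).mul (hf y hy)

theorem IsC2.continuous (hf : IsC2 f) : Continuous f := by
  have h : ContinuousOn (radialExt f) {0}ᶜ := fun y hy => (hf y hy).continuousAt.continuousWithinAt
  have : f = fun x : Sph n => radialExt f x := funext fun x => (radialExt_coe f x).symm
  rw [this]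
  exact h.comp_continuous continuous_subtype_val fun x => sph_ne_zero x

theorem IsC2.differentiableAt_homExt (hf : IsC2 f) {y : Eucl n} (hy : y ≠ 0) :
    DifferentiableAt ℝ (GaussFlow.homExt f) y := (hf.homExt hy).differentiableAt (by norm_num)

theorem IsC2.contDiffAt_fderiv (hf : IsC2 f) {y : Eucl n} (hy : y ≠ 0) :
    ContDiffAt ℝ 1 (fderiv ℝ (GaussFlow.homExt f)) y :=
  (hf.homExt hy).fderiv_right (m := 1) (by norm_num)

theorem IsC2.differentiableAt_fderiv (hf : IsC2 f) {y : Eucl n} (hy : y ≠ 0) :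
    DifferentiableAt ℝ (fderiv ℝ (GaussFlow.homExt f)) y :=
  (hf.contDiffAt_fderiv hy).differentiableAt (by norm_num)

theorem fderiv_homExt_smul (f : Sph n → ℝ) {r : ℝ} (hr : 0 < r) (y : Eucl n) :
    fderiv ℝ (homExt f) (r • y) = fderiv ℝ (homExt f) y := by
  have h1 : (fun y => homExt f (r • y)) = fun y => r • homExt f y :=
    funext fun y => homExt_smul f hr y
  have h2 : fderiv ℝ (fun y => homExt f (r • y)) y = r • fderiv ℝ (homExt f) (r • y) :=
    fderiv_comp_smul r
  have h3 : fderiv ℝ (fun y => r • homExt f y) y = r • fderiv ℝ (homExt f) y :=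
    congrFun (fderiv_const_smul_field r (f := homExt f)) y
  rw [h1, h3] at h2
  exact (smul_right_injective _ hr.ne' h2).symm

theorem fderiv_fderiv_homExt_smul (f : Sph n → ℝ) {r : ℝ} (hr : 0 < r) (y : Eucl n) :
    fderiv ℝ (fderiv ℝ (homExt f)) y = r • fderiv ℝ (fderiv ℝ (homExt f)) (r • y) := by
  have h1 : (fun y => fderiv ℝ (homExt f) (r • y)) = fderiv ℝ (homExt f) :=
    funext fun y => fderiv_homExt_smul f hr y
  have h2 : fderiv ℝ (fun y => fderiv ℝ (homExt f) (r • y)) y =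
      r • fderiv ℝ (fderiv ℝ (homExt f)) (r • y) := fderiv_comp_smul r
  rwa [h1] at h2

theorem hasDerivAt_smul_id (y : Eucl n) : HasDerivAt (fun r : ℝ => r • y) y 1 := by
  simpa using (hasDerivAt_id (1 : ℝ)).smul_const y

theorem fderiv_homExt_self (hf : IsC2 f) {y : Eucl n} (hy : y ≠ 0) :
    fderiv ℝ (homExt f) y y = homExt f y := by
  have hd : HasFDerivAt (homExt f) (fderiv ℝ (homExt f) y) ((1 : ℝ) • y) := by
    rw [one_smul]; exact (hf.differentiableAt_homExt hy).hasFDerivAt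
  have h1 : HasDerivAt (homExt f ∘ fun r : ℝ => r • y) (fderiv ℝ (homExt f) y y) 1 :=
    hd.comp_hasDerivAt 1 (hasDerivAt_smul_id y)
  have h2 : HasDerivAt (fun r : ℝ => r * homExt f y) (homExt f y) 1 := by
    simpa using (hasDerivAt_id (1 : ℝ)).mul_const (homExt f y)
  refine h1.unique (h2.congr_of_eventuallyEq ?_)
  filter_upwards [lt_mem_nhds (one_pos (α := ℝ))] with r hr
  exact homExt_smul f hr y

theorem fderiv_fderiv_homExt_self (hf : IsC2 f) {y : Eucl n} (hy : y ≠ 0) :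
    fderiv ℝ (fderiv ℝ (homExt f)) y y = 0 := by
  have hd : HasFDerivAt (fderiv ℝ (homExt f)) (fderiv ℝ (fderiv ℝ (homExt f)) y) ((1 : ℝ) • y) := by
    rw [one_smul]; exact (hf.differentiableAt_fderiv hy).hasFDerivAt
  have h1 : HasDerivAt (fun r : ℝ => fderiv ℝ (homExt f) (r • y))
      (fderiv ℝ (fderiv ℝ (homExt f)) y y) 1 := hd.comp_hasDerivAt 1 (hasDerivAt_smul_id y)
  refine h1.unique ((hasDerivAt_const (1 : ℝ) (fderiv ℝ (homExt f) y)).congr_of_eventuallyEq ?_)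
  filter_upwards [lt_mem_nhds (one_pos (α := ℝ))] with r hr
  exact fderiv_homExt_smul f hr y

theorem fderiv_fderiv_homExt_symm (hf : IsC2 f) {y : Eucl n} (hy : y ≠ 0) (v w : Eucl n) :
    fderiv ℝ (fderiv ℝ (homExt f)) y v w = fderiv ℝ (fderiv ℝ (homExt f)) y w v :=
  (hf.homExt hy).isSymmSndFDerivAt (by simp) v w

theorem hasFDerivAt_norm' {y : Eucl n} (hy : y ≠ 0) :
    HasFDerivAt (fun y : Eucl n => ‖y‖) (‖y‖⁻¹ • innerSL ℝ y) y := by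
  have h := (hasStrictFDerivAt_norm_sq y).hasFDerivAt.sqrt (by simpa using hy)
  simp only [Real.sqrt_sq (norm_nonneg _)] at h
  refine h.congr_fderiv ?_
  ext v
  have : ‖y‖ ≠ 0 := norm_ne_zero_iff.mpr hy
  simp
  field_simp

theorem fderiv_homExt_apply (hf : IsC2 f) {y : Eucl n} (hy : y ≠ 0) (w : Eucl n) :
    fderiv ℝ (homExt f) y w =
      ‖y‖ * fderiv ℝ (radialExt f) y w + radialExt f y * (‖y‖⁻¹ * inner ℝ y w) := by
  have h := (hasFDerivAt_norm' hy).mul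
    ((hf y hy).differentiableAt (by norm_num)).hasFDerivAt
  have h2 : HasFDerivAt (homExt f) _ y := h
  rw [h2.fderiv]
  simp

theorem tangent_inner {x : Sph n} (v : Tangent x) : inner ℝ (x : Eucl n) (v : Eucl n) = 0 :=
  Submodule.mem_orthogonal_singleton_iff_inner_right.mp v.2

/-- Differentiating `‖y‖ * radialExt f y` twice, the Hessian of the norm contributes the term `f g`.
Thus `∇²f + f g` becomes an ordinary Euclidean Hessian. -/
theorem fderiv_fderiv_homExt_tangent (hf : IsC2 f) (x : Sph n) (v w : Tangent x) :
    fderiv ℝ (fderiv ℝ (homExt f)) x v w = formA f x v w := by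
  have hx := sph_ne_zero x
  have h1 : fderiv ℝ (fderiv ℝ (homExt f)) x v w =
      fderiv ℝ (fun y => fderiv ℝ (homExt f) y (w : Eucl n)) x v := by
    rw [fderiv_clm_apply (hf.differentiableAt_fderiv hx) (differentiableAt_const _)]
    simp
  have hev : (fun y => fderiv ℝ (homExt f) y (w : Eucl n)) =ᶠ[nhds (x : Eucl n)] fun y =>
      ‖y‖ * fderiv ℝ (radialExt f) y w + radialExt f y * (‖y‖⁻¹ * inner ℝ y w) := by
    filter_upwards [isOpen_compl_singleton.mem_nhds hx] with y hy
    exact fderiv_homExt_apply hf hy _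
  have hN := hasFDerivAt_norm' hx
  have hF := ((hf x hx).differentiableAt (by norm_num)).hasFDerivAt
  have hF1 : DifferentiableAt ℝ (fderiv ℝ (radialExt f)) (x : Eucl n) :=
    ((hf x hx).fderiv_right (m := 1) (by norm_num)).differentiableAt (by norm_num)
  have hF2 : HasFDerivAt (fun y => fderiv ℝ (radialExt f) y (w : Eucl n))
      ((fderiv ℝ (fderiv ℝ (radialExt f)) x).flip w) (x : Eucl n) := by
    have := hF1.hasFDerivAt.clm_apply (hasFDerivAt_const (w : Eucl n) (x : Eucl n))
    refine this.congr_fderiv ?_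
    ext v
    simp
  have hI : HasFDerivAt (fun y : Eucl n => inner ℝ y (w : Eucl n)) (innerSL ℝ (w : Eucl n))
      (x : Eucl n) := by
    have : (fun y : Eucl n => inner ℝ y (w : Eucl n)) = innerSL ℝ (w : Eucl n) := by
      funext y; simp [real_inner_comm]
    rw [this]
    exact (innerSL ℝ (w : Eucl n)).hasFDerivAt
  have hNi : HasFDerivAt (fun y : Eucl n => ‖y‖⁻¹) _ (x : Eucl n) :=
    (hasDerivAt_inv (norm_ne_zero_iff.mpr hx)).comp_hasFDerivAt (x : Eucl n) hN
  have htot : HasFDerivAt (fun y : Eucl n => ‖y‖ * fderiv ℝ (radialExt f) y w +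
      radialExt f y * (‖y‖⁻¹ * inner ℝ y w)) _ (x : Eucl n) :=
    (hN.mul hF2).add (hF.mul (hNi.mul hI))
  rw [h1, hev.fderiv_eq, htot.fderiv, formA, sphereHess]
  simp [tangent_inner, radialExt_coe, real_inner_comm]

theorem sub_inner_smul_mem_tangent (x : Sph n) (v : Eucl n) :
    v - inner ℝ (x : Eucl n) v • (x : Eucl n) ∈ Tangent x := by
  rw [Submodule.mem_orthogonal_singleton_iff_inner_right, inner_sub_right, real_inner_smul_right,
    real_inner_self_eq_norm_sq, sph_norm]
  ring

theorem fderiv_fderiv_homExt_pos (hf : IsC2 f) (hA : APos f) {y d : Eucl n} (hy : y ≠ 0)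
    (hd : ∀ c : ℝ, d ≠ c • y) : 0 < fderiv ℝ (fderiv ℝ (homExt f)) y d d := by
  set x := toSph y with hx
  have hyp : 0 < ‖y‖ := norm_pos_iff.mpr hy
  have hxy : ‖y‖ • (x : Eucl n) = y := norm_smul_toSph hy
  set c := inner ℝ (x : Eucl n) d with hc
  set v : Tangent x := ⟨d - c • (x : Eucl n), sub_inner_smul_mem_tangent x d⟩ with hv
  have hv0 : v ≠ 0 := by
    intro h
    have h1 : d - c • (x : Eucl n) = 0 := congrArg Subtype.val h
    apply hd (c * ‖y‖⁻¹)
    rw [mul_smul, ← coe_toSph hy]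
    exact sub_eq_zero.mp h1
  have hdv : d = (v : Eucl n) + c • (x : Eucl n) := by simp [hv]
  have h0 := hA x v hv0
  rw [← fderiv_fderiv_homExt_tangent hf] at h0
  have h1 := fderiv_fderiv_homExt_smul f hyp (x : Eucl n)
  rw [hxy] at h1
  have hsx := sph_ne_zero x
  have h2 : fderiv ℝ (fderiv ℝ (homExt f)) x d d = fderiv ℝ (fderiv ℝ (homExt f)) x v v := by
    rw [hdv]
    simp only [map_add, map_smul, add_apply, smul_apply,
      fderiv_fderiv_homExt_self hf hsx, fderiv_fderiv_homExt_symm hf hsx (v : Eucl n) (x : Eucl n)]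
    simp
  rw [← h2, h1] at h0
  simp only [smul_apply, smul_eq_mul] at h0
  exact (mul_pos_iff_of_pos_left hyp).mp h0

/-- The extension is strictly convex along the chord from `x` to `x'`, which avoids the origin
unless `x' = -x`; in that case positivity of `f` suffices. -/
theorem fderiv_homExt_lt (hf : IsC2 f) (hA : APos f) (hpos : ∀ x, 0 < f x) {x x' : Sph n}
    (hne : x' ≠ x) : fderiv ℝ (homExt f) x x' < f x' := by
  have hx := sph_ne_zero x
  by_cases hanti : x' = -x
  · have h1 := fderiv_homExt_self hf hx
    rw [homExt_coe] at h1
    have h2 := hpos x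
    have h3 := hpos x'
    rw [hanti, coe_neg_sphere, map_neg, h1]
    rw [hanti] at h3
    linarith
  have hcol : ∀ c : ℝ, (x' : Eucl n) ≠ c • (x : Eucl n) := by
    intro c h
    have h1 := sph_norm x'
    rw [h, norm_smul, sph_norm, mul_one, Real.norm_eq_abs] at h1
    rcases eq_or_eq_neg_of_abs_eq h1 with h2 | h2
    · exact hne (Subtype.ext (by rw [h, h2, one_smul]))
    · exact hanti (Subtype.ext (by rw [h, h2, coe_neg_sphere, neg_one_smul]))
  have hdx : ∀ a b : ℝ, a • (x : Eucl n) + b • (x' : Eucl n) = 0 → b = 0 := by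
    intro a b h
    by_contra hb
    apply hcol (-(b⁻¹ * a))
    have : (x' : Eucl n) = b⁻¹ • (b • (x' : Eucl n)) := by
      rw [smul_smul, inv_mul_cancel₀ hb, one_smul]
    rw [this, eq_neg_of_add_eq_zero_right h, smul_neg, smul_smul, neg_smul]
  set d : Eucl n := (x' : Eucl n) - x with hd
  set p : ℝ → Eucl n := fun τ => (x : Eucl n) + τ • d with hp
  have hpd : ∀ τ, HasDerivAt p d τ := fun τ => by
    have := ((hasDerivAt_id τ).smul_const d).const_add (x : Eucl n)
    rwa [one_smul] at this
  have hp0 : ∀ τ, p τ ≠ 0 := by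
    intro τ h
    have h1 : (1 - τ) • (x : Eucl n) + τ • (x' : Eucl n) = 0 := by
      refine Eq.trans ?_ h
      simp only [hp, hd]
      module
    have h2 := hdx _ _ h1
    rw [hp] at h
    simp only [h2, zero_smul, add_zero] at h
    exact hx h
  have hpc : ∀ τ c : ℝ, d ≠ c • p τ := by
    intro τ c h
    have h1 : (-1 - c * (1 - τ)) • (x : Eucl n) + (1 - c * τ) • (x' : Eucl n) = 0 := by
      refine Eq.trans ?_ (sub_eq_zero.mpr h)
      simp only [hp, hd]
      module
    have h2 := hdx _ _ h1
    rw [h2, zero_smul, add_zero] at h1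
    have h3 := (smul_eq_zero.mp h1).resolve_right hx
    have h4 : c = 0 := by linarith
    rw [h4] at h2
    norm_num at h2
  set h' : ℝ → ℝ := fun τ => fderiv ℝ (homExt f) (p τ) d with hh'
  have hder1 : ∀ τ, HasDerivAt (fun τ => homExt f (p τ)) (h' τ) τ := fun τ =>
    (hf.differentiableAt_homExt (hp0 τ)).hasFDerivAt.comp_hasDerivAt τ (hpd τ)
  have hder2 : ∀ τ, HasDerivAt h' (fderiv ℝ (fderiv ℝ (homExt f)) (p τ) d d) τ := fun τ => by
    have := ((hf.differentiableAt_fderiv (hp0 τ)).hasFDerivAt.comp_hasDerivAt τ (hpd τ)).clm_apply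
      (hasDerivAt_const τ d)
    simpa using this
  have hmono : StrictMono h' := strictMono_of_deriv_pos fun τ => by
    rw [(hder2 τ).deriv]
    exact fderiv_fderiv_homExt_pos hf hA (hp0 τ) (hpc τ)
  obtain ⟨ξ, hξ, he⟩ := exists_hasDerivAt_eq_slope (fun τ => homExt f (p τ)) h' zero_lt_one
    (fun τ _ => (hder1 τ).continuousAt.continuousWithinAt) fun τ _ => hder1 τ
  have h01 := hmono hξ.1
  have hp1 : p 1 = x' := by simp [hp, hd]
  have hpz : p 0 = x := by simp [hp]
  simp only [hp1, hpz, homExt_coe, sub_zero, div_one] at he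
  have h3 : h' 0 = fderiv ℝ (homExt f) x x' - f x := by
    simp only [hh', hpz, hd, map_sub]
    rw [fderiv_homExt_self hf hx, homExt_coe]
  linarith

theorem fderiv_homExt_le (hf : IsC2 f) (hA : APos f) (hpos : ∀ x, 0 < f x) (x x' : Sph n) :
    fderiv ℝ (homExt f) x x' ≤ f x' := by
  by_cases h : x' = x
  · rw [h, fderiv_homExt_self hf (sph_ne_zero x), homExt_coe]
  · exact (fderiv_homExt_lt hf hA hpos h).le

end homExt

end Extension

/-! ### Volume of the body with a given support function, by change of variables. -/

section WulffVolume

/-- The Riesz representation in coordinates. -/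
def riesz (n : ℕ) : (Eucl n →L[ℝ] ℝ) →L[ℝ] Eucl n :=
  ∑ i, (ContinuousLinearMap.apply ℝ ℝ (EuclideanSpace.basisFun (Fin (n + 1)) ℝ i)).smulRight
    (EuclideanSpace.basisFun (Fin (n + 1)) ℝ i)

theorem inner_riesz (T : Eucl n →L[ℝ] ℝ) (v : Eucl n) : inner ℝ v (riesz n T) = T v := by
  have h := (EuclideanSpace.basisFun (Fin (n + 1)) ℝ).sum_repr' v
  conv_rhs => rw [← h]
  simp [riesz, inner_sum, inner_smul_right, real_inner_comm, mul_comm]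

/-- An orthonormal basis of the ambient space adapted to the splitting into the radial line and
the tangent space. -/
theorem exists_adapted_basis (x : Sph n) :
    ∃ b : OrthonormalBasis (Unit ⊕ Fin (Module.finrank ℝ (Tangent x))) ℝ (Eucl n),
      b (Sum.inl ()) = x ∧ ∀ i, b (Sum.inr i) = stdOrthonormalBasis ℝ (Tangent x) i := by
  set e := stdOrthonormalBasis ℝ (Tangent x) with he
  set w : Unit ⊕ Fin (Module.finrank ℝ (Tangent x)) → Eucl n :=
    Sum.elim (fun _ => (x : Eucl n)) (fun i => (e i : Eucl n)) with hw
  have hon : Orthonormal ℝ w := by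
    constructor
    · rintro (_ | i)
      · exact sph_norm x
      · exact e.orthonormal.1 i
    · rintro (_ | i) (_ | j) hij
      · exact absurd rfl hij
      · exact tangent_inner (e j)
      · have := tangent_inner (e i)
        rw [real_inner_comm] at this
        exact this
      · have hij' : i ≠ j := fun h => hij (by rw [h])
        exact e.orthonormal.2 hij'
  have hcard : Fintype.card (Unit ⊕ Fin (Module.finrank ℝ (Tangent x))) =
      Module.finrank ℝ (Eucl n) := by
    have : Fact (Module.finrank ℝ (Eucl n) = n + 1) := ⟨finrank_euclideanSpace_fin⟩
    rw [Fintype.card_sum, Fintype.card_unit, Fintype.card_fin,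
      Submodule.finrank_orthogonal_span_singleton (n := n) (sph_ne_zero x),
      finrank_euclideanSpace_fin, add_comm]
  have hspan : ⊤ ≤ Submodule.span ℝ (Set.range w) := by
    have := (basisOfOrthonormalOfCardEqFinrank hon hcard).span_eq
    rw [coe_basisOfOrthonormalOfCardEqFinrank] at this
    exact this.ge
  refine ⟨OrthonormalBasis.mk hon hspan, ?_, fun i => ?_⟩
  · rw [OrthonormalBasis.coe_mk]; rfl
  · rw [OrthonormalBasis.coe_mk]; rfl

/-- In a basis adapted to `x`, the Schur complement of the radial entry removes the rank-one part
from the tangential block and leaves `H` alone. -/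
theorem det_smulRight_add (x : Sph n) (l : Eucl n →L[ℝ] ℝ) (G : Eucl n) (H : Eucl n →L[ℝ] Eucl n)
    (hl : l x ≠ 0) (hG : inner ℝ (x : Eucl n) G ≠ 0) (hHx : H x = 0)
    (hxH : ∀ v, inner ℝ (x : Eucl n) (H v) = 0) :
    (l.smulRight G + H).det = l x * inner ℝ (x : Eucl n) G * Matrix.det (Matrix.of fun i j =>
      inner ℝ (stdOrthonormalBasis ℝ (Tangent x) i : Eucl n)
        (H (stdOrthonormalBasis ℝ (Tangent x) j))) := by
  obtain ⟨b, hb0, hb⟩ := exists_adapted_basis x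
  rw [ContinuousLinearMap.det, ← LinearMap.det_toMatrix b.toBasis]
  set e := stdOrthonormalBasis ℝ (Tangent x) with he
  set a := l x * inner ℝ (x : Eucl n) G with ha
  have ha0 : a ≠ 0 := mul_ne_zero hl hG
  have hmat : LinearMap.toMatrix b.toBasis b.toBasis ((l.smulRight G + H : Eucl n →L[ℝ] Eucl n) :
      Eucl n →ₗ[ℝ] Eucl n) = Matrix.fromBlocks
        (Matrix.of fun _ _ => a)
        (Matrix.of fun _ j => l (e j) * inner ℝ (x : Eucl n) G)
        (Matrix.of fun i _ => l x * inner ℝ (e i : Eucl n) G)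
        (Matrix.of fun i j => l (e j) * inner ℝ (e i : Eucl n) G +
          inner ℝ (e i : Eucl n) (H (e j))) := by
    ext i j
    rw [LinearMap.toMatrix_apply]
    rcases i with ⟨⟩ | i <;> rcases j with ⟨⟩ | j <;>
      simp [OrthonormalBasis.repr_apply_apply, hb0, hb, hHx, hxH, ha]
  rw [hmat]
  let _ : Invertible (Matrix.of fun (_ _ : Unit) => a) :=
    ⟨Matrix.of fun _ _ => a⁻¹, by ext; simp [Matrix.mul_apply, ha0],
      by ext; simp [Matrix.mul_apply, ha0]⟩
  have hinv : ⅟(Matrix.of fun (_ _ : Unit) => a) = Matrix.of fun _ _ => a⁻¹ := rfl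
  rw [Matrix.det_fromBlocks₁₁, hinv]
  congr 1
  · simp
  · congr 1
    ext i j
    simp [Matrix.mul_apply, ha]
    field_simp
    ring

section volume

variable {f g : Sph n → ℝ}

/-- The gradient of the homogeneous extension. -/
def gradExt (f : Sph n → ℝ) (y : Eucl n) : Eucl n := riesz n (fderiv ℝ (homExt f) y)

theorem inner_gradExt (f : Sph n → ℝ) (y v : Eucl n) :
    inner ℝ v (gradExt f y) = fderiv ℝ (homExt f) y v := inner_riesz _ _

theorem gradExt_smul (f : Sph n → ℝ) {r : ℝ} (hr : 0 < r) (y : Eucl n) :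
    gradExt f (r • y) = gradExt f y := by
  rw [gradExt, gradExt, fderiv_homExt_smul f hr]

theorem gradExt_toSph (f : Sph n → ℝ) {y : Eucl n} (hy : y ≠ 0) :
    gradExt f y = gradExt f (toSph y) := by
  conv_lhs => rw [← norm_smul_toSph hy]
  exact gradExt_smul f (norm_pos_iff.mpr hy) _

/-- The map sending `r x` to `r g(x)` times the boundary point with outer normal `x`. -/
def polarMap (f g : Sph n → ℝ) (y : Eucl n) : Eucl n := homExt g y • gradExt f y

theorem IsC2.gradExt (hf : IsC2 f) {y : Eucl n} (hy : y ≠ 0) : ContDiffAt ℝ 1 (gradExt f) y :=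
  (riesz n).contDiff.contDiffAt.comp y (hf.contDiffAt_fderiv hy)

theorem IsC2.polarMap (hf : IsC2 f) (hg : IsC2 g) {y : Eucl n} (hy : y ≠ 0) :
    ContDiffAt ℝ 1 (polarMap f g) y :=
  ((hg.homExt hy).of_le (by norm_num)).smul (hf.gradExt hy)

theorem hasFDerivAt_polarMap (hf : IsC2 f) (hg : IsC2 g) {y : Eucl n} (hy : y ≠ 0) :
    HasFDerivAt (polarMap f g) ((fderiv ℝ (homExt g) y).smulRight (gradExt f y) +
      homExt g y • (riesz n).comp (fderiv ℝ (fderiv ℝ (homExt f)) y)) y := by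
  have h1 := (hg.differentiableAt_homExt hy).hasFDerivAt
  have h2 : HasFDerivAt (gradExt f) ((riesz n).comp (fderiv ℝ (fderiv ℝ (homExt f)) y)) y :=
    (riesz n).hasFDerivAt.comp y (hf.differentiableAt_fderiv hy).hasFDerivAt
  exact (h1.smul h2).congr_fderiv (add_comm _ _)

/-- The derivative is a rank-one operator with radial entry `g f`, plus `g` times the Hessian at
`x`, which kills the radial direction. The factors `‖y‖` cancel by homogeneity. -/
theorem det_polarMap (hf : IsC2 f) (hg : IsC2 g) (hfpos : ∀ x, 0 < f x) (hgpos : ∀ x, 0 < g x)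
    {y : Eucl n} (hy : y ≠ 0) :
    (fderiv ℝ (polarMap f g) y).det =
      g (toSph y) ^ (n + 1) * (f (toSph y) * detA f (toSph y)) := by
  set x := toSph y with hx
  have hyp : 0 < ‖y‖ := norm_pos_iff.mpr hy
  have hxy : ‖y‖ • (x : Eucl n) = y := norm_smul_toSph hy
  have hx0 := sph_ne_zero x
  have hl : fderiv ℝ (homExt g) y x = g x := by
    conv_lhs => rw [← hxy, fderiv_homExt_smul g hyp]
    rw [fderiv_homExt_self hg hx0, homExt_coe]
  have hG : inner ℝ (x : Eucl n) (gradExt f y) = f x := by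
    rw [gradExt_toSph f hy, inner_gradExt, fderiv_homExt_self hf hx0, homExt_coe]
  have hH : ∀ v w : Eucl n,
      inner ℝ v ((homExt g y • (riesz n).comp (fderiv ℝ (fderiv ℝ (homExt f)) y)) w) =
        g x * fderiv ℝ (fderiv ℝ (homExt f)) x w v := by
    intro v w
    rw [smul_apply, inner_smul_right, ContinuousLinearMap.comp_apply, inner_riesz,
      fderiv_fderiv_homExt_smul f hyp (x : Eucl n), hxy, homExt_eq, ← hx]
    simp only [smul_apply, smul_eq_mul]
    ring
  rw [(hasFDerivAt_polarMap hf hg hy).fderiv, det_smulRight_add x, hl, hG]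
  · have hmat : (Matrix.of fun i j => inner ℝ (stdOrthonormalBasis ℝ (Tangent x) i : Eucl n)
        ((homExt g y • (riesz n).comp (fderiv ℝ (fderiv ℝ (homExt f)) y))
          (stdOrthonormalBasis ℝ (Tangent x) j))) = g x • Matrix.of fun i j =>
        formA f x (stdOrthonormalBasis ℝ (Tangent x) i) (stdOrthonormalBasis ℝ (Tangent x) j) := by
      ext i j
      rw [Matrix.of_apply, hH, fderiv_fderiv_homExt_symm hf hx0, fderiv_fderiv_homExt_tangent hf]
      rfl
    have : Fact (Module.finrank ℝ (Eucl n) = n + 1) := ⟨finrank_euclideanSpace_fin⟩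
    have hdim : Module.finrank ℝ (Tangent x) = n :=
      Submodule.finrank_orthogonal_span_singleton (n := n) hx0
    have hpow : g x ^ Module.finrank ℝ (Tangent x) = g x ^ n := congrArg (g x ^ ·) hdim
    rw [hmat, Matrix.det_smul, Fintype.card_fin, hpow, detA]
    ring
  · rw [hl]; exact (hgpos x).ne'
  · rw [hG]; exact (hfpos x).ne'
  · apply ext_inner_left ℝ
    intro v
    rw [hH, fderiv_fderiv_homExt_self hf hx0, inner_zero_right]
    simp
  · intro v
    rw [hH, fderiv_fderiv_homExt_symm hf hx0, fderiv_fderiv_homExt_self hf hx0]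
    simp

theorem detA_pos (hf : IsC2 f) (hA : APos f) (x : Sph n) : 0 < detA f x := by
  rw [detA]
  apply Matrix.PosDef.det_pos
  set e := stdOrthonormalBasis ℝ (Tangent x) with he
  refine Matrix.PosDef.of_dotProduct_mulVec_pos ?_ fun c hc => ?_
  · ext i j
    simp only [Matrix.conjTranspose_apply, Matrix.of_apply, star_trivial]
    rw [← fderiv_fderiv_homExt_tangent hf, ← fderiv_fderiv_homExt_tangent hf,
      fderiv_fderiv_homExt_symm hf (sph_ne_zero x)]
  · set v : Tangent x := ∑ i, c i • e i with hv
    have hv0 : v ≠ 0 := by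
      intro h
      apply hc
      funext i
      exact Fintype.linearIndependent_iff.mp e.orthonormal.linearIndependent c h i
    have hval : (v : Eucl n) = ∑ i, c i • (e i : Eucl n) := by simp [hv]
    have := hA x v hv0
    rw [← fderiv_fderiv_homExt_tangent hf, hval] at this
    refine this.trans_eq ?_
    simp only [map_sum, map_smul, sum_apply, smul_apply, smul_eq_mul,
      dotProduct, Matrix.mulVec, Matrix.of_apply, star_trivial, Pi.star_apply,
      ← fderiv_fderiv_homExt_tangent hf, Finset.mul_sum]
    rw [Finset.sum_comm]
    refine Finset.sum_congr rfl fun i _ => Finset.sum_congr rfl fun j _ => ?_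
    ring

theorem isC2_one : IsC2 (fun _ : Sph n => (1 : ℝ)) := by
  intro y hy
  refine contDiffAt_const (c := (1 : ℝ)) |>.congr_of_eventuallyEq ?_
  filter_upwards [isOpen_compl_singleton.mem_nhds hy] with z hz
  exact radialExt_eq _ hz

/-- The bases in `detA` are chosen point by point, without continuity; the Jacobian of a `C¹` map of
the ambient space avoids them. -/
theorem continuous_mul_detA (hf : IsC2 f) (hfpos : ∀ x, 0 < f x) :
    Continuous fun x => f x * detA f x := by
  have h1 : (fun x => f x * detA f x) = fun x : Sph n =>
      (fderiv ℝ (polarMap f fun _ => 1) (x : Eucl n)).det := by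
    funext x
    rw [det_polarMap hf isC2_one hfpos (fun _ => one_pos) (sph_ne_zero x), toSph_coe]
    simp
  rw [h1]
  have h2 : ContinuousOn (fderiv ℝ (polarMap f fun _ : Sph n => 1)) {0}ᶜ := fun y hy =>
    (((hf.polarMap isC2_one hy).fderiv_right (m := 0) (by norm_num)).continuousAt).continuousWithinAt
  exact ContinuousLinearMap.continuous_det.comp
    (h2.comp_continuous continuous_subtype_val fun x => sph_ne_zero x)

/-- The convex set cut out by the half-spaces `⟨x, z⟩ ≤ f x`. -/
def wulff (f : Sph n → ℝ) : Set (Eucl n) := {z | ∀ x : Sph n, inner ℝ (x : Eucl n) z ≤ f x}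

/-- Every direction is, up to a factor, a boundary point given by the gradient. -/
theorem exists_smul_gradExt (hf : IsC2 f) (hfpos : ∀ x, 0 < f x) {z : Eucl n} (hz : z ≠ 0) :
    ∃ (x : Sph n) (r : ℝ), 0 < r ∧ z = r • gradExt f x := by
  have hcont : Continuous fun x : Sph n => inner ℝ (x : Eucl n) z / f x :=
    Continuous.div (by fun_prop) hf.continuous fun x => (hfpos x).ne'
  obtain ⟨x, -, hmax⟩ := isCompact_univ.exists_isMaxOn univ_nonempty hcont.continuousOn
  set r := inner ℝ (x : Eucl n) z / f x with hr
  have hle : ∀ x' : Sph n, inner ℝ (x' : Eucl n) z ≤ r * f x' := fun x' => by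
    have : inner ℝ (x' : Eucl n) z / f x' ≤ r := hmax (mem_univ x')
    rwa [div_le_iff₀ (hfpos x')] at this
  have hr0 : 0 < r := by
    have h1 := hle (toSph z)
    rw [coe_toSph hz, real_inner_smul_left, real_inner_self_eq_norm_sq] at h1
    have h2 : 0 < ‖z‖ := norm_pos_iff.mpr hz
    have h3 : 0 < ‖z‖⁻¹ * ‖z‖ ^ 2 := by positivity
    exact pos_of_mul_pos_left (h3.trans_le h1) (hfpos _).le
  refine ⟨x, r, hr0, ?_⟩
  have hx := sph_ne_zero x
  have hd : HasFDerivAt (fun y : Eucl n => inner ℝ z y - r * homExt f y)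
      (innerSL ℝ z - r • fderiv ℝ (homExt f) x) (x : Eucl n) :=
    (innerSL ℝ z).hasFDerivAt.sub ((hf.differentiableAt_homExt hx).hasFDerivAt.const_mul r)
  -- As `x` maximizes `⟨x, z⟩ / f x`, the difference is nonpositive everywhere and zero at `x`; the
  -- first-order condition says that `z` is `r` times the gradient.
  have hloc : IsLocalMax (fun y : Eucl n => inner ℝ z y - r * homExt f y) (x : Eucl n) := by
    have h0 : inner ℝ z (x : Eucl n) - r * homExt f x = 0 := by
      rw [homExt_coe, real_inner_comm, hr, div_mul_cancel₀ _ (hfpos x).ne', sub_self]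
    filter_upwards [isOpen_compl_singleton.mem_nhds hx] with y hy
    rw [h0, sub_nonpos, homExt_eq]
    have h1 := mul_le_mul_of_nonneg_left (hle (toSph y)) (norm_nonneg y)
    rw [← real_inner_smul_left, norm_smul_toSph hy] at h1
    rw [real_inner_comm]
    linarith
  have h0 := hloc.hasFDerivAt_eq_zero hd
  apply ext_inner_left ℝ
  intro v
  have h1 := congrArg (fun T : Eucl n →L[ℝ] ℝ => T v) h0
  simp only [sub_apply, smul_apply, innerSL_apply_apply, smul_eq_mul,
    zero_apply] at h1
  rw [inner_smul_right, inner_gradExt, real_inner_comm]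
  linarith

theorem inner_gradExt_self (hf : IsC2 f) (x : Sph n) :
    inner ℝ (x : Eucl n) (gradExt f x) = f x := by
  rw [inner_gradExt, fderiv_homExt_self hf (sph_ne_zero x), homExt_coe]

theorem gradExt_mem_wulff (hf : IsC2 f) (hA : APos f) (hfpos : ∀ x, 0 < f x) (x : Sph n) :
    gradExt f x ∈ wulff f := fun x' => by
  rw [inner_gradExt]
  exact fderiv_homExt_le hf hA hfpos x x'

/-- Only covering is claimed, for arbitrary positive `g`; this is why the volume comparison below is
an inequality. -/
theorem wulff_subset_image (hf : IsC2 f) (hfpos : ∀ x, 0 < f x) (hgpos : ∀ x, 0 < g x) :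
    wulff (fun x => g x * f x) \ {0} ⊆ polarMap f g '' (closedBall 0 1 \ {0}) := by
  rintro z ⟨hz, hz0⟩
  obtain ⟨x, r, hr, e⟩ := exists_smul_gradExt hf hfpos hz0
  have h1 := hz x
  rw [e, inner_smul_right, inner_gradExt_self hf] at h1
  have h2 : r ≤ g x := le_of_mul_le_mul_right h1 (hfpos x)
  have hρ : 0 < r / g x := div_pos hr (hgpos x)
  refine ⟨(r / g x) • (x : Eucl n), ⟨?_, smul_ne_zero hρ.ne' (sph_ne_zero x)⟩, ?_⟩
  · rw [mem_closedBall_zero_iff, norm_smul, sph_norm, mul_one, Real.norm_of_nonneg hρ.le]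
    exact (div_le_one (hgpos x)).mpr h2
  · rw [polarMap, homExt_smul g hρ, gradExt_smul f hρ, homExt_coe, div_mul_cancel₀ _ (hgpos x).ne',
      e]

theorem image_polarMap_one (hf : IsC2 f) (hA : APos f) (hfpos : ∀ x, 0 < f x) :
    polarMap f (fun _ => 1) '' (closedBall 0 1 \ {0}) = wulff f \ {0} := by
  apply Subset.antisymm
  · rintro _ ⟨y, ⟨hy, hy0⟩, rfl⟩
    have hy0' : y ≠ 0 := hy0
    have hn : 0 < ‖y‖ := norm_pos_iff.mpr hy0'
    rw [mem_closedBall_zero_iff] at hy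
    rw [polarMap, homExt_eq, mul_one, gradExt_toSph f hy0']
    refine ⟨fun x' => ?_, ?_⟩
    · rw [inner_smul_right]
      have h1 := gradExt_mem_wulff hf hA hfpos (toSph y) x'
      have h2 := mul_le_mul_of_nonneg_left h1 hn.le
      have h3 := mul_le_mul_of_nonneg_right hy (hfpos x').le
      linarith
    · intro h
      have h0 : ‖y‖ • gradExt f (toSph y) = 0 := h
      have h1 := inner_gradExt_self hf (toSph y)
      rw [(smul_eq_zero.mp h0).resolve_left hn.ne', inner_zero_right] at h1
      exact (hfpos _).ne h1
  · have := wulff_subset_image (g := fun _ => 1) hf hfpos fun _ => one_pos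
    simpa using this

/-- Pair equal images with the normal of the longer preimage: unless the normals agree, the strict
support inequality makes the other side smaller. -/
theorem injOn_polarMap_one (hf : IsC2 f) (hA : APos f) (hfpos : ∀ x, 0 < f x) :
    InjOn (polarMap f fun _ => 1) (closedBall 0 1 \ {0}) := by
  have key : ∀ y y' : Eucl n, y ≠ 0 → y' ≠ 0 → ‖y‖ ≤ ‖y'‖ →
      polarMap f (fun _ => 1) y = polarMap f (fun _ => 1) y' → y = y' := by
    intro y y' hy hy' hle h
    rw [polarMap, polarMap, homExt_eq, homExt_eq, mul_one, mul_one, gradExt_toSph f hy,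
      gradExt_toSph f hy'] at h
    have hn : 0 < ‖y‖ := norm_pos_iff.mpr hy
    have h1 := congrArg (fun z => inner ℝ (toSph y' : Eucl n) z) h
    simp only [inner_smul_right] at h1
    rw [inner_gradExt_self hf, inner_gradExt] at h1
    have hsph : toSph y' = toSph y := by
      by_contra hne
      have h2 := fderiv_homExt_lt hf hA hfpos hne
      have h3 := mul_lt_mul_of_pos_left h2 hn
      have h4 := mul_le_mul_of_nonneg_right hle (hfpos (toSph y')).le
      linarith
    rw [hsph, fderiv_homExt_self hf (sph_ne_zero _), homExt_coe] at h1
    have h5 : ‖y‖ = ‖y'‖ := mul_right_cancel₀ (hfpos _).ne' h1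
    rw [← norm_smul_toSph hy, ← norm_smul_toSph hy', hsph, h5]
  intro y hy y' hy' h
  rcases le_total ‖y‖ ‖y'‖ with hle | hle
  · exact key y y' hy.2 hy'.2 hle h
  · exact (key y' y hy'.2 hy.2 hle h.symm).symm

theorem measure_diff_zero (s : Set (Eucl n)) : volume (s \ {0}) = volume s :=
  measure_sdiff_null (measure_singleton _)

theorem setLIntegral_det_polarMap (hf : IsC2 f) (hg : IsC2 g) (hA : APos f) (hfpos : ∀ x, 0 < f x)
    (hgpos : ∀ x, 0 < g x) :
    ((n + 1 : ℕ) : ENNReal) * ∫⁻ y in closedBall (0 : Eucl n) 1 \ {0},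
      ENNReal.ofReal |(fderiv ℝ (polarMap f g) y).det| =
    ENNReal.ofReal (∫ x, g x ^ (n + 1) * (f x * detA f x) ∂(sphereMeasure n)) := by
  have hc : Continuous fun x => g x ^ (n + 1) * (f x * detA f x) :=
    (hg.continuous.pow _).mul (continuous_mul_detA hf hfpos)
  have hnn : ∀ x, 0 ≤ g x ^ (n + 1) * (f x * detA f x) := fun x =>
    mul_nonneg (pow_nonneg (hgpos x).le _) (mul_nonneg (hfpos x).le (detA_pos hf hA x).le)
  rw [ofReal_integral_eq_lintegral_ofReal (integrable_of_continuous hc) (ae_of_all _ hnn),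
    lintegral_sphere (h := fun x => ENNReal.ofReal (g x ^ (n + 1) * (f x * detA f x)))
      (ENNReal.measurable_ofReal.comp hc.measurable)]
  congr 1
  have hae : (closedBall (0 : Eucl n) 1 \ {0} : Set (Eucl n)) =ᵐ[volume] ball (0 : Eucl n) 1 := by
    refine Filter.EventuallyEq.trans (sdiff_null_ae_eq_self (measure_singleton _)) ?_
    refine (ae_eq_of_subset_of_measure_ge ball_subset_closedBall ?_
      measurableSet_ball.nullMeasurableSet measure_closedBall_lt_top.ne).symm
    exact (Measure.addHaar_closedBall_eq_addHaar_ball _ _ _).le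
  rw [setLIntegral_congr_fun (g := fun y : Eucl n => ENNReal.ofReal (g (toSph y) ^ (n + 1) *
    (f (toSph y) * detA f (toSph y)))) (measurableSet_closedBall.diff (measurableSet_singleton 0)),
    Measure.restrict_congr_set hae]
  intro y hy
  simp only
  rw [det_polarMap hf hg hfpos hgpos hy.2, abs_of_nonneg (hnn _)]

/-- The volume formula in terms of the support function. -/
theorem volume_wulff (hf : IsC2 f) (hA : APos f) (hfpos : ∀ x, 0 < f x) :
    ((n + 1 : ℕ) : ENNReal) * volume (wulff f) =
      ENNReal.ofReal (∫ x, f x * detA f x ∂(sphereMeasure n)) := by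
  have h := setLIntegral_det_polarMap hf isC2_one hA hfpos (fun _ => one_pos)
  simp only [one_pow, one_mul] at h
  rw [← h, ← measure_diff_zero, ← image_polarMap_one hf hA hfpos,
    ← lintegral_abs_det_fderiv_eq_addHaar_image volume
      (measurableSet_closedBall.diff (measurableSet_singleton 0))
      (fun y hy => (((hf.polarMap isC2_one hy.2).differentiableAt
        (by norm_num)).hasFDerivAt).hasFDerivWithinAt)
      (injOn_polarMap_one hf hA hfpos)]

/-- Comparison of volumes by scaling the boundary points along the rays. -/
theorem volume_wulff_mul_le (hf : IsC2 f) (hg : IsC2 g) (hA : APos f) (hfpos : ∀ x, 0 < f x)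
    (hgpos : ∀ x, 0 < g x) :
    ((n + 1 : ℕ) : ENNReal) * volume (wulff fun x => g x * f x) ≤
      ENNReal.ofReal (∫ x, g x ^ (n + 1) * (f x * detA f x) ∂(sphereMeasure n)) := by
  rw [← setLIntegral_det_polarMap hf hg hA hfpos hgpos, ← measure_diff_zero]
  gcongr
  exact (measure_mono (wulff_subset_image hf hfpos hgpos)).trans
    (addHaar_image_le_lintegral_abs_det_fderiv volume
      (measurableSet_closedBall.diff (measurableSet_singleton 0))
      fun y hy => (((hf.polarMap hg hy.2).differentiableAt
        (by norm_num)).hasFDerivAt).hasFDerivWithinAt)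

end volume

end WulffVolume

/-! ### Translations, the bodies themselves, and differentiation in time. -/

section TimeDependence

section body

variable {f : Sph n → ℝ}

theorem homExt_sub_inner (f : Sph n → ℝ) (z y : Eucl n) :
    homExt (fun x => f x - inner ℝ (x : Eucl n) z) y = homExt f y - innerSL ℝ z y := by
  rw [homExt_eq, homExt_eq, mul_sub, innerSL_apply_apply, real_inner_comm y z]
  by_cases hy : y = 0
  · simp [hy]
  · rw [← real_inner_smul_left, norm_smul_toSph hy]

theorem radialExt_inner (z : Eucl n) {y : Eucl n} (hy : y ≠ 0) :
    radialExt (fun x : Sph n => inner ℝ (x : Eucl n) z) y = ‖y‖⁻¹ * inner ℝ y z := by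
  rw [radialExt_eq _ hy, coe_toSph hy, real_inner_smul_left]

theorem isC2_inner (z : Eucl n) : IsC2 fun x : Sph n => inner ℝ (x : Eucl n) z := by
  intro y hy
  have h : ContDiffAt ℝ 2 (fun y : Eucl n => ‖y‖⁻¹ * inner ℝ y z) y :=
    ((contDiffAt_norm ℝ hy).inv (norm_ne_zero_iff.mpr hy)).mul
      (contDiffAt_id.inner ℝ contDiffAt_const)
  refine h.congr_of_eventuallyEq ?_
  filter_upwards [isOpen_compl_singleton.mem_nhds hy] with y' hy'
  exact radialExt_inner z hy'

theorem IsC2.sub {g : Sph n → ℝ} (hf : IsC2 f) (hg : IsC2 g) : IsC2 fun x => f x - g x := by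
  intro y hy
  refine ((hf y hy).sub (hg y hy)).congr_of_eventuallyEq ?_
  filter_upwards [isOpen_compl_singleton.mem_nhds hy] with y' hy'
  rw [radialExt_eq _ hy', radialExt_eq _ hy', radialExt_eq _ hy']

theorem IsC2.div {g : Sph n → ℝ} (hf : IsC2 f) (hg : IsC2 g) (h0 : ∀ x, g x ≠ 0) :
    IsC2 fun x => f x / g x := by
  intro y hy
  refine ((hf y hy).div (hg y hy) (by rw [radialExt_eq _ hy]; exact h0 _)).congr_of_eventuallyEq ?_
  filter_upwards [isOpen_compl_singleton.mem_nhds hy] with y' hy'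
  rw [Pi.div_apply, radialExt_eq _ hy', radialExt_eq _ hy', radialExt_eq _ hy']

theorem formA_sub_inner (hf : IsC2 f) (z : Eucl n) :
    formA (fun x => f x - inner ℝ (x : Eucl n) z) = formA f := by
  funext x v w
  rw [← fderiv_fderiv_homExt_tangent (hf.sub (isC2_inner z)), ← fderiv_fderiv_homExt_tangent hf]
  have hev : fderiv ℝ (homExt fun x => f x - inner ℝ (x : Eucl n) z) =ᶠ[nhds (x : Eucl n)]
      fun y => fderiv ℝ (homExt f) y - innerSL ℝ z := by
    filter_upwards [isOpen_compl_singleton.mem_nhds (sph_ne_zero x)] with y hy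
    rw [funext (homExt_sub_inner f z)]
    exact ((hf.differentiableAt_homExt hy).hasFDerivAt.sub (innerSL ℝ z).hasFDerivAt).fderiv
  rw [hev.fderiv_eq, fderiv_sub_const]

theorem detA_sub_inner (hf : IsC2 f) (z : Eucl n) :
    detA (fun x => f x - inner ℝ (x : Eucl n) z) = detA f := by
  funext x
  rw [detA, detA, formA_sub_inner hf]

theorem APos.sub_inner (hA : APos f) (hf : IsC2 f) (z : Eucl n) :
    APos fun x => f x - inner ℝ (x : Eucl n) z := by
  intro x v hv
  rw [formA_sub_inner hf]
  exact hA x v hv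

theorem volume_wulff_sub_inner (f : Sph n → ℝ) (z : Eucl n) :
    volume (wulff fun x => f x - inner ℝ (x : Eucl n) z) = volume (wulff f) := by
  have : (wulff fun x => f x - inner ℝ (x : Eucl n) z) = (fun y => y + z) ⁻¹' wulff f := by
    ext y
    simp only [wulff, mem_ofPred_eq, mem_preimage, inner_add_right, le_sub_iff_add_le]
  rw [this, measure_preimage_add_right]

/-- Both sides are `n + 1` times the volume of a body, and the two bodies are translates with the
same `detA`. -/
theorem integral_sub_inner_mul_detA (hf : IsC2 f) (hA : APos f) (hpos : ∀ x, 0 < f x) {z : Eucl n}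
    (hz : ∀ x : Sph n, 0 < f x - inner ℝ (x : Eucl n) z) :
    ∫ x : Sph n, (f x - inner ℝ (x : Eucl n) z) * detA f x ∂(sphereMeasure n) =
      ∫ x, f x * detA f x ∂(sphereMeasure n) := by
  have h1 := volume_wulff (hf.sub (isC2_inner z)) (hA.sub_inner hf z) hz
  rw [volume_wulff_sub_inner, volume_wulff hf hA hpos, detA_sub_inner hf] at h1
  refine ((ENNReal.ofReal_eq_ofReal_iff ?_ ?_).mp h1).symm
  · exact integral_nonneg fun x => mul_nonneg (hpos x).le (detA_pos hf hA x).le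
  · exact integral_nonneg fun x => mul_nonneg (hz x).le (detA_pos hf hA x).le

/-- The convex body with smooth support function `f`. -/
def wulffBody (f : Sph n → ℝ) (hf : IsC2 f) (hpos : ∀ x, 0 < f x) : ConvexBody (Eucl n) where
  carrier := wulff f
  convex' := by
    have : wulff f = ⋂ x : Sph n, {z : Eucl n | inner ℝ (x : Eucl n) z ≤ f x} := by
      ext z; simp [wulff]
    rw [this]
    exact convex_iInter fun x => convex_halfSpace_le (innerₛₗ ℝ (x : Eucl n)).isLinear _
  isCompact' := by
    obtain ⟨x₀, -, hmax⟩ := isCompact_univ.exists_isMaxOn univ_nonempty hf.continuous.continuousOn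
    have hcl : IsClosed (wulff f) := by
      have : wulff f = ⋂ x : Sph n, {z : Eucl n | inner ℝ (x : Eucl n) z ≤ f x} := by
        ext z; simp [wulff]
      rw [this]
      exact isClosed_iInter fun x => isClosed_le (by fun_prop) continuous_const
    refine (isCompact_closedBall (0 : Eucl n) (f x₀)).of_isClosed_subset hcl fun z hz => ?_
    rw [mem_closedBall_zero_iff]
    by_cases h0 : z = 0
    · rw [h0, norm_zero]; exact (hpos _).le
    have h1 := hz (toSph z)
    rw [coe_toSph h0, real_inner_smul_left, real_inner_self_eq_norm_sq] at h1
    have h2 : ‖z‖ ≠ 0 := norm_ne_zero_iff.mpr h0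
    have h3 : ‖z‖⁻¹ * ‖z‖ ^ 2 = ‖z‖ := by field_simp
    rw [h3] at h1
    exact h1.trans (hmax (mem_univ _))
  nonempty' := ⟨0, fun x => by rw [inner_zero_right]; exact (hpos x).le⟩

theorem supportFn_wulffBody (hf : IsC2 f) (hA : APos f) (hpos : ∀ x, 0 < f x) (x : Sph n) :
    supportFn (wulffBody f hf hpos) 0 x = f x := by
  rw [supportFn_zero]
  apply le_antisymm
  · exact supp_le (wulffBody f hf hpos).isCompact (wulffBody f hf hpos).nonempty fun y hy => hy x
  · have := inner_le_supp (wulffBody f hf hpos).isCompact (x : Eucl n)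
      (gradExt_mem_wulff hf hA hpos x)
    rwa [inner_gradExt_self hf] at this

theorem coe_eq_wulff {Ω : ConvexBody (Eucl n)} (h : ∀ x, f x = supportFn Ω 0 x) :
    (Ω : Set (Eucl n)) = wulff f := by
  ext z
  rw [SetLike.mem_coe, mem_iff_inner_le]
  simp only [wulff, mem_ofPred_eq, h]

end body

section parametric

theorem exists_bound_of_continuousOn_strip {a b : ℝ} {φ : ℝ → Sph n → ℝ}
    (hc : ContinuousOn (fun p : ℝ × Sph n => φ p.1 p.2) (Icc a b ×ˢ univ)) :
    ∃ M, ∀ t ∈ Icc a b, ∀ x, ‖φ t x‖ ≤ M := by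
  obtain ⟨M, hM⟩ := (isCompact_Icc.prod isCompact_univ).exists_bound_of_continuousOn hc
  exact ⟨M, fun t ht x => hM (t, x) ⟨ht, mem_univ x⟩⟩

theorem continuous_slice {T : Set ℝ} {φ : ℝ → Sph n → ℝ}
    (hc : ContinuousOn (fun p : ℝ × Sph n => φ p.1 p.2) (T ×ˢ univ)) {t : ℝ} (ht : t ∈ T) :
    Continuous (φ t) :=
  hc.comp_continuous (f := fun x => (t, x)) (by fun_prop) fun x => ⟨ht, mem_univ x⟩

theorem continuousOn_integral_strip {a b : ℝ} {φ : ℝ → Sph n → ℝ}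
    (hc : ContinuousOn (fun p : ℝ × Sph n => φ p.1 p.2) (Icc a b ×ˢ univ)) :
    ContinuousOn (fun t => ∫ x, φ t x ∂(sphereMeasure n)) (Icc a b) := by
  obtain ⟨M, hM⟩ := exists_bound_of_continuousOn_strip hc
  refine continuousOn_of_dominated (bound := fun _ => M) ?_ ?_ (integrable_const _) ?_
  · exact fun t ht => (continuous_slice hc ht).aestronglyMeasurable
  · exact fun t ht => ae_of_all _ (hM t ht)
  · exact ae_of_all _ fun x => hc.comp (f := fun t => (t, x)) (by fun_prop)
      fun t ht => ⟨ht, mem_univ x⟩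

theorem hasDerivAt_integral_strip {a b : ℝ} {φ φ' : ℝ → Sph n → ℝ}
    (hc : ContinuousOn (fun p : ℝ × Sph n => φ p.1 p.2) (Icc a b ×ˢ univ))
    (hc' : ContinuousOn (fun p : ℝ × Sph n => φ' p.1 p.2) (Icc a b ×ˢ univ))
    (hd : ∀ t ∈ Ioo a b, ∀ x, HasDerivAt (fun s => φ s x) (φ' t x) t) {t : ℝ} (ht : t ∈ Ioo a b) :
    HasDerivAt (fun s => ∫ x, φ s x ∂(sphereMeasure n)) (∫ x, φ' t x ∂(sphereMeasure n)) t := by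
  obtain ⟨M, hM⟩ := exists_bound_of_continuousOn_strip hc'
  have hsub := Ioo_subset_Icc_self (a := a) (b := b)
  refine (hasDerivAt_integral_of_dominated_loc_of_deriv_le (bound := fun _ => M)
    (isOpen_Ioo.mem_nhds ht) ?_ ?_ ?_ ?_ (integrable_const _) ?_).2
  · filter_upwards [isOpen_Ioo.mem_nhds ht] with s hs
    exact (continuous_slice hc (hsub hs)).aestronglyMeasurable
  · exact integrable_of_continuous (continuous_slice hc (hsub ht))
  · exact (continuous_slice hc' (hsub ht)).aestronglyMeasurable
  · exact ae_of_all _ fun x s hs => hM s (hsub hs) x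
  · exact ae_of_all _ fun x s hs => hd s hs x

end parametric

section smoothness

/-- The space-time domain of the flow. -/
abbrev flowDomain (n : ℕ) : Set (ℝ × Eucl n) := Ici (0 : ℝ) ×ˢ {(0 : Eucl n)}ᶜ

theorem uniqueDiffOn_flowDomain (n : ℕ) : UniqueDiffOn ℝ (flowDomain n) :=
  (uniqueDiffOn_Ici 0).prod isOpen_compl_singleton.uniqueDiffOn

/-- The time derivative of a function on the space-time domain. -/
def timeDeriv (H : ℝ × Eucl n → ℝ) (p : ℝ × Eucl n) : ℝ :=
  fderivWithin ℝ H (flowDomain n) p (1, 0)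

theorem contDiffOn_timeDeriv {H : ℝ × Eucl n → ℝ} (hH : ContDiffOn ℝ ∞ H (flowDomain n)) :
    ContDiffOn ℝ ∞ (timeDeriv H) (flowDomain n) :=
  (hH.fderivWithin (uniqueDiffOn_flowDomain n) (by simp)).clm_apply contDiffOn_const

theorem hasDerivWithinAt_timeDeriv {H : ℝ × Eucl n → ℝ} (hH : ContDiffOn ℝ ∞ H (flowDomain n))
    {t : ℝ} (ht : 0 ≤ t) {z : Eucl n} (hz : z ≠ 0) :
    HasDerivWithinAt (fun s => H (s, z)) (timeDeriv H (t, z)) (Ici 0) t := by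
  have h1 : HasFDerivWithinAt H (fderivWithin ℝ H (flowDomain n) (t, z)) (flowDomain n) (t, z) :=
    ((hH.differentiableOn (by simp)) (t, z) ⟨ht, hz⟩).hasFDerivWithinAt
  have h2 : HasDerivWithinAt (fun s : ℝ => (s, z)) ((1 : ℝ), (0 : Eucl n)) (Ici 0) t :=
    (hasDerivWithinAt_id t _).prodMk (hasDerivWithinAt_const t _ z)
  exact h1.comp_hasDerivWithinAt (f := fun s : ℝ => (s, z)) t h2 fun s hs => ⟨hs, hz⟩

theorem continuousOn_sphere {H : ℝ × Eucl n → ℝ} (hH : ContDiffOn ℝ ∞ H (flowDomain n)) :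
    ContinuousOn (fun p : ℝ × Sph n => H (p.1, p.2)) (Ici 0 ×ˢ univ) :=
  hH.continuousOn.comp (f := fun p : ℝ × Sph n => (p.1, (p.2 : Eucl n))) (by fun_prop)
    fun p hp => ⟨hp.1, sph_ne_zero p.2⟩

end smoothness

end TimeDependence

/-! ### Volume preservation and entropy monotonicity along the flow. -/

section Flow

section flow

variable {u : ℝ → Sph n → ℝ}

/-- The flow as a function on the space-time domain. -/
def flowExt (u : ℝ → Sph n → ℝ) (p : ℝ × Eucl n) : ℝ := radialExt (u p.1) p.2

theorem IsPositiveSolution.isC2 (hu : IsPositiveSolution u) {t : ℝ} (ht : 0 ≤ t) :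
    IsC2 (u t) := by
  intro y hy
  have h : ContDiffOn ℝ ∞ (fun z : Eucl n => flowExt u (t, z)) {0}ᶜ :=
    hu.smooth.comp (f := fun z : Eucl n => (t, z)) (by fun_prop) fun z hz => ⟨ht, hz⟩
  exact (h.contDiffAt (isOpen_compl_singleton.mem_nhds hy)).of_le ENat.LEInfty.out

theorem IsPositiveSolution.contDiffOn_flowExt (hu : IsPositiveSolution u) :
    ContDiffOn ℝ ∞ (flowExt u) (flowDomain n) := hu.smooth

/-- The speed of the support function. -/
def speed (u : ℝ → Sph n → ℝ) (t : ℝ) (x : Sph n) : ℝ := timeDeriv (flowExt u) (t, x)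

/-- The acceleration of the support function. -/
def accel (u : ℝ → Sph n → ℝ) (t : ℝ) (x : Sph n) : ℝ := timeDeriv (timeDeriv (flowExt u)) (t, x)

theorem IsPositiveSolution.continuousOn (hu : IsPositiveSolution u) :
    ContinuousOn (fun p : ℝ × Sph n => u p.1 p.2) (Ici 0 ×ˢ univ) := by
  have h := continuousOn_sphere hu.contDiffOn_flowExt
  simp only [flowExt, radialExt_coe] at h
  exact h

theorem IsPositiveSolution.continuousOn_speed (hu : IsPositiveSolution u) :
    ContinuousOn (fun p : ℝ × Sph n => speed u p.1 p.2) (Ici 0 ×ˢ univ) :=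
  continuousOn_sphere (contDiffOn_timeDeriv hu.contDiffOn_flowExt)

theorem IsPositiveSolution.continuousOn_accel (hu : IsPositiveSolution u) :
    ContinuousOn (fun p : ℝ × Sph n => accel u p.1 p.2) (Ici 0 ×ˢ univ) :=
  continuousOn_sphere (contDiffOn_timeDeriv (contDiffOn_timeDeriv hu.contDiffOn_flowExt))

theorem IsPositiveSolution.hasDerivWithinAt_speed (hu : IsPositiveSolution u) {t : ℝ} (ht : 0 ≤ t)
    (x : Sph n) : HasDerivWithinAt (fun s => u s x) (speed u t x) (Ici 0) t := by
  have h := hasDerivWithinAt_timeDeriv hu.contDiffOn_flowExt ht (sph_ne_zero x)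
  simp only [flowExt, radialExt_coe] at h
  exact h

theorem IsPositiveSolution.hasDerivWithinAt_accel (hu : IsPositiveSolution u) {t : ℝ} (ht : 0 ≤ t)
    (x : Sph n) : HasDerivWithinAt (fun s => speed u s x) (accel u t x) (Ici 0) t :=
  hasDerivWithinAt_timeDeriv (contDiffOn_timeDeriv hu.contDiffOn_flowExt) ht (sph_ne_zero x)

theorem IsPositiveSolution.hasDerivAt_speed (hu : IsPositiveSolution u) {t : ℝ} (ht : 0 < t)
    (x : Sph n) : HasDerivAt (fun s => u s x) (speed u t x) t :=
  (hu.hasDerivWithinAt_speed ht.le x).hasDerivAt (Ici_mem_nhds ht)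

theorem IsPositiveSolution.hasDerivAt_accel (hu : IsPositiveSolution u) {t : ℝ} (ht : 0 < t)
    (x : Sph n) : HasDerivAt (fun s => speed u s x) (accel u t x) t :=
  (hu.hasDerivWithinAt_accel ht.le x).hasDerivAt (Ici_mem_nhds ht)

theorem IsPositiveSolution.speed_eq (hu : IsPositiveSolution u) {t : ℝ} (ht : 0 ≤ t)
    (x : Sph n) : speed u t x = u t x - gaussCurv (u t) x :=
  (uniqueDiffOn_Ici (0 : ℝ) t ht).eq_deriv _ (hu.hasDerivWithinAt_speed ht x) (hu.flow t ht x)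

theorem IsPositiveSolution.detA_pos (hu : IsPositiveSolution u) {t : ℝ} (ht : 0 ≤ t)
    (x : Sph n) : 0 < detA (u t) x := GaussFlow.detA_pos (hu.isC2 ht) (hu.convex t ht) x

theorem IsPositiveSolution.sub_speed (hu : IsPositiveSolution u) {t : ℝ} (ht : 0 ≤ t)
    (x : Sph n) : u t x - speed u t x = (detA (u t) x)⁻¹ := by
  rw [hu.speed_eq ht, gaussCurv]
  ring

theorem IsPositiveSolution.sub_speed_pos (hu : IsPositiveSolution u) {t : ℝ} (ht : 0 ≤ t)
    (x : Sph n) : 0 < u t x - speed u t x := by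
  rw [hu.sub_speed ht]
  exact inv_pos.mpr (hu.detA_pos ht x)

/-- The density of the cone volume. -/
def coneDensity (u : ℝ → Sph n → ℝ) (t : ℝ) (x : Sph n) : ℝ := u t x / (u t x - speed u t x)

theorem IsPositiveSolution.coneDensity_eq (hu : IsPositiveSolution u) {t : ℝ} (ht : 0 ≤ t)
    (x : Sph n) : coneDensity u t x = u t x * detA (u t) x := by
  rw [coneDensity, hu.sub_speed ht, div_inv_eq_mul]

theorem IsPositiveSolution.continuousOn_coneDensity (hu : IsPositiveSolution u) :
    ContinuousOn (fun p : ℝ × Sph n => coneDensity u p.1 p.2) (Ici 0 ×ˢ univ) :=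
  hu.continuousOn.div (hu.continuousOn.sub hu.continuousOn_speed) fun p hp =>
    (hu.sub_speed_pos hp.1 p.2).ne'

/-- The total cone volume of the flow (up to the dimensional factor). -/
def totalVolume (u : ℝ → Sph n → ℝ) (t : ℝ) : ℝ := ∫ x, coneDensity u t x ∂(sphereMeasure n)

theorem IsPositiveSolution.totalVolume_eq (hu : IsPositiveSolution u) {t : ℝ} (ht : 0 ≤ t) :
    totalVolume u t = ∫ x, u t x * detA (u t) x ∂(sphereMeasure n) := by
  rw [totalVolume]
  simp only [hu.coneDensity_eq ht]

theorem strip_mono {φ : ℝ × Sph n → ℝ} (h : ContinuousOn φ (Ici 0 ×ˢ univ)) {a b : ℝ}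
    (ha : 0 ≤ a) : ContinuousOn φ (Icc a b ×ˢ univ) :=
  h.mono (prod_mono (fun _ ht => ha.trans ht.1) Subset.rfl)

theorem IsPositiveSolution.continuousOn_totalVolume (hu : IsPositiveSolution u) (b : ℝ) :
    ContinuousOn (totalVolume u) (Icc 0 b) :=
  continuousOn_integral_strip (strip_mono hu.continuousOn_coneDensity le_rfl)

/-- By the equation `1/K = 1/(u - ∂u/∂t)`, so only time derivatives of `u` enter. Mere
differentiability suffices, since the value of the derivative is found by comparison. -/
theorem IsPositiveSolution.differentiableAt_totalVolume (hu : IsPositiveSolution u) {t : ℝ}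
    (ht : 0 < t) : DifferentiableAt ℝ (totalVolume u) t := by
  set φ' : ℝ → Sph n → ℝ := fun s x =>
    (speed u s x * (u s x - speed u s x) - u s x * (speed u s x - accel u s x)) /
      (u s x - speed u s x) ^ 2 with hφ'
  have hsub := hu.continuousOn.sub hu.continuousOn_speed
  have hc' : ContinuousOn (fun p : ℝ × Sph n => φ' p.1 p.2) (Ici 0 ×ˢ univ) :=
    ((hu.continuousOn_speed.mul hsub).sub
      (hu.continuousOn.mul (hu.continuousOn_speed.sub hu.continuousOn_accel))).div (hsub.pow 2)
      fun p hp => pow_ne_zero 2 (hu.sub_speed_pos hp.1 p.2).ne'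
  refine (hasDerivAt_integral_strip (a := 0) (b := t + 1) (φ' := φ')
    (strip_mono hu.continuousOn_coneDensity le_rfl) (strip_mono hc' le_rfl) ?_
    ⟨ht, by linarith⟩).differentiableAt
  intro s hs x
  exact (hu.hasDerivAt_speed hs.1 x).div ((hu.hasDerivAt_speed hs.1 x).sub
    (hu.hasDerivAt_accel hs.1 x)) (hu.sub_speed_pos hs.1.le x).ne'

theorem IsPositiveSolution.volume_wulff (hu : IsPositiveSolution u) {t : ℝ} (ht : 0 ≤ t) :
    ((n + 1 : ℕ) : ENNReal) * volume (wulff (u t)) = ENNReal.ofReal (totalVolume u t) := by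
  rw [GaussFlow.volume_wulff (hu.isC2 ht) (hu.convex t ht) (hu.pos t ht), hu.totalVolume_eq ht]

theorem IsPositiveSolution.coneDensity_pos (hu : IsPositiveSolution u) {t : ℝ} (ht : 0 ≤ t)
    (x : Sph n) : 0 < coneDensity u t x :=
  div_pos (hu.pos t ht x) (hu.sub_speed_pos ht x)

theorem IsPositiveSolution.totalVolume_le (hu : IsPositiveSolution u) {s t : ℝ} (hs : 0 ≤ s)
    (ht : 0 ≤ t) : totalVolume u s ≤
      ∫ x, (u s x / u t x) ^ (n + 1) * coneDensity u t x ∂(sphereMeasure n) := by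
  have hg : ∀ x, 0 < u s x / u t x := fun x => div_pos (hu.pos s hs x) (hu.pos t ht x)
  have h := volume_wulff_mul_le (hu.isC2 ht)
    ((hu.isC2 hs).div (hu.isC2 ht) fun x => (hu.pos t ht x).ne') (hu.convex t ht) (hu.pos t ht) hg
  have he : (fun x => u s x / u t x * u t x) = u s :=
    funext fun x => div_mul_cancel₀ _ (hu.pos t ht x).ne'
  rw [he, hu.volume_wulff hs] at h
  simp only [← hu.coneDensity_eq ht] at h
  refine (ENNReal.ofReal_le_ofReal_iff ?_).mp h
  exact integral_nonneg fun x => mul_nonneg (pow_nonneg (hg x).le _) (hu.coneDensity_pos ht x).le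

theorem IsPositiveSolution.hasDerivAt_totalVolume (hu : IsPositiveSolution u) {t : ℝ}
    (ht : 0 < t) : HasDerivAt (totalVolume u)
      ((n + 1) * (totalVolume u t - (sphereMeasure n).real univ)) t := by
  set φ : ℝ → Sph n → ℝ := fun s x => (u s x / u t x) ^ (n + 1) * coneDensity u t x with hφ
  set φ' : ℝ → Sph n → ℝ := fun s x =>
    (((n + 1 : ℕ) : ℝ) * (u s x / u t x) ^ n * (speed u s x / u t x)) * coneDensity u t x with hφ'
  have hut : ContinuousOn (fun p : ℝ × Sph n => u t p.2) (Ici 0 ×ˢ univ) :=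
    ((hu.isC2 ht.le).continuous.comp continuous_snd).continuousOn
  have hct : ContinuousOn (fun p : ℝ × Sph n => coneDensity u t p.2) (Ici 0 ×ˢ univ) :=
    ((continuous_slice hu.continuousOn_coneDensity ht.le).comp continuous_snd).continuousOn
  have hne : ∀ p ∈ (Ici (0 : ℝ) ×ˢ univ : Set (ℝ × Sph n)), u t p.2 ≠ 0 := fun p _ =>
    (hu.pos t ht.le p.2).ne'
  have hc : ContinuousOn (fun p : ℝ × Sph n => φ p.1 p.2) (Ici 0 ×ˢ univ) :=
    ((hu.continuousOn.div hut hne).pow _).mul hct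
  have hc' : ContinuousOn (fun p : ℝ × Sph n => φ' p.1 p.2) (Ici 0 ×ˢ univ) :=
    ((continuousOn_const.mul ((hu.continuousOn.div hut hne).pow _)).mul
      (hu.continuousOn_speed.div hut hne)).mul hct
  have hG := hasDerivAt_integral_strip (a := 0) (b := t + 1) (φ := φ) (φ' := φ')
    (strip_mono hc le_rfl) (strip_mono hc' le_rfl) (fun s hs x => by
      have := ((((hu.hasDerivAt_speed hs.1 x).div_const (u t x)).pow (n + 1)).mul_const
        (coneDensity u t x))
      exact this) (t := t) ⟨ht, by linarith⟩
  have hval : ∫ x, φ' t x ∂(sphereMeasure n) =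
      (n + 1) * (totalVolume u t - (sphereMeasure n).real univ) := by
    have h1 : ∀ x, φ' t x = (n + 1) * (coneDensity u t x - 1) := by
      intro x
      have h2 := hu.sub_speed_pos ht.le x
      have h3 := hu.pos t ht.le x
      simp only [hφ', coneDensity]
      rw [div_self h3.ne', one_pow]
      push_cast
      field_simp
      ring
    simp only [h1]
    rw [integral_const_mul, integral_sub
      (integrable_of_continuous (continuous_slice hu.continuousOn_coneDensity ht.le))
      (integrable_const _), integral_const, smul_eq_mul, mul_one, totalVolume]
  rw [hval] at hG
  have hV := (hu.differentiableAt_totalVolume ht).hasDerivAt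
  -- The explicit upper bound for the volume at time `s` touches the volume at `s = t`, so the
  -- difference has a minimum there and the two derivatives coincide.
  have hmin : IsLocalMin (fun s => ∫ x, φ s x ∂(sphereMeasure n) - totalVolume u s) t := by
    have h0 : ∫ x, φ t x ∂(sphereMeasure n) - totalVolume u t = 0 := by
      have : ∀ x, φ t x = coneDensity u t x := fun x => by
        simp only [hφ]
        rw [div_self (hu.pos t ht.le x).ne', one_pow, one_mul]
      simp only [this]
      rw [totalVolume, sub_self]
    filter_upwards [Ici_mem_nhds ht] with s hs
    rw [h0]
    exact sub_nonneg.mpr (hu.totalVolume_le hs ht.le)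
  have h0 := hmin.hasDerivAt_eq_zero (hG.sub hV)
  rw [← sub_eq_zero.mp h0] at hV
  exact hV

/-- The normalized flow preserves the volume. -/
theorem IsPositiveSolution.totalVolume_const (hu : IsPositiveSolution u)
    (h0 : totalVolume u 0 = (sphereMeasure n).real univ) {t : ℝ} (ht : 0 ≤ t) :
    totalVolume u t = (sphereMeasure n).real univ := by
  rcases ht.eq_or_lt with rfl | ht
  · exact h0
  set A := (sphereMeasure n).real univ with hA
  -- The excess of the volume satisfies the linear equation `y' = (n+1) y`; with the integrating
  -- factor it is constant, hence zero.
  set W : ℝ → ℝ := fun s => Real.exp (-((n + 1 : ℝ) * s)) * (totalVolume u s - A) with hW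
  have hWc : ContinuousOn W (Icc 0 t) :=
    ContinuousOn.mul (by fun_prop) ((hu.continuousOn_totalVolume t).sub continuousOn_const)
  have hWd : ∀ s ∈ Ioo 0 t, HasDerivAt W 0 s := by
    intro s hs
    have h1 : HasDerivAt (fun s : ℝ => Real.exp (-((n + 1 : ℝ) * s)))
        (Real.exp (-((n + 1 : ℝ) * s)) * (-((n + 1 : ℝ) * 1))) s :=
      (((hasDerivAt_id s).const_mul (n + 1 : ℝ)).neg).exp
    refine (h1.mul ((hu.hasDerivAt_totalVolume hs.1).sub_const A)).congr_deriv ?_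
    ring
  obtain ⟨c, hc, he⟩ := exists_hasDerivAt_eq_slope W (fun _ => 0) ht hWc hWd
  rw [eq_comm, div_eq_zero_iff] at he
  have h1 : W t - W 0 = 0 := he.resolve_right (by linarith)
  simp only [hW, h0, sub_self, mul_zero, sub_zero] at h1
  have h2 := (mul_eq_zero.mp h1).resolve_left (Real.exp_pos _).ne'
  linarith

/-- The derivative is `-e^{-t} K < 0`. This keeps shifted centres admissible at earlier times and
carries lower bounds on `u` backwards. -/
theorem IsPositiveSolution.exp_mul_antitone (hu : IsPositiveSolution u) (x : Sph n) :
    AntitoneOn (fun t => Real.exp (-t) * u t x) (Ici 0) := by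
  have hd : ∀ t, 0 ≤ t → HasDerivWithinAt (fun t => Real.exp (-t) * u t x)
      (Real.exp (-t) * (-1) * u t x + Real.exp (-t) * speed u t x) (Ici 0) t := fun t ht =>
    (((hasDerivAt_id t).neg).exp.hasDerivWithinAt).mul (hu.hasDerivWithinAt_speed ht x)
  refine antitoneOn_of_deriv_nonpos (convex_Ici 0) (fun t ht => (hd t ht).continuousWithinAt) ?_ ?_
  · intro t ht
    rw [interior_Ici] at ht
    exact ((hd t (le_of_lt ht)).hasDerivAt
      (Ici_mem_nhds ht)).differentiableAt.differentiableWithinAt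
  · intro t ht
    rw [interior_Ici] at ht
    rw [((hd t (le_of_lt ht)).hasDerivAt (Ici_mem_nhds ht)).deriv]
    have h1 := hu.sub_speed_pos (le_of_lt ht) x
    have h2 := mul_pos (Real.exp_pos (-t)) h1
    linarith

theorem IsPositiveSolution.shifted_pos (hu : IsPositiveSolution u) {t t₂ : ℝ} (ht : 0 ≤ t)
    (h : t ≤ t₂) {z : Eucl n} {x : Sph n} (hz : 0 < u t₂ x - inner ℝ (x : Eucl n) z) :
    0 < u t x - Real.exp (t - t₂) * inner ℝ (x : Eucl n) z := by
  have h1 := hu.exp_mul_antitone x ht (ht.trans h) h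
  simp only at h1
  have h2 : Real.exp (t - t₂) = Real.exp t * Real.exp (-t₂) := by
    rw [← Real.exp_add]; ring_nf
  have h3 : Real.exp t * Real.exp (-t) = 1 := by rw [← Real.exp_add]; simp
  have h4 : u t x - Real.exp (t - t₂) * inner ℝ (x : Eucl n) z =
      Real.exp t * (Real.exp (-t) * u t x - Real.exp (-t₂) * inner ℝ (x : Eucl n) z) := by
    rw [h2]
    linear_combination (-(u t x)) * h3
  rw [h4]
  refine mul_pos (Real.exp_pos _) ?_
  have h5 := mul_pos (Real.exp_pos (-t₂)) hz
  linarith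

/-- Monotonicity along the flow of the mean logarithm with respect to a moving point. -/
theorem IsPositiveSolution.integral_log_le (hu : IsPositiveSolution u)
    (h0 : totalVolume u 0 = (sphereMeasure n).real univ) {t₁ t₂ : ℝ} (ht₁ : 0 ≤ t₁) (h12 : t₁ ≤ t₂)
    {z : Eucl n} (hz : ∀ x : Sph n, 0 < u t₂ x - inner ℝ (x : Eucl n) z) :
    ∫ x : Sph n, Real.log (u t₂ x - inner ℝ (x : Eucl n) z) ∂(sphereMeasure n) ≤
      ∫ x : Sph n, Real.log (u t₁ x - Real.exp (t₁ - t₂) * inner ℝ (x : Eucl n) z)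
        ∂(sphereMeasure n) := by
  set w : ℝ → Sph n → ℝ := fun t x => u t x - Real.exp (t - t₂) * inner ℝ (x : Eucl n) z with hw
  set φ : ℝ → Sph n → ℝ := fun t x => Real.log (w t x) with hφ
  set φ' : ℝ → Sph n → ℝ := fun t x =>
    (speed u t x - Real.exp (t - t₂) * inner ℝ (x : Eucl n) z) / w t x with hφ'
  have hwpos : ∀ t ∈ Icc t₁ t₂, ∀ x, 0 < w t x := fun t ht x =>
    hu.shifted_pos (ht₁.trans ht.1) ht.2 (hz x)
  have hec : ContinuousOn (fun p : ℝ × Sph n => Real.exp (p.1 - t₂) * inner ℝ (p.2 : Eucl n) z)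
      (Icc t₁ t₂ ×ˢ univ) := by
    apply Continuous.continuousOn
    fun_prop
  have hwc : ContinuousOn (fun p : ℝ × Sph n => w p.1 p.2) (Icc t₁ t₂ ×ˢ univ) :=
    (strip_mono hu.continuousOn ht₁).sub hec
  have hc : ContinuousOn (fun p : ℝ × Sph n => φ p.1 p.2) (Icc t₁ t₂ ×ˢ univ) :=
    hwc.log fun p hp => (hwpos p.1 hp.1 p.2).ne'
  have hc' : ContinuousOn (fun p : ℝ × Sph n => φ' p.1 p.2) (Icc t₁ t₂ ×ˢ univ) :=
    ((strip_mono hu.continuousOn_speed ht₁).sub hec).div hwc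
      fun p hp => (hwpos p.1 hp.1 p.2).ne'
  have hd : ∀ t ∈ Ioo t₁ t₂, HasDerivAt (fun s => ∫ x, φ s x ∂(sphereMeasure n))
      (∫ x, φ' t x ∂(sphereMeasure n)) t := by
    intro t ht
    refine hasDerivAt_integral_strip hc hc' (fun s hs x => ?_) ht
    have he : HasDerivAt (fun s : ℝ => Real.exp (s - t₂) * inner ℝ (x : Eucl n) z)
        (Real.exp (s - t₂) * 1 * inner ℝ (x : Eucl n) z) s :=
      (((hasDerivAt_id s).sub_const t₂).exp).mul_const _
    rw [mul_one] at he
    exact ((hu.hasDerivAt_speed (ht₁.trans_lt hs.1) x).sub he).log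
      (hwpos s ⟨hs.1.le, hs.2.le⟩ x).ne'
  have hneg : ∀ t ∈ Ioo t₁ t₂, ∫ x, φ' t x ∂(sphereMeasure n) ≤ 0 := by
    intro t ht
    have ht' : t ∈ Icc t₁ t₂ := ⟨ht.1.le, ht.2.le⟩
    have ht0 : 0 ≤ t := ht₁.trans ht.1.le
    have hin : ∀ x : Sph n, w t x = u t x - inner ℝ (x : Eucl n) (Real.exp (t - t₂) • z) :=
      fun x => by simp only [hw, inner_smul_right]
    have hcont : Continuous fun x => w t x * detA (u t) x := by
      have h1 : (fun x => w t x * detA (u t) x) = fun x => w t x / (u t x - speed u t x) := by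
        funext x
        rw [hu.sub_speed ht0, div_inv_eq_mul]
      rw [h1]
      exact (continuous_slice hwc ht').div ((hu.isC2 ht0).continuous.sub
        (continuous_slice hu.continuousOn_speed ht0)) fun x => (hu.sub_speed_pos ht0 x).ne'
    -- Neither the shift of the centre nor the flow changes this integral.
    have hI : ∫ x, w t x * detA (u t) x ∂(sphereMeasure n) = (sphereMeasure n).real univ := by
      simp only [hin]
      rw [integral_sub_inner_mul_detA (hu.isC2 ht0) (hu.convex t ht0) (hu.pos t ht0)
        (fun x => by rw [← hin]; exact hwpos t ht' x), ← hu.totalVolume_eq ht0,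
        hu.totalVolume_const h0 ht0]
    -- With `a = w / K` this is `1 - 1/a ≤ a - 1`, the difference of the two sides being `(a -
    -- 1)²/a`.
    have hle : ∀ x, φ' t x ≤ w t x * detA (u t) x - 1 := by
      intro x
      have hwx := hwpos t ht' x
      have hdx := hu.detA_pos ht0 x
      have hsp : speed u t x - Real.exp (t - t₂) * inner ℝ (x : Eucl n) z =
          w t x - (detA (u t) x)⁻¹ := by
        rw [← hu.sub_speed ht0 x]
        simp only [hw]
        ring
      simp only [hφ']
      rw [hsp, div_le_iff₀ hwx]
      have h2 : (w t x * detA (u t) x - 1) * w t x - (w t x - (detA (u t) x)⁻¹) =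
          (detA (u t) x)⁻¹ * (w t x * detA (u t) x - 1) ^ 2 := by
        field_simp
      have h3 : 0 ≤ (detA (u t) x)⁻¹ * (w t x * detA (u t) x - 1) ^ 2 := by positivity
      linarith
    have hmono := integral_mono (μ := sphereMeasure n)
      (integrable_of_continuous (continuous_slice hc' ht'))
      ((integrable_of_continuous hcont).sub (integrable_const 1)) hle
    have hval : ∫ x, ((fun x => w t x * detA (u t) x) - fun _ : Sph n => (1 : ℝ)) x ∂(sphereMeasure n) =
        0 := by
      simp only [Pi.sub_apply]
      rw [integral_sub (integrable_of_continuous hcont) (integrable_const 1), hI, integral_const,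
        smul_eq_mul, mul_one, sub_self]
    exact hmono.trans hval.le
  have hanti : AntitoneOn (fun s => ∫ x, φ s x ∂(sphereMeasure n)) (Icc t₁ t₂) := by
    refine antitoneOn_of_deriv_nonpos (convex_Icc _ _) (continuousOn_integral_strip hc) ?_ ?_
    · intro t ht
      rw [interior_Icc] at ht
      exact (hd t ht).differentiableAt.differentiableWithinAt
    · intro t ht
      rw [interior_Icc] at ht
      rw [(hd t ht).deriv]
      exact hneg t ht
  have hfin := hanti (left_mem_Icc.mpr h12) (right_mem_Icc.mpr h12) h12
  simp only [hφ, hw, sub_self, Real.exp_zero, one_mul] at hfin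
  exact hfin

end flow

end Flow

/-! ### From the contraction inequality to the behaviour of the entropy points. -/

section Conclusion

section path

open Filter Topology

variable {F : Type*} [NormedAddCommGroup F] [NormedSpace ℝ F]

/-- A bounded path which contracts exponentially up to the decrease of a bounded quantity tends
to zero. -/
theorem tendsto_zero_of_contraction {e : ℝ → F} {E : ℝ → ℝ} {k D m : ℝ} (hk : 0 < k)
    (hD : ∀ t, 0 ≤ t → ‖e t‖ ≤ D) (hm : ∀ t, 0 ≤ t → m ≤ E t)
    (h : ∀ t T, 0 ≤ t → t ≤ T → k * ‖e t - Real.exp (t - T) • e T‖ ^ 2 ≤ E t - E T) :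
    Tendsto e atTop (𝓝 0) := by
  -- Nothing is known at negative times, so `E` is frozen there before taking the limit.
  have hanti : Antitone fun t => E (max t 0) := by
    intro s t hst
    have h1 := h (max s 0) (max t 0) (le_max_right _ _) (max_le_max_right 0 hst)
    have h2 : 0 ≤ k * ‖e (max s 0) - Real.exp (max s 0 - max t 0) • e (max t 0)‖ ^ 2 := by
      positivity
    exact sub_nonneg.mp (h2.trans h1)
  have hlim := tendsto_atTop_ciInf hanti ⟨m, by
    rintro _ ⟨t, rfl⟩
    exact hm _ (le_max_right _ _)⟩
  set l := ⨅ t, E (max t 0)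
  have hlim' : Tendsto E atTop (𝓝 l) := by
    refine hlim.congr' ?_
    filter_upwards [eventually_ge_atTop 0] with t ht
    rw [max_eq_left ht]
  have hle : ∀ t, 0 ≤ t → k * ‖e t‖ ^ 2 ≤ E t - l := by
    intro t ht
    have hz : Tendsto (fun T => Real.exp (t - T) • e T) atTop (𝓝 0) := by
      have h1 : Tendsto (fun T => Real.exp (t - T) * D) atTop (𝓝 0) := by
        have h2 : Tendsto (fun T : ℝ => t - T) atTop atBot :=
          tendsto_atBot_add_const_left _ t tendsto_neg_atTop_atBot
        simpa using (Real.tendsto_exp_atBot.comp h2).mul_const D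
      refine squeeze_zero_norm' ?_ h1
      filter_upwards [eventually_ge_atTop 0] with T hT
      rw [norm_smul, Real.norm_eq_abs, Real.abs_exp]
      exact mul_le_mul_of_nonneg_left (hD T hT) (Real.exp_pos _).le
    have h1 : Tendsto (fun T => k * ‖e t - Real.exp (t - T) • e T‖ ^ 2) atTop
        (𝓝 (k * ‖e t‖ ^ 2)) := by
      simpa using (((hz.const_sub (e t)).norm.pow 2).const_mul k)
    refine le_of_tendsto_of_tendsto h1 (hlim'.const_sub (E t)) ?_
    filter_upwards [eventually_ge_atTop t] with T hT
    exact h t T ht hT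
  have h1 : Tendsto (fun t => Real.sqrt ((E t - l) / k)) atTop (𝓝 0) := by
    have h2 := ((hlim'.sub_const l).div_const k).sqrt
    simpa using h2
  refine squeeze_zero_norm' ?_ h1
  filter_upwards [eventually_ge_atTop 0] with t ht
  refine Real.le_sqrt_of_sq_le ?_
  rw [le_div_iff₀ hk, mul_comm]
  exact hle t ht

/-- Such a path is small at one of boundedly many equidistant times. -/
theorem exists_norm_le_of_contraction {k D m A r : ℝ} (hk : 0 < k) (hr : 0 < r) :
    ∃ (N : ℕ) (L : ℝ), 0 ≤ L ∧ ∀ (e : ℝ → F) (E : ℝ → ℝ), (∀ t, 0 ≤ t → ‖e t‖ ≤ D) →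
      (∀ t, 0 ≤ t → m ≤ E t) → (∀ t, 0 ≤ t → E t ≤ A) →
      (∀ t T, 0 ≤ t → t ≤ T → k * ‖e t - Real.exp (t - T) • e T‖ ^ 2 ≤ E t - E T) →
      ∀ t, 0 ≤ t → ∃ j : ℕ, j ≤ N ∧ ‖e (t + j * L)‖ ≤ 2 * r := by
  obtain ⟨L, hL, hLD⟩ : ∃ L : ℝ, 0 ≤ L ∧ Real.exp (-L) * D ≤ r := by
    have h1 : Tendsto (fun L : ℝ => Real.exp (-L) * D) atTop (𝓝 0) := by
      simpa using Real.tendsto_exp_neg_atTop_nhds_zero.mul_const D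
    obtain ⟨L, h2, h3⟩ := ((eventually_ge_atTop 0).and (h1.eventually (ge_mem_nhds hr))).exists
    exact ⟨L, h2, h3⟩
  have hκ : 0 < k * r ^ 2 := by positivity
  obtain ⟨N, hN⟩ := exists_nat_gt ((A - m) / (k * r ^ 2))
  rw [div_lt_iff₀ hκ] at hN
  refine ⟨N, L, hL, fun e E hD hm hA h t ht => ?_⟩
  by_contra! hcon
  -- After waiting `L` the term `e^{-L} e` has norm at most `r`, so `‖e‖ > 2r` costs at least `k r²`
  -- of `E` per step; `N` such steps exceed the range `A - m`.
  have hstep : ∀ j : ℕ, j ≤ N → E (t + j * L) ≤ E t - j * (k * r ^ 2) := by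
    intro j
    induction j with
    | zero => simp
    | succ j ih =>
      intro hj
      have h0 : 0 ≤ t + j * L := by positivity
      have hle : t + j * L ≤ t + (j + 1 : ℕ) * L := by
        push_cast
        linarith
      have h1 := h _ _ h0 hle
      have hexp : t + j * L - (t + (j + 1 : ℕ) * L) = -L := by
        push_cast
        ring
      rw [hexp] at h1
      have h2 := hcon j (by omega)
      have h3 : ‖Real.exp (-L) • e (t + (j + 1 : ℕ) * L)‖ ≤ r := by
        rw [norm_smul, Real.norm_eq_abs, Real.abs_exp]
        exact (mul_le_mul_of_nonneg_left (hD _ (h0.trans hle)) (Real.exp_pos _).le).trans hLD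
      have h4 := norm_sub_norm_le (e (t + j * L)) (Real.exp (-L) • e (t + (j + 1 : ℕ) * L))
      have h5 : k * r ^ 2 ≤ k * ‖e (t + j * L) - Real.exp (-L) • e (t + (j + 1 : ℕ) * L)‖ ^ 2 := by
        gcongr
        linarith
      have h6 := ih (by omega)
      push_cast at h1 h5 ⊢
      linarith
  have h1 := hstep N le_rfl
  have h2 := hm (t + N * L) (by positivity)
  have h3 := hA t ht
  linarith

end path

section flow

variable {u : ℝ → Sph n → ℝ}

theorem sphereMeasure_univ (n : ℕ) :
    sphereMeasure n univ = ((n + 1 : ℕ) : ENNReal) * volume (ball (0 : Eucl n) 1) := by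
  rw [Measure.toSphere_apply_univ, finrank_euclideanSpace_fin]

theorem totalVolume_eq_of_volume_eq {Ω : ConvexBody (Eucl n)} (hu : IsPositiveSolution u)
    (hvol : volume (Ω : Set (Eucl n)) = volume (ball (0 : Eucl n) 1))
    (h : ∀ x, u 0 x = supportFn Ω 0 x) : totalVolume u 0 = (sphereMeasure n).real univ := by
  have h1 := hu.volume_wulff le_rfl
  rw [← coe_eq_wulff h, hvol, ← sphereMeasure_univ] at h1
  rw [Measure.real, h1, ENNReal.toReal_ofReal]
  exact integral_nonneg fun x => (hu.coneDensity_pos le_rfl x).le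

theorem volume_eq_of_totalVolume_eq {Ω : ConvexBody (Eucl n)} (hu : IsPositiveSolution u)
    {t : ℝ} (ht : 0 ≤ t) (h0 : totalVolume u t = (sphereMeasure n).real univ)
    (h : ∀ x, supportFn Ω 0 x = u t x) :
    volume (Ω : Set (Eucl n)) = volume (ball (0 : Eucl n) 1) := by
  have h1 := hu.volume_wulff ht
  rw [← coe_eq_wulff fun x => (h x).symm, h0, Measure.real,
    ENNReal.ofReal_toReal (measure_ne_top _ _), sphereMeasure_univ] at h1
  exact (ENNReal.mul_right_inj (by positivity) (ENNReal.natCast_ne_top _)).mp h1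

/-- The convex bodies whose support functions are the values of a solution. -/
theorem exists_bodies {Ω₀ : ConvexBody (Eucl n)} (hu : IsPositiveSolution u)
    (h : ∀ x, u 0 x = supportFn Ω₀ 0 x) :
    ∃ Ω : ℝ → ConvexBody (Eucl n), Ω 0 = Ω₀ ∧ ∀ t, 0 ≤ t → ∀ x, supportFn (Ω t) 0 x = u t x := by
  have hs : ∀ t (ht : 0 ≤ t) x, supportFn (wulffBody (u t) (hu.isC2 ht) (hu.pos t ht)) 0 x = u t x :=
    fun t ht => supportFn_wulffBody (hu.isC2 ht) (hu.convex t ht) (hu.pos t ht)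
  refine ⟨fun t => if ht : 0 ≤ t then wulffBody (u t) (hu.isC2 ht) (hu.pos t ht) else Ω₀, ?_, ?_⟩
  · beta_reduce
    rw [dif_pos le_rfl]
    -- The body built from `u 0` is the given one because the support function determines a convex
    -- body.
    exact eq_of_supportFn_eq fun x => (hs 0 le_rfl x).trans (h x)
  · intro t ht x
    beta_reduce
    rw [dif_pos ht]
    exact hs t ht x

variable {Ω₁ Ω₂ : ConvexBody (Eucl n)} {t₁ t₂ : ℝ}

theorem Adm.of_flow (hu : IsPositiveSolution u) (ht₁ : 0 ≤ t₁) (h12 : t₁ ≤ t₂)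
    (h₁ : ∀ x, supportFn Ω₁ 0 x = u t₁ x) (h₂ : ∀ x, supportFn Ω₂ 0 x = u t₂ x) {z : Eucl n}
    (hz : Adm Ω₂ z) : Adm Ω₁ (Real.exp (t₁ - t₂) • z) := by
  intro x
  rw [supportFn_eq_sub, h₁, inner_smul_right]
  refine hu.shifted_pos ht₁ h12 ?_
  rw [← h₂, ← supportFn_eq_sub]
  exact hz x

theorem meanLog_le_of_flow (hu : IsPositiveSolution u)
    (h0 : totalVolume u 0 = (sphereMeasure n).real univ) (ht₁ : 0 ≤ t₁) (h12 : t₁ ≤ t₂)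
    (h₁ : ∀ x, supportFn Ω₁ 0 x = u t₁ x) (h₂ : ∀ x, supportFn Ω₂ 0 x = u t₂ x) {z : Eucl n}
    (hz : Adm Ω₂ z) : meanLog Ω₂ z ≤ meanLog Ω₁ (Real.exp (t₁ - t₂) • z) := by
  have h := hu.integral_log_le h0 ht₁ h12 (z := z) fun x => by
    rw [← h₂, ← supportFn_eq_sub]
    exact hz x
  simp only [meanLog, supportFn_eq_sub _ z, supportFn_eq_sub _ (Real.exp (t₁ - t₂) • z), h₁, h₂,
    inner_smul_right]
  gcongr

theorem entropy_le_of_flow (hu : IsPositiveSolution u)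
    (h0 : totalVolume u 0 = (sphereMeasure n).real univ) (ht₁ : 0 ≤ t₁) (h12 : t₁ ≤ t₂)
    (h₁ : ∀ x, supportFn Ω₁ 0 x = u t₁ x) (h₂ : ∀ x, supportFn Ω₂ 0 x = u t₂ x)
    (hv : 0 < volume (Ω₂ : Set (Eucl n))) : entropy Ω₂ ≤ entropy Ω₁ := by
  obtain ⟨p, hp⟩ := exists_adm hv
  refine csSup_le ⟨_, p, hp, rfl⟩ ?_
  rintro _ ⟨z, hz, rfl⟩
  exact (meanLog_le_of_flow hu h0 ht₁ h12 h₁ h₂ hz).trans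
    (Adm.of_flow hu ht₁ h12 h₁ h₂ hz).meanLog_le_entropy

end flow

end Conclusion

end GaussFlow

end

/-! ### The main theorem. -/

theorem theoremC0 (n : ℕ) (hn : 1 ≤ n) (A : ℝ) :
    ∃ δ : ℝ, 0 < δ ∧
      ∀ Ω₀ : ConvexBody (GaussFlow.Eucl n),
        MeasureTheory.volume (Ω₀ : Set (GaussFlow.Eucl n)) =
          MeasureTheory.volume (Metric.ball (0 : GaussFlow.Eucl n) 1) →
        GaussFlow.entropy Ω₀ ≤ A →
        ∃ ε : ℝ, 0 < ε ∧ ∃ Λ : ℝ, 0 < Λ ∧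
          ∀ u : ℝ → GaussFlow.Sph n → ℝ,
            GaussFlow.IsPositiveSolution u →
            (∀ x, u 0 x = GaussFlow.supportFn Ω₀ 0 x) →
            (∀ t, 0 ≤ t → ∀ x, ε ≤ u t x) ∧
            (∀ t, 0 ≤ t → ∀ x, u t x ≤ Λ) ∧
            ∃ Ω : ℝ → ConvexBody (GaussFlow.Eucl n),
              Ω 0 = Ω₀ ∧
              (∀ t, 0 ≤ t → ∀ x, GaussFlow.supportFn (Ω t) 0 x = u t x) ∧
              ∃ e : ℝ → GaussFlow.Eucl n,
                (∀ t, 0 ≤ t → ∀ z, GaussFlow.IsEntropyPoint (Ω t) z ↔ z = e t) ∧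
                Filter.Tendsto e Filter.atTop (nhds 0) ∧
                ∀ t, 0 ≤ t →
                  δ ≤ Metric.infDist (e t) (frontier (Ω t : Set (GaussFlow.Eucl n))) := by
  open GaussFlow in
  have hball : 0 < MeasureTheory.volume (Metric.ball (0 : Eucl n) 1) :=
    Metric.measure_ball_pos _ _ one_pos
  obtain ⟨D, hD, hdiam⟩ := exists_diam_le n A
  obtain ⟨δ, hδ, hmax⟩ := exists_maximizer n hball D
  obtain ⟨c, hc, hstab⟩ := exists_stability n
  have hk : 0 < 2 * c / D ^ 2 := by positivity
  -- With `r = δ/4` the entropy point comes within `δ/2` of the origin, half of its distance to the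
  -- boundary. All constants are fixed before `Ω₀` is given.
  obtain ⟨N, L, hL, hnear⟩ := exists_norm_le_of_contraction (F := Eucl n) (D := D)
    (m := Real.log δ) (A := A) (r := δ / 4) hk (by positivity)
  refine ⟨δ, hδ, fun Ω₀ hvol hA => ⟨Real.exp (-(N * L)) * (δ / 2), by positivity, D, hD,
    fun u hu hu0 => ?_⟩⟩
  have h0 := totalVolume_eq_of_volume_eq hu hvol hu0
  obtain ⟨Ω, hΩ0, hΩ⟩ := exists_bodies hu hu0
  have hv : ∀ t, 0 ≤ t → MeasureTheory.volume (Ω t : Set (Eucl n)) =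
      MeasureTheory.volume (Metric.ball (0 : Eucl n) 1) := fun t ht =>
    volume_eq_of_totalVolume_eq hu ht (hu.totalVolume_const h0 ht) (hΩ t ht)
  have hvpos : ∀ t, 0 ≤ t → 0 < MeasureTheory.volume (Ω t : Set (Eucl n)) := fun t ht => by
    rw [hv t ht]
    exact hball
  have hEA : ∀ t, 0 ≤ t → entropy (Ω t) ≤ A := fun t ht =>
    (entropy_le_of_flow hu h0 le_rfl ht (hΩ 0 le_rfl) (hΩ t ht) (hvpos t ht)).trans
      (hΩ0.symm ▸ hA)
  have hdiamt : ∀ t, 0 ≤ t → Metric.diam (Ω t : Set (Eucl n)) ≤ D := fun t ht =>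
    hdiam _ (hvpos t ht) (hEA t ht)
  have hex : ∀ t, ∃ e, 0 ≤ t → (∀ x, δ ≤ supportFn (Ω t) e x) ∧
      meanLog (Ω t) e = entropy (Ω t) := by
    intro t
    by_cases ht : 0 ≤ t
    · obtain ⟨e, he⟩ := hmax (Ω t) (hv t ht).ge (hdiamt t ht)
      exact ⟨e, fun _ => he⟩
    · exact ⟨0, fun h => absurd h ht⟩
  choose e he using hex
  have hadm : ∀ t, 0 ≤ t → Adm (Ω t) (e t) := fun t ht x => hδ.trans_le ((he t ht).1 x)
  have hmem0 : ∀ t, 0 ≤ t → (0 : Eucl n) ∈ Ω t := fun t ht => Adm.mem fun x => by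
    rw [hΩ t ht]
    exact hu.pos t ht x
  have henorm : ∀ t, 0 ≤ t → ‖e t‖ ≤ D := fun t ht => by
    have h1 := subset_closedBall_diam (hmem0 t ht) (hadm t ht).mem
    rw [mem_closedBall_zero_iff] at h1
    exact h1.trans (hdiamt t ht)
  have hElow : ∀ t, 0 ≤ t → Real.log δ ≤ entropy (Ω t) := fun t ht =>
    ((hadm t ht).le_meanLog hδ (he t ht).1).trans (he t ht).2.le
  have hcontr : ∀ t T, 0 ≤ t → t ≤ T →
      2 * c / D ^ 2 * ‖e t - Real.exp (t - T) • e T‖ ^ 2 ≤ entropy (Ω t) - entropy (Ω T) := by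
    intro t T ht hT
    have hT0 := ht.trans hT
    have ha := Adm.of_flow hu ht hT (hΩ t ht) (hΩ T hT0) (hadm T hT0)
    have h1 := meanLog_le_of_flow hu h0 ht hT (hΩ t ht) (hΩ T hT0) (hadm T hT0)
    -- Apply stability to `e t` and the transported point `e^{t-T} e(T)`, whose mean logarithm is at
    -- least the entropy at time `T`. The midpoint average costs the factor `2` in `k`.
    have h2 := hstab (Ω t) D (hdiamt t ht) (e t) _ (hadm t ht) ha.mem
      (MeasureTheory.ae_of_all _ ha) ha.integrable_log
    rw [(he T hT0).2] at h1
    rw [(he t ht).2] at h2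
    have h3 : 2 * c / D ^ 2 * ‖e t - Real.exp (t - T) • e T‖ ^ 2 =
        2 * (c * (‖e t - Real.exp (t - T) • e T‖ ^ 2 / D ^ 2)) := by ring
    linarith
  refine ⟨fun t ht x => ?_, fun t ht x => ?_, Ω, hΩ0, hΩ, e, fun t ht z =>
    isEntropyPoint_iff (hadm t ht) (he t ht).2 z,
    tendsto_zero_of_contraction hk henorm hElow hcontr, fun t ht =>
    le_infDist_frontier hδ.le (he t ht).1⟩
  -- At the time `t + jL` the support function is at least `δ - δ/2`; going back to `t` costs at
  -- most the factor `e^{-NL}`.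
  · obtain ⟨j, hj, hej⟩ := hnear e (fun t => entropy (Ω t)) henorm hElow hEA hcontr t ht
    have ht' : 0 ≤ t + j * L := by positivity
    have h1 := (he _ ht').1 x
    rw [supportFn_eq_sub, hΩ _ ht'] at h1
    have h2 : -(2 * (δ / 4)) ≤ inner ℝ (x : Eucl n) (e (t + j * L)) := by
      have h3 := abs_real_inner_le_norm (x : Eucl n) (e (t + j * L))
      rw [sph_norm, one_mul] at h3
      exact (abs_le.mp (h3.trans hej)).1
    have h4 : Real.exp (-(t + j * L)) * u (t + j * L) x ≤ Real.exp (-t) * u t x :=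
      hu.exp_mul_antitone x ht ht' (by linarith [mul_nonneg (Nat.cast_nonneg (α := ℝ) j) hL])
    have h5 : Real.exp (-(t + j * L)) = Real.exp (-t) * Real.exp (-(j * L)) := by
      rw [← Real.exp_add]
      ring_nf
    rw [h5, mul_assoc] at h4
    have h6 := le_of_mul_le_mul_left h4 (Real.exp_pos _)
    refine le_trans ?_ h6
    have h7 : (j : ℝ) * L ≤ N * L := by gcongr
    gcongr
    linarith
  · rw [← hΩ t ht]
    exact supportFn_le ((subset_closedBall_diam (hmem0 t ht)).trans
      (Metric.closedBall_subset_closedBall (hdiamt t ht))) x
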